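/- Let $G=(V,E)$ be an Euler digraph: a finite digraph with node set $V\neq\emptyset$, in which parallel edges but no loops are allowed, such that every node has as many incoming as outgoing edges ($G$ need not be connected). Let $M\subseteq E$ be a perfect matching of $G$, that is, every node is an endpoint of exactly one edge of $M$. With $V=\{0,\dots,n-1\}$, the sign of a perfect matching is the parity ($(-1)^k$, where $k$ is the number of inversions) of the permutation of $V$ obtained by writing down the edges of the matching one after another, in any order, each as its tail followed by its head. Let $\alpha(n)=\min\{k\ge 0: A_k(1)\ge n\}$ be the inverse Ackermann function, where $A_0(j)=j+1$ and $A_{k+1}(j)=A_k^{(j+1)}(j)$ is the result of applying $A_k$ to $j$ successively $j+1$ times. Then a perfect matching $M'$ of $G$ of opposite sign can be found in time $O(|E|\cdot\max\{1,\alpha(|V|)\})$ (which is $O(|E|\cdot\alpha(|V|))$ as soon as $|V|\ge 3$). That is, there are a single program for a random access machine and constants $C$ and $c$ such that for all such $G$ and $M$, given as a list of the edges (tail, head, and whether the edge is in $M$), the program terminates after at most $C\,|E|\max\{1,\alpha(|V|)\}$ steps and outputs the indicator array of a perfect matching $M'$ of $G$ whose sign is opposite to that of $M$. The machine has finitely many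 registers and zero-initialised, indirectly addressed arrays; each step copies a word, loads a constant, adds or subtracts (truncated at zero) two words, reads or writes an array cell, does nothing, or compares two words, and every number that occurs is smaller than $(|V|+|E|+2)^c$, so words have $O(\log(|V|+|E|))$ bits. -/

import Mathlib

/-! ### Digraphs, Eulerian digraphs, perfect matchings and their signs -/

/-- A finite digraph with node set `{0, …, n - 1}` and edges numbered `0, …, m - 1`.
Edge `e` is oriented from `tail e` to `head e`. Parallel edges are allowed, loops are not. -/
structure MultiDigraph (n m : ℕ) where
  tail : Fin m → Fin n
  head : Fin m → Fin n
  loopless : ∀ e, tail e ≠ head e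

namespace MultiDigraph

variable {n m : ℕ} (G : MultiDigraph n m)

/-- Every node has as many incoming as outgoing edges. -/
def IsEuler : Prop :=
  ∀ v : Fin n,
    (Finset.univ.filter fun e => G.head e = v).card =
      (Finset.univ.filter fun e => G.tail e = v).card

/-- Every node is an endpoint of exactly one edge of `M`. -/
def IsPerfectMatching (M : Finset (Fin m)) : Prop :=
  ∀ v : Fin n, ∃! e : Fin m, e ∈ M ∧ (G.tail e = v ∨ G.head e = v)

/-- The endpoints of the listed edges, each edge written in the order of its orientation. -/
def endpoints : List (Fin m) → List (Fin n)
  | [] => []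
  | e :: l => G.tail e :: G.head e :: endpoints l

end MultiDigraph

/-- The number of pairs of positions `i < j` in a list whose `i`-th entry exceeds the `j`-th. -/
def inversions {n : ℕ} : List (Fin n) → ℕ
  | [] => 0
  | a :: l => l.countP (fun b => b < a) + inversions l

namespace MultiDigraph

variable {n m : ℕ} (G : MultiDigraph n m)

/-- The sign of a perfect matching `M`: the parity of the permutation of the nodes that is
obtained by writing down the endpoints of the edges of `M`, each edge in the order of its
orientation. The edges are taken here in increasing order of their numbers;
`sign_eq_of_toFinset_eq` shows that any other order gives the same sign. -/
def sign (M : Finset (Fin m)) : ℤ :=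
  (-1) ^ inversions (G.endpoints ((List.finRange m).filter fun e => e ∈ M))

theorem endpoints_perm {l l' : List (Fin m)} (h : l.Perm l') :
    (G.endpoints l).Perm (G.endpoints l') := by
  induction h with
  | nil => exact List.Perm.refl _
  | cons e _ ih => exact (ih.cons _).cons _
  | swap e f l =>
    have h := (List.perm_append_comm (l₁ := [G.tail f, G.head f])
      (l₂ := [G.tail e, G.head e])).append_right (G.endpoints l)
    exact h
  | trans _ _ h₁ h₂ => exact h₁.trans h₂

theorem neg_one_pow_inversions_eq {l l' : List (Fin m)} (h : l.Perm l')
    (hn : (G.endpoints l).Nodup) :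
    (-1 : ℤ) ^ inversions (G.endpoints l) = (-1 : ℤ) ^ inversions (G.endpoints l') := by
  induction h with
  | nil => rfl
  | @cons e l l' h ih =>
    have hp := G.endpoints_perm h
    have hn' : (G.endpoints l).Nodup := by
      simp only [endpoints, List.nodup_cons] at hn
      exact hn.2.2
    simp only [endpoints, inversions, List.countP_cons, pow_add, ih hn',
      hp.countP_eq]
  | swap e f l =>
    simp only [endpoints, List.nodup_cons, List.mem_cons, not_or] at hn
    obtain ⟨⟨_, h₁, h₂, _⟩, ⟨h₃, h₄, _⟩, _⟩ := hn
    have key : ∀ a b : Fin n, a ≠ b →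
        (if decide (a < b) = true then 1 else 0) + (if decide (b < a) = true then 1 else 0) = 1 := by
      intro a b hab
      rcases lt_or_gt_of_ne hab with h | h <;> simp [h, h.le]
    have k₁ := key _ _ h₁
    have k₂ := key _ _ h₂
    have k₃ := key _ _ h₃
    have k₄ := key _ _ h₄
    apply neg_one_pow_congr
    simp only [endpoints, inversions, List.countP_cons]
    grind
  | trans h₁ _ ih₁ ih₂ => exact (ih₁ hn).trans (ih₂ ((G.endpoints_perm h₁).nodup_iff.1 hn))

theorem mem_endpoints {l : List (Fin m)} {v : Fin n} :
    v ∈ G.endpoints l ↔ ∃ e ∈ l, G.tail e = v ∨ G.head e = v := by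
  induction l with
  | nil => simp [endpoints]
  | cons e l ih =>
    simp only [endpoints, List.mem_cons, ih]
    grind

theorem nodup_endpoints {M : Finset (Fin m)} (hM : G.IsPerfectMatching M) {l : List (Fin m)}
    (hl : l.Nodup) (hs : ∀ e ∈ l, e ∈ M) : (G.endpoints l).Nodup := by
  induction l with
  | nil => simp [endpoints]
  | cons e l ih =>
    have hne := G.loopless e
    have hu : ∀ v, (G.tail e = v ∨ G.head e = v) → v ∉ G.endpoints l := by
      intro v hv hmem
      obtain ⟨f, hf, hfv⟩ := G.mem_endpoints.1 hmem
      have := (hM v).unique ⟨hs f (by simp [hf]), hfv⟩ ⟨hs e (by simp), hv⟩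
      subst this
      exact (List.nodup_cons.1 hl).1 hf
    simp only [endpoints, List.nodup_cons, List.mem_cons, not_or]
    exact ⟨⟨hne, hu _ (Or.inl rfl)⟩, hu _ (Or.inr rfl),
      ih (List.nodup_cons.1 hl).2 fun f hf => hs f (by simp [hf])⟩

/-- The sign of a perfect matching does not depend on the order of its edges. -/
theorem sign_eq_of_toFinset_eq {M : Finset (Fin m)} (hM : G.IsPerfectMatching M)
    {l : List (Fin m)} (hl : l.Nodup) (hs : l.toFinset = M) :
    (-1 : ℤ) ^ inversions (G.endpoints l) = G.sign M := by
  subst hs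
  apply G.neg_one_pow_inversions_eq
  · rw [List.perm_ext_iff_of_nodup hl ((List.nodup_finRange m).filter _)]
    simp
  · exact G.nodup_endpoints hM hl (by simp)

end MultiDigraph

/-! ### The inverse Ackermann function -/

/-- The Ackermann hierarchy `A₀(j) = j + 1` and `Aₖ₊₁(j) = Aₖ(Aₖ(⋯ Aₖ(j)⋯))`, with `j + 1`
applications of `Aₖ`. -/
def ackermannLevel : ℕ → ℕ → ℕ
  | 0 => fun j => j + 1
  | k + 1 => fun j => (ackermannLevel k)^[j + 1] j

theorem lt_ackermannLevel (k j : ℕ) : j < ackermannLevel k j := by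
  induction k generalizing j with
  | zero => simp [ackermannLevel]
  | succ k ih =>
    have h : ∀ i, j < (ackermannLevel k)^[i + 1] j := by
      intro i
      induction i with
      | zero => simpa using ih j
      | succ i hi => rw [Function.iterate_succ_apply']; exact hi.trans (ih _)
    exact h j

theorem le_ackermannLevel_one (k : ℕ) : k ≤ ackermannLevel k 1 := by
  induction k with
  | zero => simp
  | succ k ih =>
    have h : ackermannLevel (k + 1) 1 = ackermannLevel k (ackermannLevel k 1) := rfl
    have := lt_ackermannLevel k (ackermannLevel k 1)
    omega

/-- The inverse Ackermann function `α(n) = min {k : Aₖ(1) ≥ n}`. -/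
def inverseAckermann (n : ℕ) : ℕ :=
  Nat.find (p := fun k => n ≤ ackermannLevel k 1) ⟨n, le_ackermannLevel_one n⟩

/-! ### A random access machine with unit-cost instructions and bounded words

The machine has registers and several memory arrays, all indexed by natural numbers and holding
natural numbers. A program is a finite text and hence mentions only finitely many registers and
arrays; array cells are addressed indirectly, by the contents of a register. -/

/-- The contents of the registers, and of the cells of the memory arrays: `mem a i` is the content
of cell `i` of array `a`. -/
structure RAMState where
  reg : ℕ → ℕ
  mem : ℕ → ℕ → ℕ

/-- Write `x` into register `r`. -/
def RAMState.setReg (s : RAMState) (r x : ℕ) : RAMState :=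
  { s with reg := Function.update s.reg r x }

/-- Write `x` into cell `i` of array `a`. -/
def RAMState.setMem (s : RAMState) (a i x : ℕ) : RAMState :=
  { s with mem := Function.update s.mem a (Function.update (s.mem a) i x) }

/-- Tests: comparison of the contents of two registers. -/
inductive RAMTest where
  | eq (r₁ r₂ : ℕ)
  | lt (r₁ r₂ : ℕ)

/-- The test is passed in the given state. -/
def RAMTest.Holds : RAMTest → RAMState → Prop
  | .eq r₁ r₂, s => s.reg r₁ = s.reg r₂
  | .lt r₁ r₂, s => s.reg r₁ < s.reg r₂

/-- Programs. The numbers `r`, `r₁`, `r₂` name registers, `a` names an array. -/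
inductive RAMProgram where
  /-- do nothing -/
  | skip
  /-- `r := x` for a constant `x` -/
  | const (r x : ℕ)
  /-- `r := r₁` -/
  | copy (r r₁ : ℕ)
  /-- `r := r₁ + r₂` -/
  | add (r r₁ r₂ : ℕ)
  /-- `r := r₁ - r₂`, which is `0` if `r₁ < r₂` -/
  | sub (r r₁ r₂ : ℕ)
  /-- `r := a[r₁]` -/
  | load (r a r₁ : ℕ)
  /-- `a[r₁] := r₂` -/
  | store (a r₁ r₂ : ℕ)
  /-- first `P`, then `Q` -/
  | seq (P Q : RAMProgram)
  /-- if the test is passed then `P`, else `Q` -/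
  | branch (b : RAMTest) (P Q : RAMProgram)
  /-- while the test is passed do `P` -/
  | loop (b : RAMTest) (P : RAMProgram)

/-- `RAMRun W P s s' t`: on a machine whose words hold the numbers less than `W`, program `P`
started in state `s` terminates in state `s'` after exactly `t` steps, where every elementary
instruction and every evaluation of a test is one step. There is no run that would produce a number
that does not fit into a word (the instructions without a bound only copy numbers or make them
smaller). -/
inductive RAMRun (W : ℕ) : RAMProgram → RAMState → RAMState → ℕ → Prop where
  | skip (s : RAMState) : RAMRun W .skip s s 1
  | const (s : RAMState) (r x : ℕ) (h : x < W) :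
      RAMRun W (.const r x) s (s.setReg r x) 1
  | copy (s : RAMState) (r r₁ : ℕ) :
      RAMRun W (.copy r r₁) s (s.setReg r (s.reg r₁)) 1
  | add (s : RAMState) (r r₁ r₂ : ℕ) (h : s.reg r₁ + s.reg r₂ < W) :
      RAMRun W (.add r r₁ r₂) s (s.setReg r (s.reg r₁ + s.reg r₂)) 1
  | sub (s : RAMState) (r r₁ r₂ : ℕ) :
      RAMRun W (.sub r r₁ r₂) s (s.setReg r (s.reg r₁ - s.reg r₂)) 1
  | load (s : RAMState) (r a r₁ : ℕ) :
      RAMRun W (.load r a r₁) s (s.setReg r (s.mem a (s.reg r₁))) 1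
  | store (s : RAMState) (a r₁ r₂ : ℕ) :
      RAMRun W (.store a r₁ r₂) s (s.setMem a (s.reg r₁) (s.reg r₂)) 1
  | seq {P Q : RAMProgram} {s s₁ s₂ : RAMState} {t₁ t₂ : ℕ}
      (hP : RAMRun W P s s₁ t₁) (hQ : RAMRun W Q s₁ s₂ t₂) :
      RAMRun W (.seq P Q) s s₂ (t₁ + t₂)
  | branch_true {b : RAMTest} {P Q : RAMProgram} {s s' : RAMState} {t : ℕ}
      (hb : b.Holds s) (hP : RAMRun W P s s' t) :
      RAMRun W (.branch b P Q) s s' (t + 1)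
  | branch_false {b : RAMTest} {P Q : RAMProgram} {s s' : RAMState} {t : ℕ}
      (hb : ¬ b.Holds s) (hQ : RAMRun W Q s s' t) :
      RAMRun W (.branch b P Q) s s' (t + 1)
  | loop_true {b : RAMTest} {P : RAMProgram} {s s₁ s₂ : RAMState} {t₁ t₂ : ℕ}
      (hb : b.Holds s) (hP : RAMRun W P s s₁ t₁) (hL : RAMRun W (.loop b P) s₁ s₂ t₂) :
      RAMRun W (.loop b P) s s₂ (t₁ + t₂ + 1)
  | loop_false {b : RAMTest} {P : RAMProgram} {s : RAMState} (hb : ¬ b.Holds s) :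
      RAMRun W (.loop b P) s s 1

/-! ### Input and output -/

/-- The indicator array of a set of edges. -/
def edgeFlags {m : ℕ} (M : Finset (Fin m)) (i : ℕ) : ℕ :=
  if h : i < m then (if (⟨i, h⟩ : Fin m) ∈ M then 1 else 0) else 0

/-- The initial state for a digraph with a set of edges, given as a bare list of edges:
registers `0` and `1` hold the number of nodes and of edges, cell `e` of the arrays `0`, `1` and `2`
holds the tail of edge `e`, the head of edge `e`, and whether `e` belongs to `M`; everything else
is `0`. -/
def initialState {n m : ℕ} (G : MultiDigraph n m) (M : Finset (Fin m)) : RAMState where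
  reg
    | 0 => n
    | 1 => m
    | _ => 0
  mem
    | 0 => fun i => if h : i < m then (G.tail ⟨i, h⟩ : ℕ) else 0
    | 1 => fun i => if h : i < m then (G.head ⟨i, h⟩ : ℕ) else 0
    | 2 => edgeFlags M
    | _ => fun _ => 0

/-- The set of edges that a state presents as output: array `3` holds its indicator on the cells
`0, …, m - 1`. -/
def IsOutput {m : ℕ} (s : RAMState) (M : Finset (Fin m)) : Prop :=
  ∀ i < m, s.mem 3 i = edgeFlags M i

/-! Suppose that a node u is entered by a matching edge e from w and by no other edge. By Euler's
condition a single edge f leaves u, say to v. If v = w, then exchanging the antiparallel edges e and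
f transposes two neighbouring entries of the word of endpoints, so the sign changes. If v ≠ w,
contract u, v and w to one node. This deletes e and f, the digraph stays Eulerian, and the matching
without e is a perfect matching of it. Let A be a matching of opposite sign in the contracted
digraph. It covers the new node in v or in w, because no other edge meets u. In the first case add e
to A, in the second add f. The parities still differ after this: in the second case because passing
from w u … v … to u v … w … is an even rearrangement (`PermSign.rotate`). This is
`IsOppositeMatching.undo`.

Nodes u of this kind are produced by deleting closed walks of non-matching edges, which respects
Euler's condition. The search walks backwards along non-matching edges and keeps its path on a
stack. When it meets a class of the stack again, it discards the closed walk. When no unscanned edge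
enters the topmost class, counting degrees (`IsBalanced`) shows that its matching edge enters it and
that, unless it is the only class on the stack, nothing leaves it but the stack edge f. Then e and f
are exchanged or contracted. If it is the only class, the search restarts at the tail of its
matching edge, where some unscanned edge must enter (`SearchState.exists_unscanned`). Every step
lowers `searchWeight`, so after O(|V| + |E|) steps the search must have found antiparallel edges;
this also proves that the second matching exists.

The classes are kept in a disjoint set forest with union by rank and path compression. The potential
`forestPotential` bounds the amortized cost of a root query by O(α(|V|)): among the path nodes of
equal height all but the last lose potential (`IsSetForest.compressPath_amortized`).

To undo a contraction one must know whether a node lies in v or in w, but the compressed forest no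
longer tells. Instead the nodes receive positions such that every class that ever occurred lies in
an interval, with v before u before w. One comparison with a stored threshold then decides
(`IsNested.of_split`), so that undoing all contractions takes linear time. -/

/-! ### Weakest preconditions for random access machine programs -/

/-- Program `P`, started in state `s`, terminates in a state and after a number of steps that
satisfy `Q`. -/
def Wp (W : ℕ) (P : RAMProgram) (s : RAMState) (Q : RAMState → ℕ → Prop) : Prop :=
  ∃ s' t, RAMRun W P s s' t ∧ Q s' t

namespace Wp

variable {W : ℕ} {s : RAMState} {Q Q' : RAMState → ℕ → Prop}

theorem mono {P : RAMProgram} (h : Wp W P s Q) (hQ : ∀ s' t, Q s' t → Q' s' t) :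
    Wp W P s Q' := by
  obtain ⟨s', t, hr, hq⟩ := h
  exact ⟨s', t, hr, hQ _ _ hq⟩

/-- Each instruction has exactly one rule for its runs. The equivalences, used as rewrite rules,
therefore turn a straight-line program into a condition on an explicitly updated state and an
explicit step count. Only loops need invariants. -/
theorem skip_iff : Wp W .skip s Q ↔ Q s 1 := by
  constructor
  · rintro ⟨s', t, hr, hq⟩; cases hr; exact hq
  · exact fun h => ⟨_, _, .skip s, h⟩

theorem const_iff {r x : ℕ} : Wp W (.const r x) s Q ↔ x < W ∧ Q (s.setReg r x) 1 := by
  constructor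
  · rintro ⟨s', t, hr, hq⟩; cases hr with | const _ _ _ h => exact ⟨h, hq⟩
  · exact fun h => ⟨_, _, .const s r x h.1, h.2⟩

theorem copy_iff {r r₁ : ℕ} : Wp W (.copy r r₁) s Q ↔ Q (s.setReg r (s.reg r₁)) 1 := by
  constructor
  · rintro ⟨s', t, hr, hq⟩; cases hr; exact hq
  · exact fun h => ⟨_, _, .copy s r r₁, h⟩

theorem add_iff {r r₁ r₂ : ℕ} : Wp W (.add r r₁ r₂) s Q ↔
    s.reg r₁ + s.reg r₂ < W ∧ Q (s.setReg r (s.reg r₁ + s.reg r₂)) 1 := by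
  constructor
  · rintro ⟨s', t, hr, hq⟩; cases hr with | add _ _ _ _ h => exact ⟨h, hq⟩
  · exact fun h => ⟨_, _, .add s r r₁ r₂ h.1, h.2⟩

theorem sub_iff {r r₁ r₂ : ℕ} : Wp W (.sub r r₁ r₂) s Q ↔
    Q (s.setReg r (s.reg r₁ - s.reg r₂)) 1 := by
  constructor
  · rintro ⟨s', t, hr, hq⟩; cases hr; exact hq
  · exact fun h => ⟨_, _, .sub s r r₁ r₂, h⟩

theorem load_iff {r a r₁ : ℕ} : Wp W (.load r a r₁) s Q ↔
    Q (s.setReg r (s.mem a (s.reg r₁))) 1 := by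
  constructor
  · rintro ⟨s', t, hr, hq⟩; cases hr; exact hq
  · exact fun h => ⟨_, _, .load s r a r₁, h⟩

theorem store_iff {a r₁ r₂ : ℕ} : Wp W (.store a r₁ r₂) s Q ↔
    Q (s.setMem a (s.reg r₁) (s.reg r₂)) 1 := by
  constructor
  · rintro ⟨s', t, hr, hq⟩; cases hr; exact hq
  · exact fun h => ⟨_, _, .store s a r₁ r₂, h⟩

theorem seq_iff {P₁ P₂ : RAMProgram} : Wp W (.seq P₁ P₂) s Q ↔
    Wp W P₁ s fun s₁ t₁ => Wp W P₂ s₁ fun s₂ t₂ => Q s₂ (t₁ + t₂) := by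
  constructor
  · rintro ⟨s', t, hr, hq⟩
    cases hr with | seq h₁ h₂ => exact ⟨_, _, h₁, _, _, h₂, hq⟩
  · rintro ⟨s₁, t₁, h₁, s₂, t₂, h₂, hq⟩
    exact ⟨_, _, .seq h₁ h₂, hq⟩

theorem branch_iff {b : RAMTest} {P₁ P₂ : RAMProgram} : Wp W (.branch b P₁ P₂) s Q ↔
    (b.Holds s → Wp W P₁ s fun s' t => Q s' (t + 1)) ∧
      (¬ b.Holds s → Wp W P₂ s fun s' t => Q s' (t + 1)) := by
  constructor
  · rintro ⟨s', t, hr, hq⟩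
    cases hr with
    | branch_true hb h => exact ⟨fun _ => ⟨_, _, h, hq⟩, fun h' => absurd hb h'⟩
    | branch_false hb h => exact ⟨fun h' => absurd h' hb, fun _ => ⟨_, _, h, hq⟩⟩
  · rintro ⟨h₁, h₂⟩
    by_cases hb : b.Holds s
    · obtain ⟨s', t, hr, hq⟩ := h₁ hb
      exact ⟨_, _, .branch_true hb hr, hq⟩
    · obtain ⟨s', t, hr, hq⟩ := h₂ hb
      exact ⟨_, _, .branch_false hb hr, hq⟩

theorem loop_of_not {b : RAMTest} {P : RAMProgram} (hb : ¬ b.Holds s) (h : Q s 1) :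
    Wp W (.loop b P) s Q :=
  ⟨_, _, .loop_false hb, h⟩

theorem loop_of_holds {b : RAMTest} {P : RAMProgram} (hb : b.Holds s)
    (h : Wp W P s fun s₁ t₁ => Wp W (.loop b P) s₁ fun s₂ t₂ => Q s₂ (t₁ + t₂ + 1)) :
    Wp W (.loop b P) s Q := by
  obtain ⟨s₁, t₁, h₁, s₂, t₂, h₂, hq⟩ := h
  exact ⟨_, _, .loop_true hb h₁ h₂, hq⟩

/-- A loop whose invariant `I p s` carries a budget `p` that pays for every round. -/
theorem loop {b : RAMTest} {P : RAMProgram} {I : ℕ → RAMState → Prop}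
    (h : ∀ p s, I p s → b.Holds s →
      Wp W P s fun s' t => ∃ p', I p' s' ∧ p' + t + 1 ≤ p) {p : ℕ} (hI : I p s) :
    Wp W (.loop b P) s fun s' t => ∃ p', I p' s' ∧ ¬ b.Holds s' ∧ p' + t ≤ p + 1 := by
  induction p using Nat.strong_induction_on generalizing s with
  | _ p ih =>
    by_cases hb : b.Holds s
    · apply loop_of_holds hb
      refine (h p s hI hb).mono ?_
      rintro s' t ⟨p', hI', hp⟩
      refine (ih p' (by omega) hI').mono ?_
      rintro s'' t' ⟨p'', hI'', hb'', hp'⟩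
      exact ⟨p'', hI'', hb'', by omega⟩
    · exact loop_of_not hb ⟨p, hI, hb, le_rfl⟩

end Wp

namespace RAMState

variable (s : RAMState)

theorem reg_setReg (r x r' : ℕ) : (s.setReg r x).reg r' = if r' = r then x else s.reg r' := by
  simp [setReg, Function.update_apply]

theorem mem_setReg (r x : ℕ) : (s.setReg r x).mem = s.mem := rfl

theorem reg_setMem (a i x : ℕ) : (s.setMem a i x).reg = s.reg := rfl

theorem mem_setMem (a i x a' : ℕ) :
    (s.setMem a i x).mem a' = if a' = a then Function.update (s.mem a) i x else s.mem a' := by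
  simp only [setMem, Function.update_apply]

end RAMState

/-- Sequential composition of a list of programs. -/
def RAMProgram.block : List RAMProgram → RAMProgram
  | [] => .skip
  | [P] => P
  | P :: Q :: l => .seq P (block (Q :: l))

/-! ### The Ackermann potential -/

theorem ackermannLevel_iterate_le {k i j x : ℕ} (h : i ≤ j) :
    (ackermannLevel k)^[i] x ≤ (ackermannLevel k)^[j] x := by
  induction j, h using Nat.le_induction with
  | base => exact le_rfl
  | succ j _ ih =>
    rw [Function.iterate_succ_apply']
    exact ih.trans (lt_ackermannLevel k _).le

theorem ackermannLevel_mono (k : ℕ) : Monotone (ackermannLevel k) := by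
  induction k with
  | zero => intro x y h; simpa [ackermannLevel] using h
  | succ k ih =>
    intro x y h
    exact (ih.iterate (x + 1) h).trans (ackermannLevel_iterate_le (by omega))

/-- The value α(n) itself only gives a weak inequality. Ranks may reach n, and `ackermannHeight_lt`
needs them strictly below the top level, which is why the analysis runs with `a` equal to α(n) + 1.
-/
theorem ackermannLevel_succ_inverseAckermann (n : ℕ) :
    n < ackermannLevel (inverseAckermann n + 1) 1 := by
  have h : n ≤ ackermannLevel (inverseAckermann n) 1 :=
    Nat.find_spec (p := fun k => n ≤ ackermannLevel k 1) ⟨n, le_ackermannLevel_one n⟩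
  have h₁ : ackermannLevel (inverseAckermann n + 1) 1 =
    ackermannLevel (inverseAckermann n) (ackermannLevel (inverseAckermann n) 1) := rfl
  have := lt_ackermannLevel (inverseAckermann n) (ackermannLevel (inverseAckermann n) 1)
  omega

/-- The number of values `Aₖ(Aₖ(⋯ Aₖ(r)⋯))` with `k < a` and at most `r` applications of `Aₖ` that
exceed `q`: the potential of a node of rank `r` whose parent has rank `q`. -/
def ackermannGap (a r q : ℕ) : ℕ :=
  ((Finset.range a ×ˢ Finset.Icc 1 r).filter fun x => q < (ackermannLevel x.1)^[x.2] r).card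

/-- A root carries the potential `a * r`, so by this bound nothing has to be paid when it becomes a
child. -/
theorem ackermannGap_le (a r q : ℕ) : ackermannGap a r q ≤ a * r :=
  (Finset.card_filter_le _ _).trans (by simp)

theorem ackermannGap_anti (a r : ℕ) {q q' : ℕ} (h : q ≤ q') :
    ackermannGap a r q' ≤ ackermannGap a r q := by
  apply Finset.card_le_card
  intro x
  simp only [Finset.mem_filter]
  exact fun hx => ⟨hx.1, h.trans_lt hx.2⟩

theorem ackermannGap_lt {a r q q' k i : ℕ} (hk : k < a) (hi : 1 ≤ i) (hir : i ≤ r)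
    (hq : q < (ackermannLevel k)^[i] r) (hq' : (ackermannLevel k)^[i] r ≤ q') :
    ackermannGap a r q' < ackermannGap a r q := by
  apply Finset.card_lt_card
  rw [Finset.ssubset_iff_of_subset]
  · refine ⟨(k, i), ?_, ?_⟩
    · simp only [Finset.mem_filter, Finset.mem_product, Finset.mem_range, Finset.mem_Icc]
      exact ⟨⟨hk, hi, hir⟩, hq⟩
    · simp only [Finset.mem_filter, not_and, not_lt]
      exact fun _ => hq'
  · intro x
    simp only [Finset.mem_filter]
    exact fun hx => ⟨hx.1, ((hq.trans_le hq').le.trans_lt hx.2)⟩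

/-- The largest `k ≤ a` with `Aₖ(r) ≤ q`. -/
def ackermannHeight (a r q : ℕ) : ℕ :=
  Nat.findGreatest (fun k => ackermannLevel k r ≤ q) a

theorem ackermannLevel_height_le {a r q : ℕ} (h : r < q) :
    ackermannLevel (ackermannHeight a r q) r ≤ q :=
  Nat.findGreatest_spec (P := fun k => ackermannLevel k r ≤ q) (Nat.zero_le a)
    (by simpa [ackermannLevel] using h)

theorem ackermannHeight_lt {a r q : ℕ} (h : r < q) (ha : q < ackermannLevel a r) :
    ackermannHeight a r q < a := by
  refine lt_of_le_of_ne (Nat.findGreatest_le a) fun he => ?_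
  have := ackermannLevel_height_le (a := a) h
  rw [he] at this
  omega

/-- The potential drops when the new parent has rank at least `Aₖ(q)`, where `k` is the height. -/
theorem ackermannGap_drop {a r q q' : ℕ} (hr : 1 ≤ r) (h : r < q)
    (hq : ackermannLevel (ackermannHeight a r q) q ≤ q') (ha : q' < ackermannLevel a r) :
    ackermannGap a r q' < ackermannGap a r q := by
  set k := ackermannHeight a r q with hk
  have hqq : q < q' := (lt_ackermannLevel k q).trans_le hq
  have hka : k < a := ackermannHeight_lt h (hqq.trans ha)
  -- The iterate on the right is the value of level `k + 1` at `r`; if it were at most `q`, then `k`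
  -- would not be the height.
  have hk1 : q < (ackermannLevel k)^[r + 1] r := by
    by_contra hc
    have : k + 1 ≤ ackermannHeight a r q :=
      Nat.le_findGreatest hka (not_lt.1 hc)
    omega
  have hex : ∃ i, q < (ackermannLevel k)^[i] r := ⟨_, hk1⟩
  obtain ⟨i, hi, hmin⟩ : ∃ i, q < (ackermannLevel k)^[i] r ∧
      ∀ j < i, (ackermannLevel k)^[j] r ≤ q :=
    ⟨Nat.find hex, Nat.find_spec hex, fun j hj => not_lt.1 (Nat.find_min hex hj)⟩
  have hi0 : i ≠ 0 := by rintro rfl; simp at hi; omega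
  have hir : i ≤ r + 1 := by
    by_contra hc
    have := hmin (r + 1) (by omega)
    omega
  -- The iterate before the `i`-th is still at most `q`, so one more application gives at most the
  -- value of level `k` at `q`.
  have hle : (ackermannLevel k)^[i] r ≤ q' := by
    obtain ⟨j, rfl⟩ := Nat.exists_eq_succ_of_ne_zero hi0
    rw [Function.iterate_succ_apply']
    exact (ackermannLevel_mono k (hmin j (by omega))).trans hq
  -- For `i ≤ r` the pair `(k, i)` stops being counted. For `i = r + 1` the iterate is the first one
  -- of level `k + 1`, so the pair `(k + 1, 1)` stops being counted; if that level is `a`, the bound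
  -- `ha` is violated.
  rcases Nat.lt_or_ge r i with hri | hri
  · obtain rfl : i = r + 1 := by omega
    rcases Nat.lt_or_ge (k + 1) a with hka' | hka'
    · exact ackermannGap_lt hka' le_rfl hr hi hle
    · have he : k + 1 = a := by omega
      have hle' : ackermannLevel (k + 1) r ≤ q' := hle
      rw [he] at hle'
      exact absurd hle' (not_le.2 ha)
  · exact ackermannGap_lt hka (by omega) hri hi hle

/-! ### Disjoint set forests -/

/-- The parent pointers `p` and ranks `rk` form a disjoint set forest on the nodes `0, …, n - 1`
whose trees have the roots `rep v`. -/
structure IsSetForest (n : ℕ) (p rk rep : ℕ → ℕ) : Prop where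
  parent_lt : ∀ v < n, p v < n
  rep_lt : ∀ v < n, rep v < n
  rep_parent : ∀ v < n, rep (p v) = rep v
  rep_eq : ∀ v < n, p v = v → rep v = v
  parent_rep : ∀ v < n, p (rep v) = rep v
  rank_lt : ∀ v < n, p v ≠ v → rk v < rk (p v)
  rank_pos : ∀ v < n, 1 ≤ rk v
  rank_le : ∀ v < n, rk v + ((Finset.range n).filter fun v => rep v = v).card ≤ n + 1

/-- The potential of a disjoint set forest. -/
def forestPotential (a n : ℕ) (p rk : ℕ → ℕ) : ℕ :=
  ∑ v ∈ Finset.range n, if p v = v then a * rk v else ackermannGap a (rk v) (rk (p v))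

namespace IsSetForest

variable {n a : ℕ} {p rk rep : ℕ → ℕ}

theorem rep_rep (h : IsSetForest n p rk rep) {v : ℕ} (hv : v < n) : rep (rep v) = rep v :=
  h.rep_eq _ (h.rep_lt v hv) (h.parent_rep v hv)

theorem parent_eq_iff (h : IsSetForest n p rk rep) {v : ℕ} (hv : v < n) : p v = v ↔ rep v = v :=
  ⟨h.rep_eq v hv, fun hr => by have := h.parent_rep v hv; rwa [hr] at this⟩

/-- Every join removes a root and raises a rank by at most one, which is the invariant `rank_le`. As
at least one root is always left, ranks are at most `n`; the usual logarithmic bound is not needed.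
-/
theorem rank_lt_bound (h : IsSetForest n p rk rep) {v : ℕ} (hv : v < n) : rk v ≤ n := by
  have h₁ := h.rank_le v hv
  have : 0 < ((Finset.range n).filter fun v => rep v = v).card :=
    Finset.card_pos.2 ⟨rep v, by simp [h.rep_lt v hv, h.rep_rep hv]⟩
  omega

/-- Redirecting a node to a node of larger rank in its tree. -/
theorem update (h : IsSetForest n p rk rep) {x y : ℕ} (hx : x < n) (hy : y < n)
    (hr : rk x < rk y) (hp : p x ≠ x) (hxy : rep y = rep x) :
    IsSetForest n (Function.update p x y) rk rep where
  parent_lt v hv := by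
    rw [Function.update_apply]; split_ifs
    exacts [hy, h.parent_lt v hv]
  rep_lt := h.rep_lt
  rep_parent v hv := by
    rw [Function.update_apply]; split_ifs with hvx
    · rw [hxy, hvx]
    · exact h.rep_parent v hv
  rep_eq v hv := by
    rw [Function.update_apply]; split_ifs with hvx
    · rintro rfl; subst hvx; exact absurd hr (lt_irrefl _)
    · exact h.rep_eq v hv
  parent_rep v hv := by
    rw [Function.update_of_ne]
    · exact h.parent_rep v hv
    · rintro rfl; exact hp (h.parent_rep v hv)
  rank_lt v hv := by
    rw [Function.update_apply]; split_ifs with hvx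
    · rw [hvx]; exact fun _ => hr
    · exact h.rank_lt v hv
  rank_pos := h.rank_pos
  rank_le := h.rank_le

end IsSetForest

/-- Only the summand of `x` changes. The additive form avoids truncated subtraction. -/
theorem forestPotential_update (a n : ℕ) {p rk : ℕ → ℕ} {x y : ℕ} (hx : x < n) (hp : p x ≠ x)
    (hxy : y ≠ x) :
    forestPotential a n (Function.update p x y) rk + ackermannGap a (rk x) (rk (p x)) =
      forestPotential a n p rk + ackermannGap a (rk x) (rk y) := by
  have hmem : x ∈ Finset.range n := Finset.mem_range.2 hx
  rw [forestPotential, forestPotential, ← Finset.add_sum_erase _ _ hmem,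
    ← Finset.add_sum_erase (Finset.range n) (fun v => if p v = v then a * rk v else _) hmem]
  have : ∀ v ∈ (Finset.range n).erase x,
      (if Function.update p x y v = v then a * rk v
        else ackermannGap a (rk v) (rk (Function.update p x y v))) =
      (if p v = v then a * rk v else ackermannGap a (rk v) (rk (p v))) := by
    intro v hv
    rw [Function.update_of_ne (Finset.ne_of_mem_erase hv)]
  rw [Finset.sum_congr rfl this]
  simp only [Function.update_self, hxy, hp, if_false]
  omega

/-- The list of the nodes below the root `r` on the path from `x` to `r`. -/
def IsRootPath (p : ℕ → ℕ) (r : ℕ) : ℕ → List ℕ → Prop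
  | x, [] => x = r ∧ p r = r
  | x, y :: l => x = y ∧ p x ≠ x ∧ IsRootPath p r (p x) l

namespace IsSetForest

variable {n a : ℕ} {p rk rep : ℕ → ℕ}

/-- Ranks increase strictly towards the root and are at most `n`, so `n - rk x` is a decreasing
measure. -/
theorem exists_isRootPath (h : IsSetForest n p rk rep) {x : ℕ} (hx : x < n) :
    ∃ l, IsRootPath p (rep x) x l := by
  induction hk : n - rk x using Nat.strong_induction_on generalizing x with
  | _ k ih =>
    by_cases hp : p x = x
    · exact ⟨[], (h.rep_eq x hx hp).symm, h.parent_rep x hx⟩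
    · have hpx := h.parent_lt x hx
      have h₁ := h.rank_lt x hx hp
      have h₂ := h.rank_lt_bound hpx
      obtain ⟨l, hl⟩ := ih _ (by omega) hpx rfl
      rw [h.rep_parent x hx] at hl
      exact ⟨x :: l, rfl, hp, hl⟩

theorem rank_le_of_mem_path (h : IsSetForest n p rk rep) {r x : ℕ} {l : List ℕ} (hx : x < n)
    (hl : IsRootPath p r x l) :
    ∀ y ∈ l, y < n ∧ p y ≠ y ∧ rk x ≤ rk y ∧ rk (p y) ≤ rk r := by
  induction l generalizing x with
  | nil => simp
  | cons z l ih =>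
    obtain ⟨rfl, hp, hl⟩ := hl
    have hpx := h.parent_lt x hx
    have ih' := ih hpx hl
    have hlt := h.rank_lt x hx hp
    intro y hy
    rcases List.mem_cons.1 hy with rfl | hy
    · refine ⟨hx, hp, le_rfl, ?_⟩
      cases l with
      | nil => exact hl.1 ▸ le_rfl
      | cons w l =>
        obtain ⟨rfl, hp', hl'⟩ := hl
        exact (h.rank_lt _ hpx hp').le.trans (ih' (p y) (by simp)).2.2.2
    · obtain ⟨h₁, h₂, h₃, h₄⟩ := ih' y hy
      exact ⟨h₁, h₂, hlt.le.trans h₃, h₄⟩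

theorem rank_lt_of_path_cons (h : IsSetForest n p rk rep) {r x y : ℕ} {l : List ℕ} (hx : x < n)
    (hl : IsRootPath p r x (y :: l)) : rk x < rk r := by
  have h₁ := h.rank_le_of_mem_path hx hl y (by simp)
  obtain ⟨rfl, hp, -⟩ := hl
  exact (h.rank_lt x hx hp).trans_le h₁.2.2.2

end IsSetForest

theorem IsRootPath.update {p : ℕ → ℕ} {r x z w : ℕ} {l : List ℕ} (h : IsRootPath p r x l)
    (hz : z ∉ l) (hzr : z ≠ r) : IsRootPath (Function.update p z w) r x l := by
  induction l generalizing x with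
  | nil => exact ⟨h.1, by rw [Function.update_of_ne hzr.symm]; exact h.2⟩
  | cons y l ih =>
    obtain ⟨rfl, hp, hl⟩ := h
    simp only [List.mem_cons, not_or] at hz
    refine ⟨rfl, ?_, ?_⟩
    · rwa [Function.update_of_ne (Ne.symm hz.1)]
    · rw [Function.update_of_ne (Ne.symm hz.1)]; exact ih hl hz.2

/-- Redirect all nodes of a list to `r`. -/
def compressPath (r : ℕ) : List ℕ → (ℕ → ℕ) → ℕ → ℕ
  | [], p => p
  | x :: l, p => compressPath r l (Function.update p x r)

namespace IsSetForest

variable {n a : ℕ} {p rk rep : ℕ → ℕ}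

/-- The amortized cost of path compression. -/
theorem compressPath_amortized (h : IsSetForest n p rk rep) (ha : n < ackermannLevel a 1)
    {x : ℕ} (hx : x < n) {l : List ℕ} (hl : IsRootPath p (rep x) x l) :
    IsSetForest n (compressPath (rep x) l p) rk rep ∧
    forestPotential a n (compressPath (rep x) l p) rk + l.length ≤ forestPotential a n p rk +
      (l.toFinset.image fun y => ackermannHeight a (rk y) (rk (p y))).card := by
  induction l generalizing x p with
  | nil => exact ⟨h, by simp [compressPath]⟩
  | cons z l ih =>
    have hxr := h.rank_lt_of_path_cons hx hl
    obtain ⟨rfl, hp, hl⟩ := hl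
    have hpx := h.parent_lt x hx
    have hrx : rep x ≠ x := fun he => hp ((h.parent_eq_iff hx).2 he)
    have hmem := h.rank_le_of_mem_path hpx hl
    have hlt := h.rank_lt x hx hp
    -- Ranks grow along the path, so `x` does not recur on it. Redirecting `x` thus changes neither
    -- the rest of the path nor the heights of its nodes.
    have hxl : x ∉ l := fun hxl => by have := (hmem x hxl).2.2.1; omega
    have h' := h.update hx (h.rep_lt x hx) hxr hp (h.rep_rep hx)
    have hrp := h.rep_parent x hx
    have hl' : IsRootPath (Function.update p x (rep x)) (rep (p x)) (p x) l := by
      rw [hrp]; exact hl.update hxl hrx.symm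
    obtain ⟨ih₁, ih₂⟩ := ih h' hpx hl'
    rw [hrp] at ih₁ ih₂
    refine ⟨ih₁, ?_⟩
    have himg : (l.toFinset.image fun y => ackermannHeight a (rk y)
        (rk (Function.update p x (rep x) y))) =
        l.toFinset.image fun y => ackermannHeight a (rk y) (rk (p y)) := by
      apply Finset.image_congr
      intro y hy
      have : y ≠ x := by rintro rfl; exact hxl (by simpa using hy)
      simp [Function.update_of_ne this]
    rw [himg] at ih₂
    have hΦ := forestPotential_update a n (rk := rk) hx hp hrx
    rw [List.toFinset_cons, Finset.image_insert, List.length_cons]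
    change forestPotential a n (compressPath (rep x) l (Function.update p x (rep x))) rk + _ ≤ _
    -- If a later node `y` of the path has the same height `k`, then the root has rank at least that
    -- of the parent of `y`, hence at least the value of level `k` at `rk y`, which is no smaller
    -- than that at `rk (p x)`. So `x` loses potential and pays for itself. Otherwise `x`
    -- contributes a new height to the count on the right-hand side.
    by_cases hc : ackermannHeight a (rk x) (rk (p x)) ∈
        l.toFinset.image fun y => ackermannHeight a (rk y) (rk (p y))
    · rw [Finset.insert_eq_of_mem hc]
      obtain ⟨y, hy, hyk⟩ := Finset.mem_image.1 hc
      obtain ⟨hyn, hpy, hxy, hyr⟩ := hmem y (by simpa using hy)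
      have hdrop : ackermannGap a (rk x) (rk (rep x)) < ackermannGap a (rk x) (rk (p x)) := by
        apply ackermannGap_drop (h.rank_pos x hx) hlt
        · rw [← hyk]
          exact (ackermannLevel_mono _ hxy).trans
            ((ackermannLevel_height_le (h.rank_lt y hyn hpy)).trans hyr)
        · exact (h.rank_lt_bound (h.rep_lt x hx)).trans_lt
            (ha.trans_le (ackermannLevel_mono a (h.rank_pos x hx)))
      omega
    · rw [Finset.card_insert_of_notMem hc]
      have : ackermannGap a (rk x) (rk (rep x)) ≤ ackermannGap a (rk x) (rk (p x)) := by
        apply ackermannGap_anti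
        cases l with
        | nil => rw [hl.1]
        | cons w l =>
          have := h.rank_lt_of_path_cons hpx hl
          omega
      omega

/-- All ranks are at most `n`, which is below level `a` at 1 and hence below level `a` at any rank.
So only the heights below `a` occur, which bounds the number of path nodes that do not pay for
themselves. -/
theorem card_heights_le (h : IsSetForest n p rk rep) (ha : n < ackermannLevel a 1)
    {x r : ℕ} (hx : x < n) {l : List ℕ} (hl : IsRootPath p r x l) :
    (l.toFinset.image fun y => ackermannHeight a (rk y) (rk (p y))).card ≤ a := by
  refine (Finset.card_le_card (t := Finset.range a) ?_).trans (Finset.card_range a).le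
  intro k hk
  obtain ⟨y, hy, rfl⟩ := Finset.mem_image.1 hk
  obtain ⟨hyn, hpy, -, -⟩ := h.rank_le_of_mem_path hx hl y (by simpa using hy)
  rw [Finset.mem_range]
  apply ackermannHeight_lt (h.rank_lt y hyn hpy)
  exact (h.rank_lt_bound (h.parent_lt y hyn)).trans_lt
    (ha.trans_le (ackermannLevel_mono a (h.rank_pos y hyn)))

/-- The representatives after two trees with roots `x` and `y` have been joined, `c` being the new
root. -/
def joinRep (rep : ℕ → ℕ) (x y c : ℕ) (v : ℕ) : ℕ :=
  if rep v = x ∨ rep v = y then c else rep v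

theorem card_roots_join {x y : ℕ} (hx : x < n)
    (hrx : rep x = x) (hry : rep y = y) (hxy : x ≠ y) :
    ((Finset.range n).filter fun v => joinRep rep x y y v = v).card + 1 =
      ((Finset.range n).filter fun v => rep v = v).card := by
  rw [← Finset.card_erase_add_one (s := (Finset.range n).filter fun v => rep v = v) (a := x)
    (by simp [hx, hrx])]
  congr 2
  ext v
  simp only [Finset.mem_filter, Finset.mem_range, Finset.mem_erase, joinRep]
  grind

/-- Joining the tree with root `x` to the root `y`, with or without a change of the rank of `y`. -/
theorem join (h : IsSetForest n p rk rep) {x y q : ℕ} (hx : x < n) (hy : y < n)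
    (hrx : rep x = x) (hry : rep y = y) (hxy : x ≠ y) (hr : rk x < q) (hq : rk y ≤ q)
    (hq' : q ≤ rk y + 1) :
    IsSetForest n (Function.update p x y) (Function.update rk y q) (joinRep rep x y y) ∧
      forestPotential a n (Function.update p x y) (Function.update rk y q) ≤
        forestPotential a n p rk + a := by
  have hpx : p x = x := (h.parent_eq_iff hx).2 hrx
  have hpy : p y = y := (h.parent_eq_iff hy).2 hry
  have hcard := card_roots_join hx hrx hry hxy
  have hge : ∀ v, rk v ≤ Function.update rk y q v := by
    intro v; rw [Function.update_apply]; split_ifs with hv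
    · rw [hv]; exact hq
    · exact le_rfl
  constructor
  · constructor
    · intro v hv; rw [Function.update_apply]; split_ifs
      exacts [hy, h.parent_lt v hv]
    · intro v hv; unfold joinRep; split_ifs
      exacts [hy, h.rep_lt v hv]
    · intro v hv
      have := h.rep_parent v hv
      simp only [Function.update_apply, joinRep]
      grind
    · intro v hv
      have := h.rep_eq v hv
      simp only [Function.update_apply, joinRep]
      grind
    · intro v hv
      have := h.parent_rep v hv
      simp only [Function.update_apply, joinRep]
      grind
    · intro v hv
      rw [Function.update_apply p]
      split_ifs with hvx
      · intro _
        rw [hvx, Function.update_self, Function.update_of_ne hxy]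
        exact hr
      · intro hv'
        have h₁ := h.rank_lt v hv hv'
        have : v ≠ y := by rintro rfl; exact hv' hpy
        rw [Function.update_of_ne this]
        exact h₁.trans_le (hge _)
    · intro v hv
      exact (h.rank_pos v hv).trans (hge v)
    · intro v hv
      have h₁ := h.rank_le v hv
      -- The rank of `y` grows by at most one, and `hcard` compensates this by the lost root.
      have h₂ : Function.update rk y q v ≤ rk v + 1 := by
        rw [Function.update_apply]; split_ifs with hv'
        · rw [hv']; exact hq'
        · omega
      omega
  · have hmem : y ∈ Finset.range n := Finset.mem_range.2 hy
    -- Termwise comparison: the root `y` gains at most `a`; `x` turns from a root into a child,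
    -- whose gap is bounded by its former potential; the gaps of all other children do not grow, as
    -- the ranks of their parents do not fall.
    have key : ∀ v ∈ Finset.range n,
        (if Function.update p x y v = v then a * Function.update rk y q v
          else ackermannGap a (Function.update rk y q v)
            (Function.update rk y q (Function.update p x y v))) ≤
        (if p v = v then a * rk v else ackermannGap a (rk v) (rk (p v))) +
          if v = y then a else 0 := by
      intro v hv
      by_cases hvy : v = y
      · subst hvy
        rw [Function.update_of_ne hxy.symm, if_pos hpy, if_pos hpy, if_pos rfl,
          Function.update_self]
        calc a * q ≤ a * (rk v + 1) := Nat.mul_le_mul_left _ hq'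
          _ = _ := by ring
      · rw [Function.update_of_ne hvy]
        by_cases hvx : v = x
        · subst hvx
          rw [Function.update_self, if_neg hxy.symm, if_pos hpx]
          exact (ackermannGap_le _ _ _).trans (Nat.le_add_right _ _)
        · rw [Function.update_of_ne hvx]
          split_ifs with hpv
          · exact Nat.le_add_right _ _
          · exact (ackermannGap_anti _ _ (hge _))
    refine (Finset.sum_le_sum key).trans ?_
    rw [Finset.sum_add_distrib, Finset.sum_ite_eq' _ _ _, if_pos hmem]
    exact le_rfl

end IsSetForest

/-! ### Programs for disjoint set forests

The arrays `4` and `5` hold the parents and the ranks. -/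

/-- Put the root of the tree of the node in register `4` into register `5` and compress the path. -/
def findRoot : RAMProgram :=
  .block
    [.copy 5 4, .load 6 4 5, .load 7 5 5, .load 8 5 6,
      .loop (.lt 7 8) (.block [.copy 5 6, .load 6 4 5, .copy 7 8, .load 8 5 6]),
      .copy 6 4, .load 8 4 6, .load 9 5 8,
      .loop (.lt 9 7) (.block [.store 4 6 5, .copy 6 8, .load 8 4 6, .load 9 5 8])]

/-- Registers `7` and `8` hold the ranks of the current node and of its parent. They differ except
at a root, so comparing ranks detects the root. -/
theorem wp_climb {W n : ℕ} {p rk rep : ℕ → ℕ} (h : IsSetForest n p rk rep) {r : ℕ}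
    {l : List ℕ} {s : RAMState} (hp : s.mem 4 = p) (hrk : s.mem 5 = rk) (hx : s.reg 5 < n)
    (hl : IsRootPath p r (s.reg 5) l) (h₆ : s.reg 6 = p (s.reg 5)) (h₇ : s.reg 7 = rk (s.reg 5))
    (h₈ : s.reg 8 = rk (s.reg 6)) :
    Wp W (.loop (.lt 7 8) (.block [.copy 5 6, .load 6 4 5, .copy 7 8, .load 8 5 6])) s
      fun s' t => s'.mem = s.mem ∧ s'.reg 5 = r ∧ s'.reg 7 = rk r ∧
        (∀ i, i < 5 ∨ 9 < i → s'.reg i = s.reg i) ∧ t ≤ 5 * l.length + 1 := by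
  induction l generalizing s with
  | nil =>
    apply Wp.loop_of_not
    · simp only [RAMTest.Holds, h₇, h₈, h₆]
      rw [hl.1, hl.2]; exact lt_irrefl _
    · exact ⟨rfl, hl.1, by rw [h₇, hl.1], fun _ _ => rfl, by simp⟩
  | cons y l ih =>
    obtain ⟨rfl, hpx, hl⟩ := hl
    apply Wp.loop_of_holds
    · simp only [RAMTest.Holds, h₇, h₈, h₆]
      exact h.rank_lt _ hx hpx
    · simp only [RAMProgram.block, Wp.seq_iff, Wp.copy_iff, Wp.load_iff]
      refine (ih (by simpa [RAMState.mem_setReg] using hp)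
        (by simpa [RAMState.mem_setReg] using hrk) ?_ ?_ ?_ ?_ ?_).mono ?_
      · simpa [RAMState.reg_setReg, h₆] using h.parent_lt _ hx
      · simpa [RAMState.reg_setReg, h₆] using hl
      · simp [RAMState.reg_setReg, RAMState.mem_setReg, hp]
      · simp [RAMState.reg_setReg, h₈]
      · simp [RAMState.reg_setReg, RAMState.mem_setReg, hrk]
      · rintro s' t ⟨h₁, h₂, h₃, h₄, h₅⟩
        refine ⟨h₁, h₂, h₃, ?_, ?_⟩
        · intro i hi
          rw [h₄ i hi]
          simp only [RAMState.reg_setReg]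
          grind
        · simp only [List.length_cons]; omega

/-- The loop stops when the parent has the rank of the root. The last node of the path is then left
alone, in agreement with `compressPath`, since it already points to the root. -/
theorem wp_compress {W n : ℕ} {p rk rep : ℕ → ℕ} (h : IsSetForest n p rk rep)
    {l : List ℕ} {s : RAMState} (hp : s.mem 4 = p) (hrk : s.mem 5 = rk) (hx : s.reg 6 < n)
    (hl : IsRootPath p (rep (s.reg 6)) (s.reg 6) l) (h₅ : s.reg 5 = rep (s.reg 6))
    (h₇ : s.reg 7 = rk (s.reg 5)) (h₈ : s.reg 8 = p (s.reg 6)) (h₉ : s.reg 9 = rk (s.reg 8)) :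
    Wp W (.loop (.lt 9 7) (.block [.store 4 6 5, .copy 6 8, .load 8 4 6, .load 9 5 8])) s
      fun s' t => s'.mem = Function.update s.mem 4 (compressPath (s.reg 5) l p) ∧
        s'.reg 5 = s.reg 5 ∧ (∀ i, i < 5 ∨ 9 < i → s'.reg i = s.reg i) ∧
        t ≤ 5 * l.length + 1 := by
  induction l generalizing s p with
  | nil =>
    apply Wp.loop_of_not
    · simp only [RAMTest.Holds, h₇, h₈, h₉, h₅]
      have hr := hl.2
      rw [← hl.1] at hr ⊢
      rw [hr]; exact lt_irrefl (rk (s.reg 6))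
    · refine ⟨?_, rfl, fun _ _ => rfl, by simp⟩
      simp [compressPath, ← hp]
  | cons y l ih =>
    have hlt := h.rank_lt_of_path_cons hx hl
    have hmem := h.rank_le_of_mem_path hx hl
    obtain ⟨rfl, hpx, hl⟩ := hl
    have hpn := h.parent_lt _ hx
    have hrp := h.rep_parent _ hx
    have hrn := h.rep_lt _ hx
    cases l with
    | nil =>
      apply Wp.loop_of_not
      · simp only [RAMTest.Holds, h₇, h₈, h₉, h₅]
        rw [hl.1]; exact lt_irrefl _
      · refine ⟨?_, rfl, fun _ _ => rfl, by simp⟩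
        simp only [compressPath, h₅, ← hl.1, Function.update_eq_self]
        simp [← hp]
    | cons z l =>
      have hxl : s.reg 6 ∉ z :: l := by
        intro hc
        have h₁ := h.rank_le_of_mem_path hpn hl _ hc
        have h₂ := h.rank_lt _ hx hpx
        omega
      have hlt' := h.rank_lt_of_path_cons hpn hl
      have hne : s.reg 6 ≠ rep (s.reg 6) := fun he => hpx ((h.parent_eq_iff hx).2 he.symm)
      have h' := h.update hx hrn hlt hpx (h.rep_rep hx)
      have hl' := hl.update (w := rep (s.reg 6)) hxl hne
      rw [← hrp] at hl'
      apply Wp.loop_of_holds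
      · simp only [RAMTest.Holds, h₇, h₈, h₉, h₅]
        exact hlt'
      · simp only [RAMProgram.block, Wp.seq_iff, Wp.copy_iff, Wp.load_iff, Wp.store_iff]
        refine (ih h' ?_ ?_ ?_ ?_ ?_ ?_ ?_ ?_).mono ?_
        · simp [RAMState.mem_setReg, RAMState.mem_setMem, hp, h₅]
        · simpa [RAMState.mem_setReg, RAMState.mem_setMem] using hrk
        · simpa [RAMState.reg_setReg, RAMState.reg_setMem, h₈] using hpn
        · rw [hrp] at hl'
          simpa [RAMState.reg_setReg, RAMState.reg_setMem, h₈, hrp] using hl'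
        · simp [RAMState.reg_setReg, RAMState.reg_setMem, h₈, hrp, h₅]
        · simp [RAMState.reg_setReg, RAMState.reg_setMem, h₇]
        · simp [RAMState.reg_setReg, RAMState.mem_setReg, RAMState.reg_setMem,
            RAMState.mem_setMem, hp, h₈, h₅]
        · simp [RAMState.reg_setReg, RAMState.mem_setReg, RAMState.reg_setMem,
            RAMState.mem_setMem, hrk]
        · rintro s' t ⟨h₁, h₂, h₃, h₄⟩
          refine ⟨?_, ?_, ?_, ?_⟩
          · rw [h₁]
            simp only [RAMState.reg_setReg, RAMState.reg_setMem, compressPath, h₅]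
            funext i
            simp [Function.update_apply, RAMState.mem_setReg, RAMState.mem_setMem]
            split_ifs <;> rfl
          · rw [h₂]; simp [RAMState.reg_setReg, RAMState.reg_setMem]
          · intro i hi
            rw [h₃ i hi]
            simp only [RAMState.reg_setReg, RAMState.reg_setMem]
            grind
          · simp only [List.length_cons] at h₄ ⊢; omega

/-- Climbing and compressing take five steps each per node of the path, which explains the factor 10
in front of the potential. At most `a` nodes remain unpaid. -/
theorem wp_findRoot {W n a : ℕ} {p rk rep : ℕ → ℕ} (h : IsSetForest n p rk rep)
    (ha : n < ackermannLevel a 1) {s : RAMState} (hp : s.mem 4 = p) (hrk : s.mem 5 = rk)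
    (hx : s.reg 4 < n) :
    Wp W findRoot s fun s' t => ∃ p', IsSetForest n p' rk rep ∧
      s'.mem = Function.update s.mem 4 p' ∧ s'.reg 5 = rep (s.reg 4) ∧
      (∀ i, i < 5 ∨ 9 < i → s'.reg i = s.reg i) ∧
      10 * forestPotential a n p' rk + t ≤ 10 * forestPotential a n p rk + 10 * a + 10 := by
  obtain ⟨l, hl⟩ := h.exists_isRootPath hx
  obtain ⟨hc₁, hc₂⟩ := h.compressPath_amortized ha hx hl
  have hc₃ := h.card_heights_le ha hx hl
  simp only [findRoot, RAMProgram.block]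
  iterate 4 rw [Wp.seq_iff]; first | rw [Wp.copy_iff] | rw [Wp.load_iff]
  rw [Wp.seq_iff]
  refine (wp_climb h (l := l) (r := rep (s.reg 4)) ?_ ?_ ?_ ?_ ?_ ?_ ?_).mono ?_
  · simpa [RAMState.mem_setReg] using hp
  · simpa [RAMState.mem_setReg] using hrk
  · simpa [RAMState.reg_setReg] using hx
  · simpa [RAMState.reg_setReg] using hl
  · simp [RAMState.reg_setReg, RAMState.mem_setReg, hp]
  · simp [RAMState.reg_setReg, RAMState.mem_setReg, hrk]
  · simp [RAMState.reg_setReg, RAMState.mem_setReg, hrk]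
  · rintro s₁ t₁ ⟨hm, h₅, h₇, hf, ht⟩
    simp only [RAMState.mem_setReg] at hm
    have h₄ : s₁.reg 4 = s.reg 4 := by
      rw [hf 4 (by omega)]; simp [RAMState.reg_setReg]
    simp only [Wp.seq_iff, Wp.copy_iff, Wp.load_iff]
    refine (wp_compress h (l := l) ?_ ?_ ?_ ?_ ?_ ?_ ?_ ?_).mono ?_
    · simpa [RAMState.mem_setReg, hm] using hp
    · simpa [RAMState.mem_setReg, hm] using hrk
    · simpa [RAMState.reg_setReg, h₄] using hx
    · simpa [RAMState.reg_setReg, h₄] using hl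
    · simpa [RAMState.reg_setReg, h₄] using h₅
    · simp [RAMState.reg_setReg, h₇, h₅]
    · simp [RAMState.reg_setReg, RAMState.mem_setReg, hm, hp]
    · simp [RAMState.reg_setReg, RAMState.mem_setReg, hm, hrk]
    · rintro s₂ t₂ ⟨hm₂, h₅', hf₂, ht₂⟩
      have h₅'' : s₂.reg 5 = rep (s.reg 4) := by rw [h₅', ← h₅]; simp [RAMState.reg_setReg]
      refine ⟨compressPath (rep (s.reg 4)) l p, hc₁, ?_, h₅'', ?_, by omega⟩
      · rw [hm₂]; simp [RAMState.mem_setReg, RAMState.reg_setReg, hm, h₅]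
      · intro i hi
        rw [hf₂ i hi]
        simp only [RAMState.reg_setReg]
        have := hf i hi
        simp only [RAMState.reg_setReg] at this
        grind

/-- Join the trees whose roots are in the registers `10` and `11`; the new root is put into
register `12`. -/
def joinRoots : RAMProgram :=
  .block
    [.load 13 5 10, .load 14 5 11,
      .branch (.lt 13 14) (.block [.store 4 10 11, .copy 12 11])
        (.block [.store 4 11 10, .copy 12 10,
          .branch (.eq 13 14) (.block [.add 13 13 3, .store 5 10 13]) .skip])]

/-- In the two branches with different ranks the new root keeps its rank, so `join` is applied with
a trivial rank update. A rank is raised only if both are equal, and `rank_lt_bound` keeps it inside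
a word. -/
theorem wp_joinRoots {W n : ℕ} (a : ℕ) {p rk rep : ℕ → ℕ} (h : IsSetForest n p rk rep)
    {s : RAMState} (hp : s.mem 4 = p) (hrk : s.mem 5 = rk) (h₃ : s.reg 3 = 1) (hW : n + 1 < W)
    (hx : s.reg 10 < n) (hy : s.reg 11 < n) (hrx : rep (s.reg 10) = s.reg 10)
    (hry : rep (s.reg 11) = s.reg 11) (hxy : s.reg 10 ≠ s.reg 11) :
    Wp W joinRoots s fun s' t => ∃ p' rk',
      (s'.reg 12 = s.reg 10 ∨ s'.reg 12 = s.reg 11) ∧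
      IsSetForest n p' rk' (IsSetForest.joinRep rep (s.reg 10) (s.reg 11) (s'.reg 12)) ∧
      s'.mem = Function.update (Function.update s.mem 4 p') 5 rk' ∧
      (∀ i, i < 12 ∨ 14 < i → s'.reg i = s.reg i) ∧
      forestPotential a n p' rk' ≤ forestPotential a n p rk + a ∧ t ≤ 8 := by
  have hbound := h.rank_lt_bound hx
  have hcomm : IsSetForest.joinRep rep (s.reg 11) (s.reg 10) (s.reg 10) =
      IsSetForest.joinRep rep (s.reg 10) (s.reg 11) (s.reg 10) := by
    funext v; simp only [IsSetForest.joinRep, or_comm]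
  simp only [joinRoots, RAMProgram.block, Wp.seq_iff, Wp.copy_iff, Wp.load_iff, Wp.branch_iff,
    Wp.store_iff, Wp.add_iff, Wp.skip_iff, RAMTest.Holds]
  simp only [RAMState.reg_setReg, RAMState.mem_setReg, RAMState.reg_setMem, hrk, h₃]
  norm_num
  refine ⟨fun hlt => ?_, fun hge => ⟨fun heq => ⟨by omega, ?_⟩, fun hne => ?_⟩⟩
  · obtain ⟨j₁, j₂⟩ := h.join (a := a) hx hy hrx hry hxy hlt le_rfl (by omega)
    rw [Function.update_eq_self] at j₁ j₂
    refine ⟨_, _, j₁, ?_, by grind, j₂⟩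
    funext i
    simp only [Function.update_apply, RAMState.mem_setReg, RAMState.mem_setMem]
    split_ifs <;> simp_all
  · obtain ⟨j₁, j₂⟩ := h.join (a := a) (q := rk (s.reg 10) + 1) hy hx hry hrx hxy.symm
      (by omega) (by omega) le_rfl
    rw [hcomm] at j₁
    refine ⟨_, _, j₁, ?_, by grind, j₂⟩
    funext i
    simp only [Function.update_apply, RAMState.mem_setReg, RAMState.mem_setMem]
    split_ifs <;> simp_all
  · obtain ⟨j₁, j₂⟩ := h.join (a := a) (q := rk (s.reg 10)) hy hx hry hrx hxy.symm
      (by omega) (by omega) (by omega)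
    rw [Function.update_eq_self] at j₁ j₂
    rw [hcomm] at j₁
    refine ⟨_, _, j₁, ?_, by grind, j₂⟩
    funext i
    simp only [Function.update_apply, RAMState.mem_setReg, RAMState.mem_setMem]
    split_ifs <;> simp_all

/-! ### Parity of rearrangements -/

/-- The list `l'` arises from the list `l` by an even (`b = false`) or odd (`b = true`) number of
exchanges of adjacent entries. -/
inductive PermSign {α : Type*} : Bool → List α → List α → Prop where
  | refl (l : List α) : PermSign false l l
  | swap {b : Bool} {l : List α} (A : List α) (x y : α) (B : List α) :
      PermSign b l (A ++ x :: y :: B) → PermSign (!b) l (A ++ y :: x :: B)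

namespace PermSign

variable {α β : Type*} {b c : Bool} {l l' l'' : List α}

theorem perm (h : PermSign b l l') : l.Perm l' := by
  induction h with
  | refl l => exact .refl _
  | swap A x y B _ ih => exact ih.trans ((List.Perm.swap y x B).append_left A)

theorem trans (h : PermSign b l l') (h' : PermSign c l' l'') : PermSign (xor b c) l l'' := by
  induction h' with
  | refl l => simpa using h
  | swap A x y B _ ih => simpa using (ih h).swap A x y B

theorem symm (h : PermSign b l l') : PermSign b l' l := by
  induction h with
  | refl l => exact .refl _
  | swap A x y B _ ih =>
    have := ((PermSign.refl (A ++ y :: x :: B)).swap A y x B).trans ih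
    simpa using this

/-- Since parity is recorded by a sequence of exchanges, it passes through every map, injective or
not. This allows words of nodes to be replaced by words of classes. -/
theorem map (f : α → β) (h : PermSign b l l') : PermSign b (l.map f) (l'.map f) := by
  induction h with
  | refl l => exact .refl _
  | swap A x y B _ ih =>
    simp only [List.map_append, List.map_cons] at ih ⊢
    exact ih.swap _ _ _ _

theorem append_left (A : List α) (h : PermSign b l l') : PermSign b (A ++ l) (A ++ l') := by
  induction h with
  | refl l => exact .refl _
  | swap A' x y B _ ih =>
    rw [← List.append_assoc] at ih ⊢
    exact ih.swap _ _ _ _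

theorem cons (x : α) (h : PermSign b l l') : PermSign b (x :: l) (x :: l') :=
  h.append_left [x]

theorem move (A : List α) (x : α) (B : List α) :
    PermSign A.length.bodd (A ++ x :: B) (x :: (A ++ B)) := by
  induction A with
  | nil => simpa using PermSign.refl (x :: B)
  | cons y A ih =>
    have := (ih.cons y).swap [] y x (A ++ B)
    simpa using this

/-- Exchanging `v` with the even number of entries in front of it does not matter. -/
theorem rotate (u v w : α) (A B : List α) :
    PermSign false (w :: u :: (A ++ v :: B)) (u :: v :: (A ++ w :: B)) := by
  have h₁ := move (w :: u :: A) v B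
  have h₂ := (move (u :: v :: A) w B).symm
  have h₃ : PermSign false (v :: w :: u :: (A ++ B)) (w :: u :: v :: (A ++ B)) := by
    have := ((PermSign.refl (v :: w :: u :: (A ++ B))).swap [] v w (u :: (A ++ B))).swap
      [w] v u (A ++ B)
    simpa using this
  have := (h₁.trans h₃).trans h₂
  simpa using this

end PermSign

/-- The pair of `x` and `y` is an inversion in exactly one of the two lists, and every other pair
keeps its order. -/
theorem inversions_swap {n : ℕ} (A : List (Fin n)) (x y : Fin n) (B : List (Fin n)) (hxy : x ≠ y) :
    (-1 : ℤ) ^ inversions (A ++ y :: x :: B) = -(-1) ^ inversions (A ++ x :: y :: B) := by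
  induction A with
  | nil =>
    have key : (if decide (x < y) = true then 1 else 0) +
        (if decide (y < x) = true then 1 else 0) = 1 := by
      rcases lt_or_gt_of_ne hxy with h | h <;> simp [h, h.le]
    have hpow : ∀ k, -(-1 : ℤ) ^ k = (-1) ^ (k + 1) := fun k => by ring
    rw [hpow]
    apply neg_one_pow_congr
    simp only [List.nil_append, inversions, List.countP_cons]
    grind
  | cons a A ih =>
    have hp : (A ++ y :: x :: B).Perm (A ++ x :: y :: B) := (List.Perm.swap x y B).append_left A
    simp only [List.cons_append, inversions, pow_add, ih, hp.countP_eq]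
    ring

theorem PermSign.neg_one_pow_inversions {n : ℕ} {b : Bool} {l l' : List (Fin n)}
    (h : PermSign b l l') (hl : l.Nodup) :
    (-1 : ℤ) ^ inversions l' = (if b then -1 else 1) * (-1) ^ inversions l := by
  induction h with
  | refl l => simp
  | @swap b l A x y B h ih =>
    have hn : (A ++ x :: y :: B).Nodup := h.perm.nodup_iff.1 hl
    have hxy : x ≠ y := by
      have := (List.nodup_append.1 hn).2.1
      simp only [List.nodup_cons, List.mem_cons, not_or] at this
      exact this.1.1
    rw [inversions_swap A x y B hxy, ih hl]
    cases b <;> simp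

/-- The endpoints of the listed edges, where `tl` and `hd` give tails and heads. -/
def edgeEnds (tl hd : ℕ → ℕ) (l : List ℕ) : List ℕ :=
  l.flatMap fun e => [tl e, hd e]

section edgeEnds

variable {tl hd : ℕ → ℕ}

theorem edgeEnds_cons (e : ℕ) (l : List ℕ) :
    edgeEnds tl hd (e :: l) = tl e :: hd e :: edgeEnds tl hd l := rfl

theorem mem_edgeEnds {l : List ℕ} {v : ℕ} :
    v ∈ edgeEnds tl hd l ↔ ∃ e ∈ l, tl e = v ∨ hd e = v := by
  simp only [edgeEnds, List.mem_flatMap, List.mem_cons, List.not_mem_nil, or_false]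
  grind

/-- Each edge contributes two neighbouring entries, so exchanging two edges amounts to four
exchanges of entries. -/
theorem permSign_edgeEnds {l l' : List ℕ} (h : l.Perm l') :
    PermSign false (edgeEnds tl hd l) (edgeEnds tl hd l') := by
  induction h with
  | nil => exact .refl _
  | cons e _ ih => exact (ih.cons _).cons _
  | swap e f l =>
    have h₁ := PermSign.move [tl f, hd f] (tl e) (hd e :: edgeEnds tl hd l)
    have h₂ := (PermSign.move [tl f, hd f] (hd e) (edgeEnds tl hd l)).cons (tl e)
    simpa [edgeEnds_cons] using h₁.trans h₂
  | trans _ _ ih₁ ih₂ => simpa using ih₁.trans ih₂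

theorem nodup_of_nodup_edgeEnds {l : List ℕ} (h : (edgeEnds tl hd l).Nodup) : l.Nodup := by
  induction l with
  | nil => simp
  | cons e l ih =>
    simp only [edgeEnds_cons, List.nodup_cons, List.mem_cons, not_or] at h
    refine List.nodup_cons.2 ⟨fun he => h.1.2 (mem_edgeEnds.2 ⟨e, he, Or.inl rfl⟩), ih h.2.2⟩

end edgeEnds

/-! ### Contracting pairs of edges -/

/-- The contraction of a matching edge `e` from class `w` to class `u` and another edge `f` from `u`
to class `v` into a class with root `c`; `sv` and `su` are the sizes of the classes `v` and `u`. -/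
structure MergeStep where
  (e f u v w c sv su : ℕ)

/-- The class of a node after a contraction in terms of its class `x` before. -/
def MergeStep.merge (st : MergeStep) (x : ℕ) : ℕ :=
  if x = st.u ∨ x = st.v ∨ x = st.w then st.c else x

/-- The roots of the classes of the nodes after the given contractions, the last of which is listed
first. -/
def mergedRep : List MergeStep → ℕ → ℕ
  | [] => id
  | st :: h => fun x => st.merge (mergedRep h x)

/-- The number of nodes in the class with root `r`. -/
def classSize (n : ℕ) (rep : ℕ → ℕ) (r : ℕ) : ℕ :=
  ((Finset.range n).filter fun x => rep x = r).card

/-- After the contractions `h`, the edges and classes of `st` may be contracted; the matching `B`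
becomes `B'`, and of the other edges `live` those in `live'` remain. -/
structure MergeStep.IsValid (n : ℕ) (tl hd : ℕ → ℕ) (h : List MergeStep) (B B' : List ℕ)
    (live live' : Set ℕ) (st : MergeStep) : Prop where
  hB : B.Perm (st.e :: B')
  htl_e : mergedRep h (tl st.e) = st.w
  hhd_e : mergedRep h (hd st.e) = st.u
  htl_f : mergedRep h (tl st.f) = st.u
  hhd_f : mergedRep h (hd st.f) = st.v
  huv : st.u ≠ st.v
  hvw : st.v ≠ st.w
  hc : st.c = st.u ∨ st.c = st.v ∨ st.c = st.w
  hv : st.v < n ∧ mergedRep h st.v = st.v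
  hf : st.f ∈ live
  hlive : live' ⊆ live
  hu : ∀ g ∈ live', mergedRep h (tl g) ≠ st.u ∧ mergedRep h (hd g) ≠ st.u
  hsv : st.sv = classSize n (mergedRep h) st.v
  hsu : st.su = classSize n (mergedRep h) st.u

/-- A sequence of contractions, starting from a matching `M`: the matching `B` and a set `live` of
other edges remain. -/
inductive IsContraction (n : ℕ) (tl hd : ℕ → ℕ) (M : List ℕ) :
    List MergeStep → List ℕ → Set ℕ → Prop where
  | start (live : Set ℕ) : IsContraction n tl hd M [] M live
  | step {h : List MergeStep} {B B' : List ℕ} {live live' : Set ℕ} (st : MergeStep)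
      (hh : IsContraction n tl hd M h B live)
      (hst : st.IsValid n tl hd h B B' live live') :
      IsContraction n tl hd M (st :: h) B' live'

namespace IsContraction

variable {n : ℕ} {tl hd : ℕ → ℕ} {M : List ℕ} {h : List MergeStep} {B : List ℕ} {live : Set ℕ}

/-- The remaining matching covers every class exactly once. -/
theorem word (hc : IsContraction n tl hd M h B live) (hM : (edgeEnds tl hd M).Nodup)
    (hM' : ∀ x < n, x ∈ edgeEnds tl hd M) :
    ((edgeEnds tl hd B).map (mergedRep h)).Nodup ∧
      ∀ x < n, mergedRep h x ∈ (edgeEnds tl hd B).map (mergedRep h) := by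
  induction hc with
  | start live => simpa [mergedRep] using ⟨hM, hM'⟩
  | @step h B B' live live' st hh hst ih =>
    obtain ⟨hB, htl_e, hhd_e, -, -, huv, hvw, hc, hv, -, -, -, -, -⟩ := hst
    obtain ⟨ih₁, ih₂⟩ := ih
    have hp := ((permSign_edgeEnds (tl := tl) (hd := hd) hB).map (mergedRep h)).perm
    rw [edgeEnds_cons, List.map_cons, List.map_cons, htl_e, hhd_e] at hp
    have hn := hp.nodup_iff.1 ih₁
    simp only [List.nodup_cons, List.mem_cons, not_or] at hn
    obtain ⟨⟨hwu, hw⟩, hu', hn⟩ := hn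
    have hmap : (edgeEnds tl hd B').map (mergedRep (st :: h)) =
        ((edgeEnds tl hd B').map (mergedRep h)).map st.merge := by
      simp [mergedRep, Function.comp_def]
    rw [hmap]
    constructor
    -- Once `e` is removed, neither `u` nor `w` occurs in the word, so merging is injective on it.
    · apply hn.map_on
      intro x hx y hy hxy
      have hxw : x ≠ st.w := fun he => hw (he ▸ hx)
      have hyw : y ≠ st.w := fun he => hw (he ▸ hy)
      have hxu : x ≠ st.u := fun he => hu' (he ▸ hx)
      have hyu : y ≠ st.u := fun he => hu' (he ▸ hy)
      simp only [MergeStep.merge] at hxy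
      grind
    · intro x hx
      -- The class `v` differs from both classes covered by `e`, so `B'` still covers it; this entry
      -- now covers the merged class.
      have hvm : st.v ∈ (edgeEnds tl hd B').map (mergedRep h) := by
        have := hp.mem_iff.1 (ih₂ _ hv.1)
        rw [hv.2] at this
        simp only [List.mem_cons] at this
        rcases this with h | h | h
        exacts [absurd h hvw, absurd h.symm huv, h]
      have hxm := hp.mem_iff.1 (ih₂ x hx)
      simp only [List.mem_cons] at hxm
      simp only [mergedRep]
      have hcv : st.merge st.v = st.c := by simp [MergeStep.merge]
      rcases hxm with hxw | hxu | hxB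
      · have : st.merge st.w = st.merge st.v := by rw [hcv]; simp [MergeStep.merge]
        rw [hxw, this]; exact List.mem_map_of_mem hvm
      · have : st.merge st.u = st.merge st.v := by rw [hcv]; simp [MergeStep.merge]
        rw [hxu, this]; exact List.mem_map_of_mem hvm
      · exact List.mem_map_of_mem hxB

end IsContraction

/-- A second matching `A` of a contracted digraph, of opposite sign to `B`; `ex` gives for every
class the node in which it is covered. -/
structure IsOppositeMatching (tl hd rep : ℕ → ℕ) (B : List ℕ) (live : Set ℕ) (A : List ℕ)
    (ex : ℕ → ℕ) : Prop where
  subset : ∀ g ∈ A, g ∈ B ∨ g ∈ live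
  sign : PermSign true ((edgeEnds tl hd B).map rep) ((edgeEnds tl hd A).map rep)
  ex_rep : ∀ z ∈ edgeEnds tl hd A, ex (rep z) = z

/-- Undoing a contraction. -/
theorem IsOppositeMatching.undo {n : ℕ} {tl hd : ℕ → ℕ} {M : List ℕ} {h : List MergeStep}
    {B B' : List ℕ} {live live' : Set ℕ} {st : MergeStep}
    (hM : (edgeEnds tl hd M).Nodup) (hM' : ∀ x < n, x ∈ edgeEnds tl hd M)
    (hh : IsContraction n tl hd M h B live)
    (hst : st.IsValid n tl hd h B B' live live')
    {A : List ℕ} {ex : ℕ → ℕ}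
    (hA : IsOppositeMatching tl hd (mergedRep (st :: h)) B' live' A ex) :
    ex st.c ∈ edgeEnds tl hd A ∧
    (mergedRep h (ex st.c) = st.v ∨ mergedRep h (ex st.c) = st.w) ∧
    (mergedRep h (ex st.c) = st.v → IsOppositeMatching tl hd (mergedRep h) B live (st.e :: A)
      (Function.update (Function.update (Function.update ex st.v (ex st.c)) st.w (tl st.e))
        st.u (hd st.e))) ∧
    (mergedRep h (ex st.c) = st.w → IsOppositeMatching tl hd (mergedRep h) B live (st.f :: A)
      (Function.update (Function.update (Function.update ex st.w (ex st.c)) st.u (tl st.f))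
        st.v (hd st.f))) := by
  obtain ⟨hB, htl_e, hhd_e, htl_f, hhd_f, huv, hvw, hc, hv, hf, hlive, hu, -, -⟩ := hst
  obtain ⟨hw₁, hw₂⟩ := hh.word hM hM'
  have hp := (permSign_edgeEnds (tl := tl) (hd := hd) hB).map (mergedRep h)
  rw [edgeEnds_cons, List.map_cons, List.map_cons, htl_e, hhd_e] at hp
  have hn := hp.perm.nodup_iff.1 hw₁
  simp only [List.nodup_cons, List.mem_cons, not_or] at hn
  obtain ⟨⟨hwu, hw⟩, hu', hn⟩ := hn
  have hmap : ∀ l : List ℕ, (edgeEnds tl hd l).map (mergedRep (st :: h)) =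
      ((edgeEnds tl hd l).map (mergedRep h)).map st.merge := by
    intro l; simp [mergedRep, Function.comp_def]
  have hvm : st.v ∈ (edgeEnds tl hd B').map (mergedRep h) := by
    have := hp.perm.mem_iff.1 (hw₂ _ hv.1)
    rw [hv.2] at this
    simp only [List.mem_cons] at this
    rcases this with h | h | h
    exacts [absurd h hvw, absurd h.symm huv, h]
  have hcv : st.merge st.v = st.c := by simp [MergeStep.merge]
  -- the class `u` is not covered by `A`
  have hAu : ∀ z ∈ edgeEnds tl hd A, mergedRep h z ≠ st.u := by
    intro z hz
    obtain ⟨g, hg, hgz⟩ := mem_edgeEnds.1 hz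
    rcases hA.subset g hg with hg' | hg'
    · intro hzu
      exact hu' (hzu ▸ List.mem_map_of_mem (mem_edgeEnds.2 ⟨g, hg', hgz⟩))
    · rcases hgz with rfl | rfl
      exacts [(hu g hg').1, (hu g hg').2]
  -- The word of `A` is a rearrangement of that of `B'`, which contains the new class through `v`;
  -- `ex` returns the node that covers it.
  have hz : ex st.c ∈ edgeEnds tl hd A := by
    have : st.c ∈ (edgeEnds tl hd A).map (mergedRep (st :: h)) := by
      rw [← hA.sign.perm.mem_iff, hmap, ← hcv]
      exact List.mem_map_of_mem hvm
    obtain ⟨z, hz, hzc⟩ := List.mem_map.1 this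
    rw [← hzc, hA.ex_rep z hz]
    exact hz
  have hzr : mergedRep (st :: h) (ex st.c) = st.c := by
    have : st.c ∈ (edgeEnds tl hd A).map (mergedRep (st :: h)) := by
      rw [← hA.sign.perm.mem_iff, hmap, ← hcv]
      exact List.mem_map_of_mem hvm
    obtain ⟨z, hz, hzc⟩ := List.mem_map.1 this
    rw [← hzc, hA.ex_rep z hz]
  have hcases : mergedRep h (ex st.c) = st.v ∨ mergedRep h (ex st.c) = st.w := by
    have h₁ := hAu _ hz
    have hcB : st.c ∈ [st.u, st.v, st.w] := by simpa using hc
    simp only [mergedRep, MergeStep.merge] at hzr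
    split_ifs at hzr with h₂
    · rcases h₂ with h₂ | h₂ | h₂
      exacts [absurd h₂ h₁, Or.inl h₂, Or.inr h₂]
    · grind
  -- the other covered nodes are outside of the new class
  have hother : ∀ z ∈ edgeEnds tl hd A, z ≠ ex st.c →
      mergedRep h z ≠ st.u ∧ mergedRep h z ≠ st.v ∧ mergedRep h z ≠ st.w ∧
        ex (mergedRep h z) = z := by
    intro z hz' hzne
    have h₁ := hA.ex_rep z hz'
    have : ¬ (mergedRep h z = st.u ∨ mergedRep h z = st.v ∨ mergedRep h z = st.w) := by
      intro hc'
      simp only [mergedRep, MergeStep.merge, if_pos hc'] at h₁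
      exact hzne h₁.symm
    simp only [mergedRep, MergeStep.merge, if_neg this] at h₁
    push Not at this
    exact ⟨this.1, this.2.1, this.2.2, h₁⟩
  -- naming the new class `v` again
  have hφ : ∀ x, x ≠ st.u → x ≠ st.w →
      (fun x => if x = st.c then st.v else x) (st.merge x) = x := by
    intro x h₁ h₂
    simp only [MergeStep.merge]
    grind
  have hsign := hA.sign.map fun x => if x = st.c then st.v else x
  rw [hmap, hmap] at hsign
  have hX : (((edgeEnds tl hd B').map (mergedRep h)).map st.merge).map
      (fun x => if x = st.c then st.v else x) = (edgeEnds tl hd B').map (mergedRep h) := by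
    rw [List.map_map]
    conv_rhs => rw [← List.map_id ((edgeEnds tl hd B').map (mergedRep h))]
    apply List.map_congr_left
    intro x hx
    exact hφ x (fun he => hu' (he ▸ hx)) (fun he => hw (he ▸ hx))
  rw [hX] at hsign
  refine ⟨hz, hcases, fun hzv => ⟨?_, ?_, ?_⟩, fun hzw => ⟨?_, ?_, ?_⟩⟩
  · intro g hg
    rcases List.mem_cons.1 hg with rfl | hg
    · exact Or.inl (hB.mem_iff.2 (by simp))
    · rcases hA.subset g hg with h | h
      exacts [Or.inl (hB.mem_iff.2 (by simp [h])), Or.inr (hlive h)]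
  · have hY : (((edgeEnds tl hd A).map (mergedRep h)).map st.merge).map
        (fun x => if x = st.c then st.v else x) = (edgeEnds tl hd A).map (mergedRep h) := by
      rw [List.map_map, List.map_map]
      apply List.map_congr_left
      intro z hz'
      apply hφ _ (hAu z hz')
      by_cases hze : z = ex st.c
      · rw [hze, hzv]; exact hvw
      · exact (hother z hz' hze).2.2.1
    rw [hY] at hsign
    have := hp.trans ((hsign.cons st.u).cons st.w)
    simpa [edgeEnds_cons, htl_e, hhd_e] using this
  · intro z hz'
    rw [edgeEnds_cons] at hz'
    rcases List.mem_cons.1 hz' with rfl | hz'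
    · rw [htl_e, Function.update_of_ne hwu, Function.update_self]
    rcases List.mem_cons.1 hz' with rfl | hz'
    · rw [hhd_e, Function.update_self]
    by_cases hze : z = ex st.c
    · rw [hze, hzv, Function.update_of_ne huv.symm, Function.update_of_ne hvw, Function.update_self]
    · obtain ⟨h₁, h₂, h₃, h₄⟩ := hother z hz' hze
      rw [Function.update_of_ne h₁, Function.update_of_ne h₃, Function.update_of_ne h₂, h₄]
  · intro g hg
    rcases List.mem_cons.1 hg with rfl | hg
    · exact Or.inr hf
    · rcases hA.subset g hg with h | h
      exacts [Or.inl (hB.mem_iff.2 (by simp [h])), Or.inr (hlive h)]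
  · -- the word of `A` has exactly one entry in the new class
    obtain ⟨Z₁, Z₂, hZ⟩ := List.append_of_mem hz
    have hnd : ((edgeEnds tl hd A).map (mergedRep (st :: h))).Nodup := by
      rw [← hA.sign.perm.nodup_iff, hmap]
      apply hn.map_on
      intro x hx y hy hxy
      have hxw : x ≠ st.w := fun he => hw (he ▸ hx)
      have hyw : y ≠ st.w := fun he => hw (he ▸ hy)
      have hxu : x ≠ st.u := fun he => hu' (he ▸ hx)
      have hyu : y ≠ st.u := fun he => hu' (he ▸ hy)
      simp only [MergeStep.merge] at hxy
      grind
    have hZn : (Z₁ ++ ex st.c :: Z₂).Nodup := hZ ▸ hnd.of_map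
    have hZ' : ∀ z, z ∈ Z₁ ∨ z ∈ Z₂ → z ∈ edgeEnds tl hd A ∧ z ≠ ex st.c := by
      intro z hz'
      refine ⟨by rw [hZ]; simp; tauto, ?_⟩
      rintro rfl
      have := (List.perm_middle.nodup_iff.1 hZn)
      simp only [List.nodup_cons, List.mem_append] at this
      exact this.1 hz'
    have hφ' : ∀ z, z ∈ Z₁ ∨ z ∈ Z₂ →
        (if st.merge (mergedRep h z) = st.c then st.v else st.merge (mergedRep h z)) =
          mergedRep h z := by
      intro z hz'
      obtain ⟨h₁, h₂⟩ := hZ' z hz'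
      exact hφ _ (hAu z h₁) (hother z h₁ h₂).2.2.1
    have hY : (((edgeEnds tl hd A).map (mergedRep h)).map st.merge).map
        (fun x => if x = st.c then st.v else x) =
        Z₁.map (mergedRep h) ++ st.v :: Z₂.map (mergedRep h) := by
      rw [hZ]
      simp only [List.map_append, List.map_cons, List.map_map]
      congr 1
      · exact List.map_congr_left fun z hz' => hφ' z (Or.inl hz')
      · congr 1
        · simp only [hzw, MergeStep.merge]; simp
        · exact List.map_congr_left fun z hz' => hφ' z (Or.inr hz')
    rw [hY] at hsign
    have h₁ := hp.trans ((hsign.cons st.u).cons st.w)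
    -- So far the entry of the new class was read as `v`, although it is `w`. The rotation repairs
    -- this and replaces the ends of `e` by those of `f`, without changing the parity.
    have h₂ := h₁.trans (PermSign.rotate st.u st.v st.w (Z₁.map (mergedRep h))
      (Z₂.map (mergedRep h)))
    simpa [edgeEnds_cons, htl_f, hhd_f, hZ, hzw] using h₂
  · intro z hz'
    rw [edgeEnds_cons] at hz'
    rcases List.mem_cons.1 hz' with rfl | hz'
    · rw [htl_f, Function.update_of_ne huv, Function.update_self]
    rcases List.mem_cons.1 hz' with rfl | hz'
    · rw [hhd_f, Function.update_self]
    by_cases hze : z = ex st.c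
    · rw [hze, hzw, Function.update_of_ne hvw.symm, Function.update_of_ne hwu, Function.update_self]
    · obtain ⟨h₁, h₂, h₃, h₄⟩ := hother z hz' hze
      rw [Function.update_of_ne h₂, Function.update_of_ne h₁, Function.update_of_ne h₃, h₄]

/-! ### Positions of the nodes in their classes -/

/-- The class with root `r` occupies the `classSize n rep r` positions from `lo r` on. -/
def IsNested (n : ℕ) (rep lo pos : ℕ → ℕ) : Prop :=
  ∀ x < n, lo (rep x) ≤ pos x ∧ pos x < lo (rep x) + classSize n rep (rep x)

/-- The thresholds tell on which side of a contraction a node is. -/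
def AreThresholds (n : ℕ) (pos thr : ℕ → ℕ) : List MergeStep → Prop
  | [] => True
  | st :: h => (∀ x < n, (mergedRep h x = st.v → pos x < thr h.length) ∧
      (mergedRep h x = st.w → thr h.length ≤ pos x)) ∧ AreThresholds n pos thr h

theorem classSize_merge {n : ℕ} {rep : ℕ → ℕ} {st : MergeStep} (huv : st.u ≠ st.v)
    (hvw : st.v ≠ st.w) (hwu : st.w ≠ st.u) (hc : st.c = st.u ∨ st.c = st.v ∨ st.c = st.w) (r : ℕ) :
    (r ≠ st.c → r ≠ st.u → r ≠ st.v → r ≠ st.w →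
      classSize n (fun x => st.merge (rep x)) r = classSize n rep r) ∧
    classSize n (fun x => st.merge (rep x)) st.c =
      classSize n rep st.v + classSize n rep st.u + classSize n rep st.w := by
  constructor
  · intro h₁ h₂ h₃ h₄
    unfold classSize
    congr 1
    apply Finset.filter_congr
    intro x _
    simp only [MergeStep.merge]
    grind
  · unfold classSize
    rw [← Finset.card_union_of_disjoint, ← Finset.card_union_of_disjoint]
    · congr 1
      ext x
      simp only [Finset.mem_filter, Finset.mem_union, MergeStep.merge]
      grind
    · rw [Finset.disjoint_left]
      intro x
      simp only [Finset.mem_filter, Finset.mem_union]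
      grind
    · rw [Finset.disjoint_left]
      intro x
      simp only [Finset.mem_filter]
      grind

/-- The lower ends of the positions after undoing a contraction. -/
def MergeStep.splitPositions (st : MergeStep) (lo : ℕ → ℕ) : ℕ → ℕ :=
  Function.update (Function.update (Function.update lo st.v (lo st.c)) st.u (lo st.c + st.sv))
    st.w (lo st.c + st.sv + st.su)

/-- The interval of the new class is cut into the intervals of `v`, `u` and `w` in this order. Hence
the lower end of `w` separates `v` from `w`. The class `u` lies between them and need not be
recognised, since the matching of the contracted digraph never covers it. -/
theorem IsNested.of_split {n : ℕ} {h : List MergeStep} {st : MergeStep} {lo pos : ℕ → ℕ}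
    (huv : st.u ≠ st.v) (hvw : st.v ≠ st.w) (hwu : st.w ≠ st.u)
    (hc : st.c = st.u ∨ st.c = st.v ∨ st.c = st.w)
    (hsv : st.sv = classSize n (mergedRep h) st.v)
    (hsu : st.su = classSize n (mergedRep h) st.u)
    (hn : IsNested n (mergedRep h) (st.splitPositions lo) pos) :
    IsNested n (mergedRep (st :: h)) lo pos ∧
      ∀ x < n, (mergedRep h x = st.v → pos x < lo st.c + st.sv + st.su) ∧
        (mergedRep h x = st.w → lo st.c + st.sv + st.su ≤ pos x) := by
  have hsize := classSize_merge (n := n) (rep := mergedRep h) huv hvw hwu hc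
  have hlv : st.splitPositions lo st.v = lo st.c := by
    simp [MergeStep.splitPositions, huv.symm, hvw]
  have hlu : st.splitPositions lo st.u = lo st.c + st.sv := by
    simp [MergeStep.splitPositions, hwu.symm]
  have hlw : st.splitPositions lo st.w = lo st.c + st.sv + st.su := by
    simp [MergeStep.splitPositions]
  constructor
  · intro x hx
    have h₁ := hn x hx
    simp only [mergedRep]
    by_cases hxc : mergedRep h x = st.u ∨ mergedRep h x = st.v ∨ mergedRep h x = st.w
    · have hm : st.merge (mergedRep h x) = st.c := by simp [MergeStep.merge, hxc]
      rw [hm, (hsize 0).2]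
      rcases hxc with he | he | he <;> rw [he] at h₁ <;> omega
    · have hm : st.merge (mergedRep h x) = mergedRep h x := by simp [MergeStep.merge, hxc]
      push Not at hxc
      rw [hm, (hsize _).1 (by grind) hxc.1 hxc.2.1 hxc.2.2]
      simpa [MergeStep.splitPositions, Function.update_apply, hxc] using h₁
  · intro x hx
    have h₁ := hn x hx
    constructor <;> intro he <;> rw [he] at h₁ <;> omega

/-! ### Linked lists -/

/-- The linked list with the pointers `nxt` that starts at `i` and ends with the pointer `nil`
consists of the given entries. -/
def IsLinkedList (nxt : ℕ → ℕ) (nil : ℕ) : ℕ → List ℕ → Prop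
  | i, [] => i = nil
  | i, x :: l => i = x ∧ x ≠ nil ∧ IsLinkedList nxt nil (nxt x) l

namespace IsLinkedList

variable {nxt : ℕ → ℕ} {nil i j x y : ℕ} {l l' : List ℕ}

theorem update (h : IsLinkedList nxt nil i l) (hx : x ∉ l) :
    IsLinkedList (Function.update nxt x y) nil i l := by
  induction l generalizing i with
  | nil => exact h
  | cons z l ih =>
    simp only [List.mem_cons, not_or] at hx
    refine ⟨h.1, h.2.1, ?_⟩
    rw [Function.update_of_ne (Ne.symm hx.1)]
    exact ih h.2.2 hx.2

/-- One pointer, written at the last entry, concatenates two lists; this is what the array of last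
entries is kept for. -/
theorem append (h : IsLinkedList nxt nil i (l ++ [x])) (h' : IsLinkedList nxt nil j l')
    (hx : x ∉ l) (hx' : x ∉ l') :
    IsLinkedList (Function.update nxt x j) nil i (l ++ x :: l') := by
  induction l generalizing i with
  | nil =>
    refine ⟨h.1, h.2.1, ?_⟩
    rw [Function.update_self]
    exact h'.update hx'
  | cons z l ih =>
    simp only [List.mem_cons, not_or] at hx
    refine ⟨h.1, h.2.1, ?_⟩
    rw [Function.update_of_ne (Ne.symm hx.1)]
    exact ih h.2.2 hx.2

theorem eq_nil_iff (h : IsLinkedList nxt nil i l) : i = nil ↔ l = [] := by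
  cases l with
  | nil => exact ⟨fun _ => rfl, fun _ => h⟩
  | cons z l => simpa [h.1] using h.2.1

end IsLinkedList

/-- For every class there is a linked list of the edges in `U` that enter it. -/
def IsInLists (n m : ℕ) (hd rep first nxt last : ℕ → ℕ) (U : Finset ℕ) : Prop :=
  ∃ L : ℕ → List ℕ, ∀ r < n, rep r = r →
    IsLinkedList nxt m (first r) (L r) ∧ (L r).Nodup ∧
      (∀ g, g ∈ L r ↔ g ∈ U ∧ rep (hd g) = r) ∧ ∀ A x, L r = A ++ [x] → last r = x

namespace IsInLists

variable {n m : ℕ} {hd rep first nxt last : ℕ → ℕ} {U : Finset ℕ}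

theorem first_eq_iff (h : IsInLists n m hd rep first nxt last U) {r : ℕ} (hr : r < n)
    (hrr : rep r = r) : first r = m ↔ ∀ g ∈ U, rep (hd g) ≠ r := by
  obtain ⟨L, hL⟩ := h
  obtain ⟨h₁, -, h₃, -⟩ := hL r hr hrr
  rw [h₁.eq_nil_iff, List.eq_nil_iff_forall_not_mem]
  simp only [h₃, not_and, ne_eq]

/-- Removing the first edge of a list. -/
theorem pop (h : IsInLists n m hd rep first nxt last U) {r : ℕ} (hr : r < n)
    (hrr : rep r = r) (hne : first r ≠ m) :
    first r ∈ U ∧ rep (hd (first r)) = r ∧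
      IsInLists n m hd rep (Function.update first r (nxt (first r))) nxt last
        (U.erase (first r)) := by
  obtain ⟨L, hL⟩ := h
  obtain ⟨h₁, h₂, h₃, h₄⟩ := hL r hr hrr
  obtain ⟨g, l, hl⟩ : ∃ g l, L r = g :: l := List.exists_cons_of_ne_nil (mt h₁.eq_nil_iff.2 hne)
  rw [hl] at h₁ h₂ h₃ h₄
  obtain ⟨hg, hgm, h₁⟩ := h₁
  have hgr := (h₃ g).1 (by simp)
  rw [hg]
  refine ⟨hgr.1, hgr.2, Function.update L r l, fun r' hr' hrr' => ?_⟩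
  by_cases he : r' = r
  · subst he
    rw [Function.update_self, Function.update_self]
    refine ⟨h₁, (List.nodup_cons.1 h₂).2, fun g' => ?_, fun A x hA => h₄ (g :: A) x (by simp [hA])⟩
    have := h₃ g'
    have hgl := (List.nodup_cons.1 h₂).1
    simp only [List.mem_cons] at this
    simp only [Finset.mem_erase]
    grind
  · rw [Function.update_of_ne he, Function.update_of_ne he]
    obtain ⟨k₁, k₂, k₃, k₄⟩ := hL r' hr' hrr'
    refine ⟨k₁, k₂, fun g' => ?_, k₄⟩
    rw [k₃, Finset.mem_erase]
    grind

/-- Joining the lists of the classes of a contraction. -/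
theorem merge (h : IsInLists n m hd rep first nxt last U) {st : MergeStep}
    (hU : ∀ g ∈ U, rep (hd g) ≠ st.u) (hv : st.v < n) (hw : st.w < n) (hrv : rep st.v = st.v)
    (hrw : rep st.w = st.w) (hvw : st.v ≠ st.w) (hc : st.c = st.u ∨ st.c = st.v ∨ st.c = st.w)
    {fi la : ℕ} {nxt' : ℕ → ℕ}
    (hcases : (first st.v = m ∧ fi = first st.w ∧ la = last st.w ∧ nxt' = nxt) ∨
      (first st.v ≠ m ∧ first st.w = m ∧ fi = first st.v ∧ la = last st.v ∧ nxt' = nxt) ∨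
      (first st.v ≠ m ∧ first st.w ≠ m ∧ fi = first st.v ∧ la = last st.w ∧
        nxt' = Function.update nxt (last st.v) (first st.w))) :
    IsInLists n m hd (fun x => st.merge (rep x)) (Function.update first st.c fi) nxt'
      (Function.update last st.c la) U := by
  obtain ⟨L, hL⟩ := h
  obtain ⟨v₁, v₂, v₃, v₄⟩ := hL _ hv hrv
  obtain ⟨w₁, w₂, w₃, w₄⟩ := hL _ hw hrw
  -- No unscanned edge enters `u`, so the lists of `v` and `w` make up the list of the new class.
  have hmem : ∀ g, g ∈ L st.v ++ L st.w ↔ g ∈ U ∧ st.merge (rep (hd g)) = st.c := by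
    intro g
    have := hU g
    rw [List.mem_append, v₃, w₃]
    simp only [MergeStep.merge]
    grind
  have hnd : (L st.v ++ L st.w).Nodup := by
    rw [List.nodup_append]
    refine ⟨v₂, w₂, ?_⟩
    rintro g hg _ hg' rfl
    rw [v₃] at hg; rw [w₃] at hg'
    exact hvw (hg.2.symm.trans hg'.2)
  have hroot : ∀ r < n, st.merge (rep r) = r → r ≠ st.c →
      rep r = r ∧ r ≠ st.u ∧ r ≠ st.v ∧ r ≠ st.w := by
    intro r _ hr hrc
    simp only [MergeStep.merge] at hr
    grind
  have hnew : ∀ r, r ≠ st.c → r ≠ st.u → r ≠ st.v → r ≠ st.w → ∀ g, g ∈ U →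
      (rep (hd g) = r ↔ st.merge (rep (hd g)) = r) := by
    intro r h₁ h₂ h₃ h₄ g _
    simp only [MergeStep.merge]
    grind
  refine ⟨Function.update L st.c (L st.v ++ L st.w), fun r hr hrr => ?_⟩
  by_cases he : r = st.c
  · rw [he, Function.update_self, Function.update_self, Function.update_self]
    rcases hcases with ⟨c₁, rfl, rfl, rfl⟩ | ⟨c₁, c₂, rfl, rfl, rfl⟩ | ⟨c₁, c₂, rfl, rfl, rfl⟩
    · have hnil := v₁.eq_nil_iff.1 c₁
      rw [hnil, List.nil_append] at hnd hmem ⊢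
      exact ⟨w₁, hnd, hmem, w₄⟩
    · have hnil := w₁.eq_nil_iff.1 c₂
      rw [hnil, List.append_nil] at hnd hmem ⊢
      exact ⟨v₁, hnd, hmem, v₄⟩
    · refine ⟨?_, hnd, hmem, ?_⟩
      · obtain ⟨A, x, hA⟩ : ∃ A x, L st.v = A ++ [x] :=
          ⟨_, _, (List.dropLast_append_getLast (mt v₁.eq_nil_iff.2 c₁)).symm⟩
        rw [v₄ A x hA]
        rw [hA] at v₁ v₂ hnd ⊢
        have hxA : x ∉ A := by
          have := List.perm_middle.nodup_iff.1 v₂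
          simpa using (List.nodup_cons.1 this).1
        have hxw : x ∉ L st.w := by
          intro hx
          exact (List.nodup_append.1 hnd).2.2 x (by simp) x hx rfl
        simpa using v₁.append w₁ hxA hxw
      · intro A x hA
        obtain ⟨A', x', hA'⟩ : ∃ A x, L st.w = A ++ [x] :=
          ⟨_, _, (List.dropLast_append_getLast (mt w₁.eq_nil_iff.2 c₂)).symm⟩
        rw [hA', ← List.append_assoc] at hA
        have := List.append_inj_right' hA rfl
        simp only [List.cons.injEq, and_true] at this
        rw [← this, w₄ A' x' hA']
  · rw [Function.update_of_ne he, Function.update_of_ne he, Function.update_of_ne he]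
    obtain ⟨r₁, r₂, r₃, r₄⟩ := hroot r hr hrr he
    obtain ⟨k₁, k₂, k₃, k₄⟩ := hL r hr r₁
    refine ⟨?_, k₂, ?_, k₄⟩
    · rcases hcases with ⟨c₁, rfl, rfl, rfl⟩ | ⟨c₁, c₂, rfl, rfl, rfl⟩ | ⟨c₁, c₂, rfl, rfl, rfl⟩
      · exact k₁
      · exact k₁
      · apply k₁.update
        obtain ⟨A, x, hA⟩ : ∃ A x, L st.v = A ++ [x] :=
          ⟨_, _, (List.dropLast_append_getLast (mt v₁.eq_nil_iff.2 c₁)).symm⟩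
        rw [v₄ A x hA]
        intro hx
        have h₁ := ((k₃ x).1 hx).2
        have h₂ := ((v₃ x).1 (by simp [hA])).2
        exact r₃ (h₁.symm.trans h₂)
    · intro g
      rw [k₃]
      refine and_congr_right fun hg => hnew r he r₂ r₃ r₄ g hg

end IsInLists

/-! ### The stack -/

/-- The stack of classes `stV 0, …, stV sp`; the edge `stE j` leaves the class `stV j` and enters
the class below. -/
structure IsStack (n : ℕ) (tl hd rep stV stE lev : ℕ → ℕ) (sp : ℕ) : Prop where
  lt : ∀ j ≤ sp, stV j < n
  root : ∀ j ≤ sp, rep (stV j) = stV j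
  lev_eq : ∀ j ≤ sp, lev (stV j) = j
  tail_eq : ∀ j < sp, rep (tl (stE (j + 1))) = stV (j + 1)
  head_eq : ∀ j < sp, rep (hd (stE (j + 1))) = stV j

namespace IsStack

variable {n : ℕ} {tl hd rep stV stE lev : ℕ → ℕ} {sp : ℕ}

/-- On the stack, `lev` inverts `stV`. It also gives a test for being on the stack that tolerates
stale values of `lev`: a class `r` is on the stack if and only if `lev r ≤ sp` and `stV (lev r) =
r`. -/
theorem inj (h : IsStack n tl hd rep stV stE lev sp) {i j : ℕ} (hi : i ≤ sp) (hj : j ≤ sp)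
    (hij : stV i = stV j) : i = j := by
  rw [← h.lev_eq i hi, ← h.lev_eq j hj, hij]

theorem pointer_lt (h : IsStack n tl hd rep stV stE lev sp) : sp < n := by
  have : (Finset.range (sp + 1)).card ≤ (Finset.range n).card := by
    apply Finset.card_le_card_of_injOn stV
    · intro j hj
      simp only [Finset.coe_range, Set.mem_Iio] at hj ⊢
      exact h.lt j (by omega)
    · intro i hi j hj hij
      simp only [Finset.coe_range, Set.mem_Iio] at hi hj
      exact h.inj (by omega) (by omega) hij
  simpa using this

/-- Entries above the stack pointer are never erased, because the conditions only concern positions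
up to the pointer. -/
theorem pop (h : IsStack n tl hd rep stV stE lev sp) {j : ℕ} (hj : j ≤ sp) :
    IsStack n tl hd rep stV stE lev j where
  lt i hi := h.lt i (hi.trans hj)
  root i hi := h.root i (hi.trans hj)
  lev_eq i hi := h.lev_eq i (hi.trans hj)
  tail_eq i hi := h.tail_eq i (hi.trans_le hj)
  head_eq i hi := h.head_eq i (hi.trans_le hj)

theorem push (h : IsStack n tl hd rep stV stE lev sp) {a g : ℕ} (ha : a < n) (hra : rep a = a)
    (hnew : ∀ j ≤ sp, stV j ≠ a) (htl : rep (tl g) = a) (hhd : rep (hd g) = stV sp) :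
    IsStack n tl hd rep (Function.update stV (sp + 1) a) (Function.update stE (sp + 1) g)
      (Function.update lev a (sp + 1)) (sp + 1) where
  lt j hj := by
    rw [Function.update_apply]; split_ifs
    exacts [ha, h.lt j (by omega)]
  root j hj := by
    rw [Function.update_apply]; split_ifs
    exacts [hra, h.root j (by omega)]
  lev_eq j hj := by
    rw [Function.update_apply stV]; split_ifs with hjs
    · rw [Function.update_self, hjs]
    · rw [Function.update_of_ne (hnew j (by omega)), h.lev_eq j (by omega)]
  tail_eq j hj := by
    simp only [Function.update_apply]
    split_ifs with hjs
    exacts [htl, h.tail_eq j (by omega)]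
  head_eq j hj := by
    simp only [Function.update_apply]
    split_ifs with hjs hjs' hjs'
    · omega
    · rw [hhd]; congr 1; omega
    · omega
    · exact h.head_eq j (by omega)

theorem restart {a : ℕ} (ha : a < n) (hra : rep a = a) :
    IsStack n tl hd rep (Function.update stV 0 a) stE (Function.update lev a 0) 0 where
  lt j hj := by obtain rfl := Nat.le_zero.1 hj; simpa using ha
  root j hj := by obtain rfl := Nat.le_zero.1 hj; simpa using hra
  lev_eq j hj := by obtain rfl := Nat.le_zero.1 hj; simp
  tail_eq j hj := by omega
  head_eq j hj := by omega

/-- The stack after a contraction of the topmost classes `u` and `v` with `w`, which becomes the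
class at position `tgt`. -/
theorem merge (h : IsStack n tl hd rep stV stE lev sp) {st : MergeStep} {tgt : ℕ}
    (htgt : tgt < sp) (hu : stV sp = st.u) (hv : stV (sp - 1) = st.v)
    (ht : stV tgt = st.v ∨ stV tgt = st.w) (hw : ∀ j < tgt, stV j ≠ st.w)
    (hcn : st.c < n) (hcr : rep st.c = st.c)
    (hc : st.c = st.u ∨ st.c = st.v ∨ st.c = st.w) :
    IsStack n tl hd (fun x => st.merge (rep x)) (Function.update stV tgt st.c) stE
      (Function.update lev st.c tgt) tgt := by
  have hbelow : ∀ j < tgt, stV j ≠ st.u ∧ stV j ≠ st.v ∧ stV j ≠ st.w := by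
    intro j hj
    refine ⟨fun he => ?_, fun he => ?_, hw j hj⟩
    · have := h.inj (by omega) le_rfl (he.trans hu.symm); omega
    · have := h.inj (by omega) (by omega) (he.trans hv.symm); omega
  have hbc : ∀ j < tgt, stV j ≠ st.c := by
    intro j hj; have := hbelow j hj; grind
  have hm : ∀ j < tgt, st.merge (stV j) = stV j := by
    intro j hj; have := hbelow j hj; simp [MergeStep.merge, this]
  have hmt : st.merge (stV tgt) = st.c := by
    rcases ht with h | h <;> simp [MergeStep.merge, h]
  have hrc : ∀ r, r = st.u ∨ r = st.v ∨ r = st.w → st.merge r = st.c := by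
    intro r hr; simp [MergeStep.merge, hr]
  constructor
  · intro j hj
    rw [Function.update_apply]; split_ifs
    exacts [hcn, h.lt j (by omega)]
  · intro j hj
    rw [Function.update_apply]; split_ifs with hjt
    · rw [hcr, hrc _ hc]
    · rw [h.root j (by omega), hm j (by omega)]
  · intro j hj
    rw [Function.update_apply stV]; split_ifs with hjt
    · rw [Function.update_self, hjt]
    · rw [Function.update_of_ne (hbc j (by omega)), h.lev_eq j (by omega)]
  · intro j hj
    rw [h.tail_eq j (by omega), Function.update_apply]; split_ifs with hjt
    · rw [hjt, hmt]
    · rw [hm _ (by omega)]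
  · intro j hj
    rw [h.head_eq j (by omega), Function.update_of_ne (by omega), hm _ hj]

end IsStack

/-! ### Degrees -/

/-- The number of edges in `U` and `B` whose end `φ` is in the class `r`. -/
def classDegree (φ : ℕ → ℕ) (U : Finset ℕ) (B : List ℕ) (r : ℕ) : ℕ :=
  (U.filter fun g => φ g = r).card + B.countP fun g => φ g = r

/-- With an additional path from class `top` to class `bot` every class has equally many incoming
and outgoing edges. -/
def IsBalanced (tl hd rep : ℕ → ℕ) (U : Finset ℕ) (B : List ℕ) (bot top : ℕ) : Prop :=
  ∀ r, classDegree (fun g => rep (hd g)) U B r + (if r = bot then 1 else 0) =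
    classDegree (fun g => rep (tl g)) U B r + (if r = top then 1 else 0)

theorem classDegree_erase {φ : ℕ → ℕ} {U : Finset ℕ} {B : List ℕ} {g : ℕ} (hg : g ∈ U) (r : ℕ) :
    classDegree φ (U.erase g) B r + (if r = φ g then 1 else 0) = classDegree φ U B r := by
  unfold classDegree
  rw [Finset.filter_erase]
  by_cases hr : φ g = r
  · rw [if_pos hr.symm]
    have := Finset.card_erase_add_one (s := U.filter fun g => φ g = r) (a := g) (by simp [hg, hr])
    omega
  · rw [if_neg (Ne.symm hr), Finset.erase_eq_of_notMem (by simp [hr])]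
    rfl

theorem classDegree_perm_cons {φ : ℕ → ℕ} {U : Finset ℕ} {B B' : List ℕ} {e : ℕ}
    (h : B.Perm (e :: B')) (r : ℕ) :
    classDegree φ U B r = classDegree φ U B' r + (if r = φ e then 1 else 0) := by
  unfold classDegree
  rw [h.countP_eq, List.countP_cons, add_assoc]
  simp [eq_comm]

/-- Degrees of merged classes add up, and roots that have disappeared have degree zero. Written as
sums of indicators, the claim reduces to the pointwise identity `key`. -/
theorem classDegree_merge {φ : ℕ → ℕ} {U : Finset ℕ} {B : List ℕ} {st : MergeStep}
    (huv : st.u ≠ st.v) (hvw : st.v ≠ st.w) (hwu : st.w ≠ st.u)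
    (hc : st.c = st.u ∨ st.c = st.v ∨ st.c = st.w) (r : ℕ) :
    classDegree (fun g => st.merge (φ g)) U B r =
      if r = st.c then classDegree φ U B st.u + classDegree φ U B st.v + classDegree φ U B st.w
      else if r = st.u ∨ r = st.v ∨ r = st.w then 0 else classDegree φ U B r := by
  have key : ∀ x, (if st.merge x = r then 1 else 0) =
      if r = st.c then (if x = st.u then 1 else 0) + (if x = st.v then 1 else 0) +
        (if x = st.w then 1 else 0)
      else if r = st.u ∨ r = st.v ∨ r = st.w then 0 else if x = r then 1 else 0 := by
    intro x
    simp only [MergeStep.merge]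
    grind
  have hU : ∀ (ψ : ℕ → ℕ) (r : ℕ), (U.filter fun g => ψ g = r).card =
      ∑ g ∈ U, if ψ g = r then 1 else 0 := fun ψ r => Finset.card_filter _ _
  have hB : ∀ (ψ : ℕ → ℕ) (r : ℕ), (B.countP fun g => ψ g = r) =
      (B.map fun g => if ψ g = r then 1 else 0).sum := by
    intro ψ r
    induction B with
    | nil => rfl
    | cons e B ih => simp only [List.countP_cons, List.map_cons, List.sum_cons, ih]; simp [add_comm]
  simp only [classDegree, hU, hB, key]
  split_ifs
  · simp only [Finset.sum_add_distrib, List.sum_map_add]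
    ring
  · simp
  · rfl

namespace IsBalanced

variable {tl hd rep : ℕ → ℕ} {U : Finset ℕ} {B : List ℕ} {bot top : ℕ}

/-- Moving along an edge against its direction. -/
theorem scan (h : IsBalanced tl hd rep U B bot top) {g : ℕ} (hg : g ∈ U) (hr : rep (hd g) = top) :
    IsBalanced tl hd rep (U.erase g) B bot (rep (tl g)) := by
  intro r
  have h₀ := h r
  have h₁ := classDegree_erase (φ := fun g => rep (hd g)) (B := B) hg r
  have h₂ := classDegree_erase (φ := fun g => rep (tl g)) (B := B) hg r
  rw [hr] at h₁
  omega

theorem restart (h : IsBalanced tl hd rep U B bot bot) (a : ℕ) :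
    IsBalanced tl hd rep U B a a := by
  intro r
  have := h r
  omega

/-- Removing `e` takes an incoming edge from `u` and an outgoing edge from `w`. So the path that
balances the degrees now starts in `w` instead of `u`, and after the identification in `c`. -/
theorem merge {st : MergeStep} (h : IsBalanced tl hd rep U B bot st.u) {B' : List ℕ}
    (hB : B.Perm (st.e :: B')) (htl : rep (tl st.e) = st.w) (hhd : rep (hd st.e) = st.u)
    (huv : st.u ≠ st.v) (hvw : st.v ≠ st.w) (hwu : st.w ≠ st.u)
    (hc : st.c = st.u ∨ st.c = st.v ∨ st.c = st.w) :
    IsBalanced tl hd (fun x => st.merge (rep x)) U B' (st.merge bot) st.c := by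
  intro r
  have h' : ∀ r, classDegree (fun g => rep (hd g)) U B' r + (if r = bot then 1 else 0) =
      classDegree (fun g => rep (tl g)) U B' r + (if r = st.w then 1 else 0) := by
    intro r
    have h₀ := h r
    rw [classDegree_perm_cons hB, classDegree_perm_cons hB, htl, hhd] at h₀
    omega
  rw [classDegree_merge (φ := fun g => rep (hd g)) huv hvw hwu hc,
    classDegree_merge (φ := fun g => rep (tl g)) huv hvw hwu hc]
  have hu := h' st.u
  have hv := h' st.v
  have hw := h' st.w
  have hr := h' r
  simp only [if_neg hvw, if_neg hwu.symm, if_true] at hu hv hw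
  simp only [MergeStep.merge]
  split_ifs at * <;> omega

end IsBalanced

/-- The left-hand side counts the occurrences of `r` in the word of the matching. -/
theorem countP_add_countP_le {tl hd rep : ℕ → ℕ} {B : List ℕ}
    (h : ((edgeEnds tl hd B).map rep).Nodup) (r : ℕ) :
    (B.countP fun g => rep (hd g) = r) + (B.countP fun g => rep (tl g) = r) ≤ 1 := by
  have hcount : ((edgeEnds tl hd B).map rep).count r =
      (B.countP fun g => rep (hd g) = r) + (B.countP fun g => rep (tl g) = r) := by
    clear h
    induction B with
    | nil => rfl
    | cons e B ih =>
      simp only [edgeEnds_cons, List.map_cons, List.count_cons, List.countP_cons, ih]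
      simp only [decide_eq_true_eq, beq_iff_eq]
      omega
  rw [← hcount]
  exact List.nodup_iff_count_le_one.1 h r

/-- Arrays `15` to `22` hold the contractions. -/
def IsRecorded (mem : ℕ → ℕ → ℕ) : List MergeStep → Prop
  | [] => True
  | st :: h => (mem 15 h.length = st.e ∧ mem 16 h.length = st.f ∧ mem 17 h.length = st.u ∧
      mem 18 h.length = st.v ∧ mem 19 h.length = st.w ∧ mem 20 h.length = st.sv ∧
      mem 21 h.length = st.su ∧ mem 22 h.length = st.c) ∧ IsRecorded mem h

theorem IsRecorded.congr {mem mem' : ℕ → ℕ → ℕ} {h : List MergeStep} (hr : IsRecorded mem h)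
    (he : ∀ a, 15 ≤ a → a ≤ 22 → ∀ i < h.length, mem' a i = mem a i) : IsRecorded mem' h := by
  induction h with
  | nil => trivial
  | cons st h ih =>
    have hl : h.length < (st :: h).length := by simp
    refine ⟨?_, ih hr.2 fun a h₁ h₂ i hi => he a h₁ h₂ i (hi.trans hl)⟩
    rw [he 15 (by omega) (by omega) _ hl, he 16 (by omega) (by omega) _ hl,
      he 17 (by omega) (by omega) _ hl, he 18 (by omega) (by omega) _ hl,
      he 19 (by omega) (by omega) _ hl, he 20 (by omega) (by omega) _ hl,
      he 21 (by omega) (by omega) _ hl, he 22 (by omega) (by omega) _ hl]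
    exact hr.1

/-! ### The state of the search -/

/-- A digraph with nodes `0, …, n - 1` and edges `0, …, m - 1`, and the list `M` of the edges of a
perfect matching. -/
structure IsMatchedDigraph (n m : ℕ) (tl hd : ℕ → ℕ) (M : List ℕ) : Prop where
  tail_lt : ∀ g < m, tl g < n
  head_lt : ∀ g < m, hd g < n
  edge_lt : ∀ e ∈ M, e < m
  nodup : (edgeEnds tl hd M).Nodup
  covers : ∀ x < n, x ∈ edgeEnds tl hd M

/-- The unscanned edges and those on the stack. -/
def liveEdges (U : Finset ℕ) (stE : ℕ → ℕ) (sp : ℕ) : Set ℕ :=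
  {g | g ∈ U ∨ ∃ j < sp, stE (j + 1) = g}

/-- The invariant of the search: `h` are the contractions made so far, `B` is the remaining
matching, and `U` is the set of the unscanned edges. -/
structure SearchState (n m : ℕ) (tl hd : ℕ → ℕ) (M : List ℕ) (h : List MergeStep) (B : List ℕ)
    (U : Finset ℕ) (s : RAMState) : Prop where
  reg_nodes : s.reg 0 = n
  reg_edges : s.reg 1 = m
  reg_zero : s.reg 2 = 0
  reg_one : s.reg 3 = 1
  reg_steps : s.reg 17 = h.length
  tails : s.mem 0 = tl
  heads : s.mem 1 = hd
  out : ∀ g, s.mem 3 g = if g ∈ B then 1 else 0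
  forest : IsSetForest n (s.mem 4) (s.mem 5) (mergedRep h)
  mate : ∀ e ∈ M, s.mem 6 (tl e) = e ∧ s.mem 6 (hd e) = e
  base : ∀ z ∈ edgeEnds tl hd B, s.mem 7 (mergedRep h z) = z
  lists : IsInLists n m hd (mergedRep h) (s.mem 8) (s.mem 9) (s.mem 10) U
  size : ∀ r < n, mergedRep h r = r → s.mem 11 r = classSize n (mergedRep h) r
  stack : IsStack n tl hd (mergedRep h) (s.mem 12) (s.mem 13) (s.mem 14) (s.reg 16)
  recorded : IsRecorded s.mem h
  unscanned_lt : ∀ g ∈ U, g < m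
  contraction : IsContraction n tl hd M h B (liveEdges U (s.mem 13) (s.reg 16))
  balanced : IsBalanced tl hd (mergedRep h) U B (s.mem 12 0) (s.mem 12 (s.reg 16))
  card_roots : ((Finset.range n).filter fun x => mergedRep h x = x).card + 2 * h.length ≤ n

theorem IsContraction.subset {n : ℕ} {tl hd : ℕ → ℕ} {M : List ℕ} {h : List MergeStep}
    {B : List ℕ} {live : Set ℕ} (hc : IsContraction n tl hd M h B live) : ∀ e ∈ B, e ∈ M := by
  induction hc with
  | start live => exact fun _ he => he
  | step st hh hst ih => exact fun e he => ih e (hst.hB.mem_iff.2 (by simp [he]))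

/-- Live edges may be forgotten at any time: a contraction only requires that those remaining
afterwards avoid `u` and were live before. This covers all discarded closed walks. -/
theorem IsContraction.mono {n : ℕ} {tl hd : ℕ → ℕ} {M : List ℕ} {h : List MergeStep}
    {B : List ℕ} {live live' : Set ℕ} (hc : IsContraction n tl hd M h B live)
    (hl : live' ⊆ live) : IsContraction n tl hd M h B live' := by
  cases hc with
  | start live => exact .start _
  | step st hh hst =>
    exact .step st hh { hst with
      hlive := hl.trans hst.hlive
      hu := fun g hg => hst.hu g (hl hg) }

namespace SearchState

variable {n m : ℕ} {tl hd : ℕ → ℕ} {M : List ℕ} {h : List MergeStep} {B : List ℕ}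
  {U : Finset ℕ} {s : RAMState}

/-- If no unscanned edge enters the topmost class then its matching edge does. In this case it is
the only class on the stack, or no unscanned edge leaves it. -/
theorem exists_matching_edge (hG : IsMatchedDigraph n m tl hd M)
    (hs : SearchState n m tl hd M h B U s) (hU : ∀ g ∈ U, mergedRep h (hd g) ≠ s.mem 12 (s.reg 16)) :
    ∃ e ∈ B, mergedRep h (hd e) = s.mem 12 (s.reg 16) ∧
      (0 < s.reg 16 → ∀ g ∈ U, mergedRep h (tl g) ≠ s.mem 12 (s.reg 16)) := by
  obtain ⟨hw₁, hw₂⟩ := hs.contraction.word hG.nodup hG.covers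
  set x := s.mem 12 (s.reg 16) with hx
  have hle := countP_add_countP_le hw₁ x
  have hbal := hs.balanced x
  rw [← hx, if_pos rfl] at hbal
  have hin : (U.filter fun g => mergedRep h (hd g) = x).card = 0 := by
    rw [Finset.card_eq_zero, Finset.filter_eq_empty_iff]
    exact fun g hg => hU g hg
  simp only [classDegree, hin, zero_add] at hbal
  -- Above the bottom of the stack the balance demands one more incoming than outgoing edge. At the
  -- bottom both numbers agree; if no matching edge entered, none would leave either, but every
  -- class is covered.
  have hpos : 0 < B.countP fun g => mergedRep h (hd g) = x := by
    by_cases hsp : x = s.mem 12 0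
    · rw [if_pos hsp] at hbal
      by_contra hc
      have h0 : (B.countP fun g => mergedRep h (hd g) = x) = 0 := by omega
      have h0' : (B.countP fun g => mergedRep h (tl g) = x) = 0 := by omega
      rw [List.countP_eq_zero] at h0 h0'
      have hxx := hs.stack.root _ le_rfl
      have := hw₂ x (hs.stack.lt _ le_rfl)
      rw [hxx, List.mem_map] at this
      obtain ⟨z, hz, hzx⟩ := this
      obtain ⟨e, he, hez⟩ := mem_edgeEnds.1 hz
      rcases hez with rfl | rfl
      · exact h0' e he (by simpa using hzx)
      · exact h0 e he (by simpa using hzx)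
    · rw [if_neg hsp] at hbal
      omega
  obtain ⟨e, he, hex⟩ := List.countP_pos_iff.1 hpos
  -- Above the bottom the in-degree is one more than the out-degree and comes from the matching
  -- alone, so it is at most one and no edge leaves.
  refine ⟨e, he, by simpa using hex, fun hsp g hg hgx => ?_⟩
  have hne : x ≠ s.mem 12 0 := by
    intro he
    have := hs.stack.inj le_rfl (Nat.zero_le _) he
    omega
  rw [if_neg hne] at hbal
  have : 0 < (U.filter fun g => mergedRep h (tl g) = x).card :=
    Finset.card_pos.2 ⟨g, by simp [hg, hgx]⟩
  omega

/-- If a single class is on the stack and its matching edge leaves it, then an unscanned edge enters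
it. -/
theorem exists_unscanned (hG : IsMatchedDigraph n m tl hd M)
    (hs : SearchState n m tl hd M h B U s) {x e : ℕ} (he : e ∈ B)
    (hex : mergedRep h (tl e) = x) (hbal : IsBalanced tl hd (mergedRep h) U B x x) :
    ¬ ∀ g ∈ U, mergedRep h (hd g) ≠ x := by
  intro hU
  obtain ⟨hw₁, hw₂⟩ := hs.contraction.word hG.nodup hG.covers
  have hle := countP_add_countP_le hw₁ x
  have hb := hbal x
  have hin : (U.filter fun g => mergedRep h (hd g) = x).card = 0 := by
    rw [Finset.card_eq_zero, Finset.filter_eq_empty_iff]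
    exact fun g hg => hU g hg
  simp only [classDegree, hin, zero_add] at hb
  -- The matching covers `x` by the tail of `e` only. Without entering unscanned edges the in-degree
  -- would be zero and the out-degree positive.
  have : 0 < B.countP fun g => mergedRep h (tl g) = x :=
    List.countP_pos_iff.2 ⟨e, he, by simpa using hex⟩
  omega

end SearchState

/-! ### The search program

Registers `0` to `3` hold the number of nodes, the number of edges, `0` and `1`; register `16` is the
stack pointer, `17` the number of contractions and `18` tells whether the search is finished.
Registers `19` to `24` hold the topmost class, an edge that is not in the matching, an edge of the
matching, the class of its tail, the second class on the stack, and a position on the stack.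

Arrays `0` to `3` hold the tails, the heads, the given and the current matching, `4` and `5` the
disjoint set forest, `6` the matching edge of every node, `7` the node of every class that is
incident to the current matching, `8`, `9` and `10` the lists of the unscanned edges that enter a
class, `11` the sizes of the classes, `12`, `13` and `14` the stack, and `15` to `22` the
contractions. -/

/-- Push the class in register `5`, which is reached by the edge in register `20`. -/
def pushClass : RAMProgram :=
  .block [.add 16 16 3, .store 12 16 5, .store 13 16 20, .store 14 5 16]

/-- Scan the edge in register `20`, the first in the list of the topmost class. -/
def scanEdge : RAMProgram :=
  .block
    [.load 4 0 20, findRoot, .load 25 9 20, .store 8 19 25, .load 24 14 5,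
      .branch (.lt 16 24) pushClass
        (.block [.load 25 12 24, .branch (.eq 25 5) (.copy 16 24) pushClass])]

/-- Restart from the tail of the matching edge that enters the only class on the stack. -/
def restartSearch : RAMProgram :=
  .block
    [.load 25 7 19, .load 21 6 25, .load 4 0 21, findRoot, .store 12 2 5, .store 14 5 2]

/-- Find the position on the stack of the class that arises from a contraction. -/
def chooseTarget : RAMProgram :=
  .block
    [.load 25 14 22,
      .branch (.lt 16 25) .skip
        (.block [.load 26 12 25, .branch (.eq 26 22) (.copy 24 25) .skip])]

/-- Join the lists of the classes in registers `23` and `22`. -/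
def joinLists : RAMProgram :=
  .block
    [.load 25 8 23, .load 26 10 23, .load 29 8 22, .load 30 10 22,
      .branch (.eq 25 1) (.block [.copy 25 29, .copy 26 30])
        (.branch (.eq 29 1) .skip (.block [.store 9 26 29, .copy 26 30]))]

/-- Record the contraction of the classes in registers `19`, `23` and `22`; put the size of the new
class into register `27` and its node that is incident to the matching into register `28`. -/
def recordContraction : RAMProgram :=
  .block
    [.store 15 17 21, .store 16 17 20, .store 17 17 19, .store 18 17 23, .store 19 17 22,
      .load 25 11 23, .load 26 11 19, .store 20 17 25, .store 21 17 26, .add 25 25 26,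
      .load 26 11 22, .add 27 25 26, .load 28 7 23]

/-- Join the trees of the classes in registers `19`, `23` and `22`. -/
def joinClasses : RAMProgram :=
  .block [.copy 10 19, .copy 11 23, joinRoots, .copy 10 12, .copy 11 22, joinRoots]

/-- Store the data of the new class in register `12`. -/
def storeClass : RAMProgram :=
  .block
    [.store 22 17 12, .store 7 12 28, .store 8 12 25, .store 10 12 26, .store 11 12 27,
      .store 12 24 12, .store 14 12 24, .copy 16 24, .store 3 21 2, .add 17 17 3]

/-- Contract the classes in registers `19`, `23` and `22`. -/
def contractClasses : RAMProgram :=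
  .block [chooseTarget, recordContraction, joinLists, joinClasses, storeClass]

/-- The step for a topmost class that is entered by a matching edge only. -/
def closeClass : RAMProgram :=
  .block
    [.load 20 13 16, .load 25 7 19, .load 21 6 25, .load 4 0 21, findRoot, .copy 22 5,
      .sub 24 16 3, .load 23 12 24,
      .branch (.eq 22 23) (.const 18 1) contractClasses]

/-- One step of the search. -/
def searchStep : RAMProgram :=
  .block
    [.load 19 12 16, .load 20 8 19,
      .branch (.eq 20 1) (.branch (.eq 16 2) restartSearch closeClass) scanEdge]

/-- Search for two antiparallel edges between two classes, one of them in the matching. -/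
def searchLoop : RAMProgram :=
  .loop (.eq 18 2) searchStep

/-- The amount of work that is left, apart from that for the disjoint set forest. -/
def searchWeight (n m : ℕ) (h : List MergeStep) (U : Finset ℕ) (s : RAMState) : ℕ :=
  2 * U.card + 3 * ((Finset.range n).filter fun x => mergedRep h x = x).card +
    if s.reg 16 = 0 ∧ s.mem 8 (s.mem 12 0) = m then 1 else 0

/-! ### Restarting the search -/

namespace SearchState

variable {W n m a : ℕ} {tl hd : ℕ → ℕ} {M : List ℕ} {h : List MergeStep} {B : List ℕ}
  {U : Finset ℕ} {s s' : RAMState}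

theorem congr (hs : SearchState n m tl hd M h B U s) (hm : s'.mem = s.mem)
    (hr : ∀ r, r < 4 ∨ r = 16 ∨ r = 17 → s'.reg r = s.reg r) :
    SearchState n m tl hd M h B U s' := by
  have h16 := hr 16 (by omega)
  have h17 := hr 17 (by omega)
  constructor
  · rw [hr 0 (by omega)]; exact hs.reg_nodes
  · rw [hr 1 (by omega)]; exact hs.reg_edges
  · rw [hr 2 (by omega)]; exact hs.reg_zero
  · rw [hr 3 (by omega)]; exact hs.reg_one
  · rw [h17]; exact hs.reg_steps
  all_goals (try rw [hm]); (try rw [h16])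
  exacts [hs.tails, hs.heads, hs.out, hs.forest, hs.mate, hs.base, hs.lists, hs.size, hs.stack,
    hs.recorded, hs.unscanned_lt, hs.contraction, hs.balanced, hs.card_roots]

theorem update_forest (hs : SearchState n m tl hd M h B U s) {p : ℕ → ℕ}
    (hp : IsSetForest n p (s.mem 5) (mergedRep h))
    (hm : s'.mem = Function.update s.mem 4 p)
    (hr : ∀ r, r < 4 ∨ r = 16 ∨ r = 17 → s'.reg r = s.reg r) :
    SearchState n m tl hd M h B U s' := by
  have h16 := hr 16 (by omega)
  have h17 := hr 17 (by omega)
  have hne : ∀ i, i ≠ 4 → s'.mem i = s.mem i := fun i hi => by rw [hm, Function.update_of_ne hi]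
  have h4 : s'.mem 4 = p := by rw [hm, Function.update_self]
  constructor
  · rw [hr 0 (by omega)]; exact hs.reg_nodes
  · rw [hr 1 (by omega)]; exact hs.reg_edges
  · rw [hr 2 (by omega)]; exact hs.reg_zero
  · rw [hr 3 (by omega)]; exact hs.reg_one
  · rw [h17]; exact hs.reg_steps
  · rw [hne 0 (by omega)]; exact hs.tails
  · rw [hne 1 (by omega)]; exact hs.heads
  · rw [hne 3 (by omega)]; exact hs.out
  · rw [h4, hne 5 (by omega)]; exact hp
  · rw [hne 6 (by omega)]; exact hs.mate
  · rw [hne 7 (by omega)]; exact hs.base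
  · rw [hne 8 (by omega), hne 9 (by omega), hne 10 (by omega)]; exact hs.lists
  · rw [hne 11 (by omega)]; exact hs.size
  · rw [hne 12 (by omega), hne 13 (by omega), hne 14 (by omega), h16]; exact hs.stack
  · exact hs.recorded.congr fun b h₁ h₂ i _ => by rw [hne b (by omega)]
  · exact hs.unscanned_lt
  · rw [hne 13 (by omega), h16]; exact hs.contraction
  · rw [hne 12 (by omega), h16]; exact hs.balanced
  · exact hs.card_roots

theorem wp_findRoot (hs : SearchState n m tl hd M h B U s) (ha : n < ackermannLevel a 1)
    (hx : s.reg 4 < n) :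
    Wp W findRoot s fun s' t => SearchState n m tl hd M h B U s' ∧
      s'.reg 5 = mergedRep h (s.reg 4) ∧ (∀ i, i ≠ 4 → s'.mem i = s.mem i) ∧
      (∀ i, i < 5 ∨ 9 < i → s'.reg i = s.reg i) ∧
      10 * forestPotential a n (s'.mem 4) (s'.mem 5) + t ≤
        10 * forestPotential a n (s.mem 4) (s.mem 5) + 10 * a + 10 := by
  refine (_root_.wp_findRoot hs.forest ha rfl rfl hx).mono ?_
  rintro s' t ⟨p, hp, hm, h5, hf, ht⟩
  have hne : ∀ i, i ≠ 4 → s'.mem i = s.mem i := fun i hi => by rw [hm, Function.update_of_ne hi]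
  refine ⟨hs.update_forest hp hm fun r hr => hf r (by omega), h5, hne, hf, ?_⟩
  rw [hne 5 (by omega), hm, Function.update_self]
  exact ht

/-- The matching edge of a class, as read off from the arrays. -/
theorem mate_base (hs : SearchState n m tl hd M h B U s) {e : ℕ} (he : e ∈ B) :
    s.mem 6 (s.mem 7 (mergedRep h (hd e))) = e := by
  rw [hs.base _ (mem_edgeEnds.2 ⟨e, he, Or.inr rfl⟩)]
  exact (hs.mate e (hs.contraction.subset e he)).2

/-- The last summand of `searchWeight` exists for this step, which neither scans nor contracts. An
unscanned edge enters the new class by `exists_unscanned`, so the summand drops from one to zero and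
two restarts cannot follow each other. -/
theorem wp_restartSearch (hG : IsMatchedDigraph n m tl hd M)
    (hs : SearchState n m tl hd M h B U s) (ha : n < ackermannLevel a 1)
    (h19 : s.reg 19 = s.mem 12 (s.reg 16)) (h8 : s.mem 8 (s.reg 19) = m) (h16 : s.reg 16 = 0) :
    Wp W restartSearch s fun s' t => SearchState n m tl hd M h B U s' ∧ s'.reg 18 = s.reg 18 ∧
      searchWeight n m h U s' + 1 ≤ searchWeight n m h U s ∧
      10 * forestPotential a n (s'.mem 4) (s'.mem 5) + t ≤
        10 * forestPotential a n (s.mem 4) (s.mem 5) + 10 * a + 20 := by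
  have hx := hs.stack.lt _ le_rfl
  have hrx := hs.stack.root _ le_rfl
  rw [← h19] at hx hrx
  obtain ⟨e, he, hex, -⟩ := hs.exists_matching_edge hG
    (by rw [← h19]; exact (hs.lists.first_eq_iff hx hrx).1 h8)
  rw [← h19] at hex
  have hmate := hs.mate_base he
  have hem := hG.edge_lt e (hs.contraction.subset e he)
  rw [hex] at hmate
  simp only [restartSearch, RAMProgram.block, Wp.seq_iff, Wp.load_iff]
  have hs₁ := hs.congr (s' := ((s.setReg 25 (s.mem 7 (s.reg 19))).setReg 21
    (s.mem 6 (s.mem 7 (s.reg 19)))).setReg 4 (s.mem 0 (s.mem 6 (s.mem 7 (s.reg 19))))) rfl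
    (by intro r hr; simp only [RAMState.reg_setReg]; grind)
  simp only [RAMState.reg_setReg, RAMState.mem_setReg, if_true]
  have hlt : tl e < n := hG.tail_lt e hem
  refine (hs₁.wp_findRoot ha ?_).mono ?_
  · simpa [RAMState.reg_setReg, hmate, hs.tails] using hlt
  rintro s₂ t₂ ⟨hs₂, h5, hm, hf, ht⟩
  simp only [RAMState.mem_setReg] at hm ht
  simp only [Wp.store_iff]
  have h5' : s₂.reg 5 = mergedRep h (tl e) := by
    rw [h5]; simp [RAMState.reg_setReg, hmate, hs.tails]
  have h16' : s₂.reg 16 = 0 := by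
    rw [hf 16 (by omega)]; simpa [RAMState.reg_setReg] using h16
  have h18' : s₂.reg 18 = s.reg 18 := by
    rw [hf 18 (by omega)]; simp [RAMState.reg_setReg]
  have hn := hs.forest.rep_lt _ hlt
  have hrr := hs.forest.rep_rep hlt
  have hbal : IsBalanced tl hd (mergedRep h) U B (mergedRep h (tl e)) (mergedRep h (tl e)) := by
    have := hs.balanced
    rw [h16] at this
    exact this.restart _
  have hne := hs.exists_unscanned hG he rfl hbal
  rw [← hs.lists.first_eq_iff hn hrr] at hne
  refine ⟨?_, by simpa [RAMState.reg_setMem] using h18', ?_, ?_⟩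
  · constructor
    all_goals try simp only [RAMState.mem_setMem, RAMState.reg_setMem, hs₂.reg_zero, h5', h16']
    · exact hs₂.reg_nodes
    · exact hs₂.reg_edges
    · exact hs₂.reg_one
    · exact hs₂.reg_steps
    · exact hs₂.tails
    · exact hs₂.heads
    · exact hs₂.out
    · exact hs₂.forest
    · exact hs₂.mate
    · exact hs₂.base
    · exact hs₂.lists
    · exact hs₂.size
    · exact IsStack.restart hn hrr
    · refine hs₂.recorded.congr fun b h₁ h₂ i _ => ?_
      simp only [RAMState.mem_setMem]
      rw [if_neg (by omega), if_neg (by omega)]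
    · exact hs₂.unscanned_lt
    · refine hs₂.contraction.mono ?_
      rintro g (hg | ⟨j, hj, -⟩)
      exacts [Or.inl hg, by omega]
    · simpa using hbal
    · exact hs₂.card_roots
  · have h8' : s.mem 8 (s.mem 12 0) = m := by rw [← h16, ← h19]; exact h8
    simp [searchWeight, RAMState.mem_setMem, RAMState.reg_setMem, h16', h16, h5', hs₂.reg_zero,
      hm 8, hne, h8']
  · simp only [RAMState.mem_setMem]
    norm_num
    omega

end SearchState

/-! ### Scanning an edge -/

namespace SearchState

variable {W n m a : ℕ} {tl hd : ℕ → ℕ} {M : List ℕ} {h : List MergeStep} {B : List ℕ}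
  {U : Finset ℕ} {s s' : RAMState}

/-- The scanned edge and the stack edges above position `j` form a closed walk of classes.
Discarding it preserves the balance, and the live edges only become fewer. For `j` equal to the
stack pointer the scanned edge is a loop of the contracted digraph. -/
theorem of_pop (hs : SearchState n m tl hd M h B U s)
    (h8 : s.mem 8 (s.mem 12 (s.reg 16)) ≠ m) {g j : ℕ}
    (hg : g = s.mem 8 (s.mem 12 (s.reg 16))) (hj : j ≤ s.reg 16)
    (hja : s.mem 12 j = mergedRep h (tl g))
    (hr : ∀ r, r < 4 ∨ r = 17 → s'.reg r = s.reg r) (h16' : s'.reg 16 = j)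
    (hm : ∀ i, i ≠ 8 → s'.mem i = s.mem i)
    (h8' : s'.mem 8 = Function.update (s.mem 8) (s.mem 12 (s.reg 16)) (s.mem 9 g)) :
    SearchState n m tl hd M h B (U.erase g) s' := by
  obtain ⟨hgU, hgr, hl⟩ := hs.lists.pop (hs.stack.lt _ le_rfl) (hs.stack.root _ le_rfl) h8
  rw [← hg] at hgU hgr hl
  constructor
  · rw [hr 0 (by omega)]; exact hs.reg_nodes
  · rw [hr 1 (by omega)]; exact hs.reg_edges
  · rw [hr 2 (by omega)]; exact hs.reg_zero
  · rw [hr 3 (by omega)]; exact hs.reg_one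
  · rw [hr 17 (by omega)]; exact hs.reg_steps
  · rw [hm 0 (by omega)]; exact hs.tails
  · rw [hm 1 (by omega)]; exact hs.heads
  · rw [hm 3 (by omega)]; exact hs.out
  · rw [hm 4 (by omega), hm 5 (by omega)]; exact hs.forest
  · rw [hm 6 (by omega)]; exact hs.mate
  · rw [hm 7 (by omega)]; exact hs.base
  · rw [h8', hm 9 (by omega), hm 10 (by omega)]; exact hl
  · rw [hm 11 (by omega)]; exact hs.size
  · rw [hm 12 (by omega), hm 13 (by omega), hm 14 (by omega), h16']; exact hs.stack.pop hj
  · exact hs.recorded.congr fun b h₁ h₂ i _ => by rw [hm b (by omega)]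
  · exact fun g' hg' => hs.unscanned_lt g' (Finset.mem_of_mem_erase hg')
  · rw [hm 13 (by omega), h16']
    refine hs.contraction.mono ?_
    rintro g' (hg' | ⟨i, hi, hi'⟩)
    exacts [Or.inl (Finset.mem_of_mem_erase hg'), Or.inr ⟨i, by omega, hi'⟩]
  · rw [hm 12 (by omega), h16', hja]; exact hs.balanced.scan hgU hgr
  · exact hs.card_roots

/-- The scanned edge moves from the unscanned edges to the stack, so no new edge becomes live, and
the balancing path is prolonged by it. -/
theorem of_push (hG : IsMatchedDigraph n m tl hd M) (hs : SearchState n m tl hd M h B U s)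
    (h8 : s.mem 8 (s.mem 12 (s.reg 16)) ≠ m) {g : ℕ}
    (hg : g = s.mem 8 (s.mem 12 (s.reg 16)))
    (hnew : ∀ j ≤ s.reg 16, s.mem 12 j ≠ mergedRep h (tl g))
    (hr : ∀ r, r < 4 ∨ r = 17 → s'.reg r = s.reg r) (h16' : s'.reg 16 = s.reg 16 + 1)
    (hm : ∀ i, i ≠ 8 → i ≠ 12 → i ≠ 13 → i ≠ 14 → s'.mem i = s.mem i)
    (h8' : s'.mem 8 = Function.update (s.mem 8) (s.mem 12 (s.reg 16)) (s.mem 9 g))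
    (h12' : s'.mem 12 = Function.update (s.mem 12) (s.reg 16 + 1) (mergedRep h (tl g)))
    (h13' : s'.mem 13 = Function.update (s.mem 13) (s.reg 16 + 1) g)
    (h14' : s'.mem 14 = Function.update (s.mem 14) (mergedRep h (tl g)) (s.reg 16 + 1)) :
    SearchState n m tl hd M h B (U.erase g) s' := by
  obtain ⟨hgU, hgr, hl⟩ := hs.lists.pop (hs.stack.lt _ le_rfl) (hs.stack.root _ le_rfl) h8
  rw [← hg] at hgU hgr hl
  have hlt := hG.tail_lt g (hs.unscanned_lt g hgU)
  constructor
  · rw [hr 0 (by omega)]; exact hs.reg_nodes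
  · rw [hr 1 (by omega)]; exact hs.reg_edges
  · rw [hr 2 (by omega)]; exact hs.reg_zero
  · rw [hr 3 (by omega)]; exact hs.reg_one
  · rw [hr 17 (by omega)]; exact hs.reg_steps
  · rw [hm 0 (by omega) (by omega) (by omega) (by omega)]; exact hs.tails
  · rw [hm 1 (by omega) (by omega) (by omega) (by omega)]; exact hs.heads
  · rw [hm 3 (by omega) (by omega) (by omega) (by omega)]; exact hs.out
  · rw [hm 4 (by omega) (by omega) (by omega) (by omega),
      hm 5 (by omega) (by omega) (by omega) (by omega)]
    exact hs.forest
  · rw [hm 6 (by omega) (by omega) (by omega) (by omega)]; exact hs.mate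
  · rw [hm 7 (by omega) (by omega) (by omega) (by omega)]; exact hs.base
  · rw [h8', hm 9 (by omega) (by omega) (by omega) (by omega),
      hm 10 (by omega) (by omega) (by omega) (by omega)]
    exact hl
  · rw [hm 11 (by omega) (by omega) (by omega) (by omega)]; exact hs.size
  · rw [h12', h13', h14', h16']
    exact hs.stack.push (hs.forest.rep_lt _ hlt) (hs.forest.rep_rep hlt) hnew rfl hgr
  · exact hs.recorded.congr fun b h₁ h₂ i _ => by
      rw [hm b (by omega) (by omega) (by omega) (by omega)]
  · exact fun g' hg' => hs.unscanned_lt g' (Finset.mem_of_mem_erase hg')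
  · rw [h13', h16']
    refine hs.contraction.mono ?_
    rintro g' (hg' | ⟨i, hi, hi'⟩)
    · exact Or.inl (Finset.mem_of_mem_erase hg')
    · rw [Function.update_apply] at hi'
      split_ifs at hi' with he
      · exact Or.inl (hi' ▸ hgU)
      · exact Or.inr ⟨i, by omega, hi'⟩
  · rw [h12', h16', Function.update_self, Function.update_of_ne (by omega)]
    exact hs.balanced.scan hgU hgr
  · exact hs.card_roots

theorem wp_scanEdge (hG : IsMatchedDigraph n m tl hd M)
    (hs : SearchState n m tl hd M h B U s) (ha : n < ackermannLevel a 1) (hW : n < W)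
    (h19 : s.reg 19 = s.mem 12 (s.reg 16)) (h20 : s.reg 20 = s.mem 8 (s.reg 19))
    (h8 : s.reg 20 ≠ m) :
    Wp W scanEdge s fun s' t => (∃ U', SearchState n m tl hd M h B U' s' ∧
      searchWeight n m h U' s' + 1 ≤ searchWeight n m h U s) ∧ s'.reg 18 = s.reg 18 ∧
      10 * forestPotential a n (s'.mem 4) (s'.mem 5) + t ≤
        10 * forestPotential a n (s.mem 4) (s.mem 5) + 10 * a + 30 := by
  rw [h20, h19] at h8
  have hsp := hs.stack.pointer_lt
  obtain ⟨hgU, -, -⟩ := hs.lists.pop (hs.stack.lt _ le_rfl) (hs.stack.root _ le_rfl) h8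
  rw [← h19, ← h20] at hgU
  have hgm := hs.unscanned_lt _ hgU
  have hlt := hG.tail_lt _ hgm
  simp only [scanEdge, RAMProgram.block, Wp.seq_iff, Wp.load_iff]
  have hs₁ := hs.congr (s' := s.setReg 4 (s.mem 0 (s.reg 20))) rfl
    (by intro r hr; simp only [RAMState.reg_setReg]; grind)
  refine (hs₁.wp_findRoot ha ?_).mono ?_
  · simpa [RAMState.reg_setReg, hs.tails] using hlt
  rintro s₂ t₂ ⟨hs₂, h5, hm, hf, ht⟩
  simp only [RAMState.mem_setReg] at hm ht
  have h5' : s₂.reg 5 = mergedRep h (tl (s.reg 20)) := by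
    rw [h5]; simp [RAMState.reg_setReg, hs.tails]
  have hf' : ∀ i, i < 4 ∨ 9 < i → s₂.reg i = s.reg i := by
    intro i hi
    rw [hf i (by omega)]
    simp only [RAMState.reg_setReg]
    rw [if_neg (by omega)]
  have h16' := hf' 16 (by omega)
  have h18' := hf' 18 (by omega)
  have h19' := hf' 19 (by omega)
  have h20' := hf' 20 (by omega)
  have hone := hs₂.reg_one
  have hm8 := hm 8 (by omega)
  have hm9 := hm 9 (by omega)
  have hm12 := hm 12 (by omega)
  have hm14 := hm 14 (by omega)
  have hh8 : s₂.mem 8 (s₂.mem 12 (s₂.reg 16)) ≠ m := by rw [hm8, hm12, h16']; exact h8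
  have hhg : s.reg 20 = s₂.mem 8 (s₂.mem 12 (s₂.reg 16)) := by rw [hm8, hm12, h16', h20, h19]
  -- The scanned edge releases two units, of which the summand for an exhausted single class may
  -- take one.
  have hweight : ∀ s', searchWeight n m h (U.erase (s.reg 20)) s' + 1 ≤ searchWeight n m h U s := by
    intro s'
    have := Finset.card_erase_add_one hgU
    simp only [searchWeight]
    split_ifs <;> omega
  have hpush : (∀ j ≤ s₂.reg 16, s₂.mem 12 j ≠ mergedRep h (tl (s.reg 20))) →
      ∀ s₃ : RAMState, s₃.mem = (s₂.setMem 8 (s.reg 19) (s.mem 9 (s.reg 20))).mem →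
      (∀ r, r ≠ 24 → r ≠ 25 → s₃.reg r = s₂.reg r) → Wp W pushClass s₃ fun s' t =>
        SearchState n m tl hd M h B (U.erase (s.reg 20)) s' ∧ s'.reg 18 = s.reg 18 ∧
          s'.mem 4 = s₂.mem 4 ∧ s'.mem 5 = s₂.mem 5 ∧ t ≤ 4 := by
    intro hnew s₃ hm₃ hr₃
    have hr3 := hr₃ 3 (by omega) (by omega)
    have hr5 := hr₃ 5 (by omega) (by omega)
    have hr16 := hr₃ 16 (by omega) (by omega)
    have hr18 := hr₃ 18 (by omega) (by omega)
    have hr20 := hr₃ 20 (by omega) (by omega)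
    simp only [pushClass, RAMProgram.block, Wp.seq_iff, Wp.store_iff, Wp.add_iff]
    simp only [RAMState.reg_setReg, RAMState.reg_setMem, RAMState.mem_setReg,
      RAMState.mem_setMem]
    norm_num [hr3, hr5, hr16, hr18, hr20, hone, h16', h18', h20', h5', hm₃, RAMState.mem_setMem]
    refine ⟨by omega, ?_⟩
    apply hs₂.of_push hG hh8 hhg hnew
    · intro r hr
      simp only [RAMState.reg_setReg, RAMState.reg_setMem]
      rw [if_neg (by omega), hr₃ r (by omega) (by omega)]
    · simp [RAMState.reg_setReg, RAMState.reg_setMem, h16']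
    · intro i h₁ h₂ h₃ h₄
      simp [RAMState.mem_setReg, RAMState.mem_setMem, hm₃, h₁, h₂, h₃, h₄]
    · simp [RAMState.mem_setReg, RAMState.mem_setMem, hm₃, hm9, hm12, h16', h19]
    · simp [RAMState.mem_setReg, RAMState.mem_setMem, hm₃, h16']
    · simp [RAMState.mem_setReg, RAMState.mem_setMem, hm₃, h16']
    · simp [RAMState.mem_setReg, RAMState.mem_setMem, hm₃, h16']
  simp only [Wp.store_iff, Wp.branch_iff, Wp.seq_iff, Wp.load_iff, Wp.copy_iff, RAMTest.Holds]
  simp only [RAMState.reg_setReg, RAMState.reg_setMem, RAMState.mem_setReg, RAMState.mem_setMem,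
    h19', h20', h16', hm9, hm14, hm12]
  norm_num
  refine ⟨fun hlt' => ?_, fun hle => ⟨fun heq => ⟨⟨U.erase (s.reg 20), ?_, hweight _⟩, h18', ?_⟩,
    fun hne => ?_⟩⟩
  · have := hpush (fun j hj he => by
      have := hs₂.stack.lev_eq j hj
      rw [he, ← h5', hm14] at this
      omega)
      (((s₂.setReg 25 (s.mem 9 (s.reg 20))).setMem 8 (s.reg 19) (s.mem 9 (s.reg 20))).setReg 24
          (s.mem 14 (s₂.reg 5))) rfl
      (fun r h₁ h₂ => by simp [RAMState.reg_setReg, RAMState.reg_setMem, h₁, h₂])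
    refine this.mono ?_
    rintro s' t ⟨k₁, k₂, k₃, k₄, k₅⟩
    exact ⟨⟨_, k₁, hweight _⟩, k₂, by rw [k₃, k₄]; omega⟩
  · apply hs₂.of_pop hh8 hhg (j := s.mem 14 (s₂.reg 5))
    · rw [h16']; exact hle
    · rw [hm12, ← h5']; exact heq
    · intro r hr
      simp only [RAMState.reg_setReg, RAMState.reg_setMem]
      grind
    · simp [RAMState.reg_setReg]
    · intro i h₁
      simp [RAMState.mem_setReg, RAMState.mem_setMem, h₁]
    · simp [RAMState.mem_setReg, RAMState.mem_setMem, hm9, hm12, h16', h19]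
  · omega
  · refine (hpush (fun j hj he => hne ?_)
      ((((s₂.setReg 25 (s.mem 9 (s.reg 20))).setMem 8 (s.reg 19) (s.mem 9 (s.reg 20))).setReg 24
          (s.mem 14 (s₂.reg 5))).setReg 25 (s.mem 12 (s.mem 14 (s₂.reg 5)))) rfl
      (fun r h₁ h₂ => by simp [RAMState.reg_setReg, RAMState.reg_setMem, h₁, h₂])).mono ?_
    · have := hs₂.stack.lev_eq j hj
      rw [he, ← h5', hm14] at this
      rw [this, ← hm12, he, h5']
    rintro s' t ⟨k₁, k₂, k₃, k₄, k₅⟩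
    exact ⟨⟨_, k₁, hweight _⟩, k₂, by rw [k₃, k₄]; omega⟩

end SearchState

/-! ### Contracting three classes -/

theorem card_roots_merge {n : ℕ} {rep : ℕ → ℕ} {st : MergeStep} (hu : st.u < n ∧ rep st.u = st.u)
    (hv : st.v < n ∧ rep st.v = st.v) (hw : st.w < n ∧ rep st.w = st.w)
    (huv : st.u ≠ st.v) (hvw : st.v ≠ st.w) (hwu : st.w ≠ st.u)
    (hc : st.c = st.u ∨ st.c = st.v ∨ st.c = st.w) :
    ((Finset.range n).filter fun x => st.merge (rep x) = x).card + 2 =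
      ((Finset.range n).filter fun x => rep x = x).card := by
  set R := (Finset.range n).filter fun x => rep x = x ∧ x ≠ st.u ∧ x ≠ st.v ∧ x ≠ st.w with hR
  have h₁ : ((Finset.range n).filter fun x => rep x = x) =
      insert st.u (insert st.v (insert st.w R)) := by
    ext x
    simp only [hR, Finset.mem_filter, Finset.mem_range, Finset.mem_insert]
    grind
  have h₂ : ((Finset.range n).filter fun x => st.merge (rep x) = x) = insert st.c R := by
    ext x
    simp only [hR, Finset.mem_filter, Finset.mem_range, Finset.mem_insert, MergeStep.merge]
    grind
  rw [h₁, h₂, Finset.card_insert_of_notMem, Finset.card_insert_of_notMem,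
    Finset.card_insert_of_notMem, Finset.card_insert_of_notMem]
  · simp [hR]
  · simp [hR, hvw]
  · simp [hR, huv, hwu.symm]
  · simp only [hR, Finset.mem_filter]
    grind

namespace SearchState

variable {W n m a : ℕ} {tl hd : ℕ → ℕ} {M : List ℕ} {h : List MergeStep} {B : List ℕ}
  {U : Finset ℕ} {s s' : RAMState}

/-- The topmost class `u` of the stack, entered by the matching edge `e` from the class `w` and left
by the edge `f` to the class `v` below, may be contracted with `v` and `w`. -/
structure IsContractible (n m : ℕ) (tl hd : ℕ → ℕ) (M : List ℕ) (h : List MergeStep) (B : List ℕ)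
    (U : Finset ℕ) (s : RAMState) (st : MergeStep) (B' : List ℕ) : Prop
    extends SearchState n m tl hd M h B U s where
  digraph : IsMatchedDigraph n m tl hd M
  pos : 0 < s.reg 16
  hu : st.u = s.mem 12 (s.reg 16)
  hv : st.v = s.mem 12 (s.reg 16 - 1)
  hf : st.f = s.mem 13 (s.reg 16)
  hB : B.Perm (st.e :: B')
  tail_e : mergedRep h (tl st.e) = st.w
  head_e : mergedRep h (hd st.e) = st.u
  hvw : st.v ≠ st.w
  not_head : ∀ g ∈ U, mergedRep h (hd g) ≠ st.u
  not_tail : ∀ g ∈ U, mergedRep h (tl g) ≠ st.u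

namespace IsContractible

variable {st : MergeStep} {B' : List ℕ}

theorem tail_f (hs : IsContractible n m tl hd M h B U s st B') :
    mergedRep h (tl st.f) = st.u := by
  have := hs.stack.tail_eq (s.reg 16 - 1) (by have := hs.pos; omega)
  rwa [Nat.sub_add_cancel hs.pos, ← hs.hf, ← hs.hu] at this

theorem head_f (hs : IsContractible n m tl hd M h B U s st B') :
    mergedRep h (hd st.f) = st.v := by
  have := hs.stack.head_eq (s.reg 16 - 1) (by have := hs.pos; omega)
  rwa [Nat.sub_add_cancel hs.pos, ← hs.hf, ← hs.hv] at this

theorem huv (hs : IsContractible n m tl hd M h B U s st B') : st.u ≠ st.v := by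
  intro he
  rw [hs.hu, hs.hv] at he
  have := hs.stack.inj le_rfl (by omega) he
  have := hs.pos
  omega

theorem root_u (hs : IsContractible n m tl hd M h B U s st B') :
    st.u < n ∧ mergedRep h st.u = st.u := by
  rw [hs.hu]; exact ⟨hs.stack.lt _ le_rfl, hs.stack.root _ le_rfl⟩

theorem root_v (hs : IsContractible n m tl hd M h B U s st B') :
    st.v < n ∧ mergedRep h st.v = st.v := by
  rw [hs.hv]; exact ⟨hs.stack.lt _ (by omega), hs.stack.root _ (by omega)⟩

theorem mem_B (hs : IsContractible n m tl hd M h B U s st B') : st.e ∈ B :=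
  hs.hB.mem_iff.2 (by simp)

theorem edge_lt (hs : IsContractible n m tl hd M h B U s st B') : st.e < m :=
  hs.digraph.edge_lt _ (hs.contraction.subset _ hs.mem_B)

theorem root_w (hs : IsContractible n m tl hd M h B U s st B') :
    st.w < n ∧ mergedRep h st.w = st.w := by
  have := hs.digraph.tail_lt _ hs.edge_lt
  rw [← hs.tail_e]
  exact ⟨hs.forest.rep_lt _ this, hs.forest.rep_rep this⟩

theorem word (hs : IsContractible n m tl hd M h B U s st B') :
    st.w ≠ st.u ∧ st.w ∉ (edgeEnds tl hd B').map (mergedRep h) ∧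
      st.u ∉ (edgeEnds tl hd B').map (mergedRep h) := by
  obtain ⟨hw₁, -⟩ := hs.contraction.word hs.digraph.nodup hs.digraph.covers
  have hp := (permSign_edgeEnds (tl := tl) (hd := hd) hs.hB).map (mergedRep h)
  rw [edgeEnds_cons, List.map_cons, List.map_cons, hs.tail_e, hs.head_e] at hp
  have hn := hp.perm.nodup_iff.1 hw₁
  simp only [List.nodup_cons, List.mem_cons, not_or] at hn
  exact ⟨hn.1.1, hn.1.2, hn.2.1⟩

/-- The sum is the size of the merged class, which keeps it inside a word. The true root is not
known before the trees are joined; `st.u` stands in for it, as any of the three would do. -/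
theorem size_lt (hs : IsContractible n m tl hd M h B U s st B') :
    s.mem 11 st.v + s.mem 11 st.u + s.mem 11 st.w ≤ n := by
  rw [hs.size _ hs.root_v.1 hs.root_v.2, hs.size _ hs.root_u.1 hs.root_u.2,
    hs.size _ hs.root_w.1 hs.root_w.2,
    ← (classSize_merge (st := { st with c := st.u }) hs.huv hs.hvw hs.word.1 (Or.inl rfl) 0).2]
  exact (Finset.card_filter_le _ _).trans (by simp)

/-- The state after a contraction. -/
theorem searchState (hs : IsContractible n m tl hd M h B U s st B')
    (hsv : st.sv = s.mem 11 st.v) (hsu : st.su = s.mem 11 st.u)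
    (hc : st.c = st.u ∨ st.c = st.v ∨ st.c = st.w)
    {tgt fi la : ℕ} (ht : tgt < s.reg 16)
    (ht' : s.mem 12 tgt = st.v ∨ s.mem 12 tgt = st.w) (htw : ∀ j < tgt, s.mem 12 j ≠ st.w)
    (hlists : (s.mem 8 st.v = m ∧ fi = s.mem 8 st.w ∧ la = s.mem 10 st.w ∧ s'.mem 9 = s.mem 9) ∨
      (s.mem 8 st.v ≠ m ∧ s.mem 8 st.w = m ∧ fi = s.mem 8 st.v ∧ la = s.mem 10 st.v ∧
        s'.mem 9 = s.mem 9) ∨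
      (s.mem 8 st.v ≠ m ∧ s.mem 8 st.w ≠ m ∧ fi = s.mem 8 st.v ∧ la = s.mem 10 st.w ∧
        s'.mem 9 = Function.update (s.mem 9) (s.mem 10 st.v) (s.mem 8 st.w)))
    (hforest : IsSetForest n (s'.mem 4) (s'.mem 5) (mergedRep (st :: h)))
    (hr : ∀ r < 4, s'.reg r = s.reg r) (hr16 : s'.reg 16 = tgt) (hr17 : s'.reg 17 = h.length + 1)
    (hm : ∀ i, i = 0 ∨ i = 1 ∨ i = 6 ∨ i = 13 → s'.mem i = s.mem i)
    (hm3 : s'.mem 3 = Function.update (s.mem 3) st.e 0)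
    (hm7 : s'.mem 7 = Function.update (s.mem 7) st.c (s.mem 7 st.v))
    (hm8 : s'.mem 8 = Function.update (s.mem 8) st.c fi)
    (hm10 : s'.mem 10 = Function.update (s.mem 10) st.c la)
    (hm11 : s'.mem 11 = Function.update (s.mem 11) st.c
      (s.mem 11 st.v + s.mem 11 st.u + s.mem 11 st.w))
    (hm12 : s'.mem 12 = Function.update (s.mem 12) tgt st.c)
    (hm14 : s'.mem 14 = Function.update (s.mem 14) st.c tgt)
    (hm15 : s'.mem 15 = Function.update (s.mem 15) h.length st.e)
    (hm16 : s'.mem 16 = Function.update (s.mem 16) h.length st.f)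
    (hm17 : s'.mem 17 = Function.update (s.mem 17) h.length st.u)
    (hm18 : s'.mem 18 = Function.update (s.mem 18) h.length st.v)
    (hm19 : s'.mem 19 = Function.update (s.mem 19) h.length st.w)
    (hm20 : s'.mem 20 = Function.update (s.mem 20) h.length st.sv)
    (hm21 : s'.mem 21 = Function.update (s.mem 21) h.length st.su)
    (hm22 : s'.mem 22 = Function.update (s.mem 22) h.length st.c) :
    SearchState n m tl hd M (st :: h) B' U s' ∧
      searchWeight n m (st :: h) U s' + 1 ≤ searchWeight n m h U s := by
  obtain ⟨hwu, hw, hu'⟩ := hs.word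
  obtain ⟨hw₁, -⟩ := hs.contraction.word hs.digraph.nodup hs.digraph.covers
  have hcard : ((Finset.range n).filter fun x => mergedRep (st :: h) x = x).card + 2 =
      ((Finset.range n).filter fun x => mergedRep h x = x).card :=
    card_roots_merge hs.root_u hs.root_v hs.root_w hs.huv hs.hvw hwu hc
  have hcr : st.c < n ∧ mergedRep h st.c = st.c := by
    rcases hc with hc | hc | hc <;> rw [hc]
    exacts [hs.root_u, hs.root_v, hs.root_w]
  have hsvs := hs.size _ hs.root_v.1 hs.root_v.2
  have hsus := hs.size _ hs.root_u.1 hs.root_u.2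
  have hsws := hs.size _ hs.root_w.1 hs.root_w.2
  refine ⟨?_, ?_⟩
  · constructor
    · rw [hr 0 (by omega)]; exact hs.reg_nodes
    · rw [hr 1 (by omega)]; exact hs.reg_edges
    · rw [hr 2 (by omega)]; exact hs.reg_zero
    · rw [hr 3 (by omega)]; exact hs.reg_one
    · simpa using hr17
    · rw [hm 0 (by omega)]; exact hs.tails
    · rw [hm 1 (by omega)]; exact hs.heads
    · intro g
      -- `B` has no repeated entries, so clearing a single flag removes `e`.
      have hBn := hs.hB.nodup_iff.1 (nodup_of_nodup_edgeEnds hw₁.of_map)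
      rw [hm3, Function.update_apply]
      split_ifs with hge hgB hgB
      · rw [hge] at hgB; exact absurd hgB (List.nodup_cons.1 hBn).1
      · rfl
      · rw [hs.out, if_pos (hs.hB.mem_iff.2 (by simp [hgB]))]
      · rw [hs.out, if_neg]
        rw [hs.hB.mem_iff, List.mem_cons, not_or]
        exact ⟨hge, hgB⟩
    · exact hforest
    · rw [hm 6 (by omega)]; exact hs.mate
    · intro z hz
      have hzB : z ∈ edgeEnds tl hd B := by
        rw [(permSign_edgeEnds hs.hB).perm.mem_iff, edgeEnds_cons]; simp [hz]
      have hb := hs.base z hzB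
      have hzu : mergedRep h z ≠ st.u := fun he => hu' (he ▸ List.mem_map_of_mem hz)
      have hzw : mergedRep h z ≠ st.w := fun he => hw (he ▸ List.mem_map_of_mem hz)
      rw [hm7]
      by_cases hzv : mergedRep h z = st.v
      · have : mergedRep (st :: h) z = st.c := by simp [mergedRep, MergeStep.merge, hzv]
        rw [this, Function.update_self, ← hzv, hb]
      · have : mergedRep (st :: h) z = mergedRep h z := by
          simp [mergedRep, MergeStep.merge, hzv, hzu, hzw]
        rw [this, Function.update_of_ne (by grind), hb]
    · rw [hm8, hm10]
      exact hs.lists.merge hs.not_head hs.root_v.1 hs.root_w.1 hs.root_v.2 hs.root_w.2 hs.hvw hc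
        hlists
    · intro r hrn hrr
      have hsize := classSize_merge (n := n) (rep := mergedRep h) hs.huv hs.hvw hwu hc
      rw [hm11, Function.update_apply]
      split_ifs with hrc
      · rw [hrc]
        refine Eq.trans ?_ (hsize 0).2.symm
        rw [hsvs, hsus, hsws]
      · have : mergedRep h r = r ∧ r ≠ st.u ∧ r ≠ st.v ∧ r ≠ st.w := by
          simp only [mergedRep, MergeStep.merge] at hrr
          grind
        refine Eq.trans ?_ ((hsize r).1 hrc this.2.1 this.2.2.1 this.2.2.2).symm
        exact hs.size r hrn this.1
    · rw [hm12, hm 13 (by omega), hm14, hr16]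
      exact hs.stack.merge ht hs.hu.symm hs.hv.symm ht' htw hcr.1 hcr.2 hc
    · refine ⟨?_, hs.recorded.congr fun b h₁ h₂ i hi => ?_⟩
      · rw [hm15, hm16, hm17, hm18, hm19, hm20, hm21, hm22]
        simp only [Function.update_self, and_self]
      · have hne : i ≠ h.length := hi.ne
        interval_cases b
        · rw [hm15, Function.update_of_ne hne]
        · rw [hm16, Function.update_of_ne hne]
        · rw [hm17, Function.update_of_ne hne]
        · rw [hm18, Function.update_of_ne hne]
        · rw [hm19, Function.update_of_ne hne]
        · rw [hm20, Function.update_of_ne hne]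
        · rw [hm21, Function.update_of_ne hne]
        · rw [hm22, Function.update_of_ne hne]
    · exact hs.unscanned_lt
    · refine .step st hs.contraction ⟨hs.hB, hs.tail_e, hs.head_e, hs.tail_f, hs.head_f, hs.huv,
        hs.hvw, hc, hs.root_v, ?_, ?_, ?_, by rw [hsv, hsvs], by rw [hsu, hsus]⟩
      · refine Or.inr ⟨s.reg 16 - 1, by have := hs.pos; omega, ?_⟩
        rw [Nat.sub_add_cancel hs.pos, hs.hf]
      · rw [hm 13 (by omega), hr16]
        rintro g (hg | ⟨j, hj, hjg⟩)
        exacts [Or.inl hg, Or.inr ⟨j, by omega, hjg⟩]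
      · rw [hm 13 (by omega), hr16]
        rintro g (hg | ⟨j, hj, hjg⟩)
        · exact ⟨hs.not_tail g hg, hs.not_head g hg⟩
        -- The stack edges that remain join positions at most `tgt`, whereas `u` occurs only at the
        -- top.
        · rw [← hjg, hs.stack.tail_eq j (by omega), hs.stack.head_eq j (by omega), hs.hu]
          refine ⟨fun he => ?_, fun he => ?_⟩
          · have := hs.stack.inj (by omega) le_rfl he; omega
          · have := hs.stack.inj (by omega) le_rfl he; omega
    · have hbal := hs.balanced
      rw [← hs.hu] at hbal
      have := hbal.merge hs.hB hs.tail_e hs.head_e hs.huv hs.hvw hwu hc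
      rw [hm12, hr16, Function.update_self]
      -- The bottom class takes part in the contraction only if the new class is placed at position
      -- zero.
      have hbot : Function.update (s.mem 12) tgt st.c 0 = st.merge (s.mem 12 0) := by
        rw [Function.update_apply]
        split_ifs with h0
        · rw [← h0] at ht'
          rcases ht' with he | he <;> rw [he] <;> simp [MergeStep.merge]
        · have h₁ : s.mem 12 0 ≠ st.u := by
            rw [hs.hu]; intro he
            have := hs.stack.inj (Nat.zero_le _) le_rfl he; omega
          have h₂ : s.mem 12 0 ≠ st.v := by
            rw [hs.hv]; intro he
            have := hs.stack.inj (Nat.zero_le _) (by omega) he; omega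
          have h₃ : s.mem 12 0 ≠ st.w := htw 0 (by omega)
          simp [MergeStep.merge, h₁, h₂, h₃]
      rw [hbot]
      exact this
    · have := hs.card_roots
      rw [List.length_cons]
      omega
  · have h16 : ¬ (s.reg 16 = 0 ∧ s.mem 8 (s.mem 12 0) = m) := by
      have := hs.pos
      omega
    simp only [searchWeight, if_neg h16]
    split_ifs <;> omega

end IsContractible

end SearchState

/-! ### The program for a contraction -/

namespace SearchState

variable {W n m a : ℕ} {tl hd : ℕ → ℕ} {M : List ℕ} {h : List MergeStep} {B : List ℕ}
  {U : Finset ℕ} {s s' : RAMState}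

/-- The new class takes the place of the second class from the top, unless the tail of the matching
edge lies in a class of the stack. In that case it takes the place of that class, because the stack
edges above have become a closed walk. -/
theorem wp_chooseTarget (hs : SearchState n m tl hd M h B U s) (hpos : 0 < s.reg 16)
    (hu : s.reg 22 ≠ s.mem 12 (s.reg 16)) (h24 : s.reg 24 = s.reg 16 - 1) :
    Wp W chooseTarget s fun s' t => s'.mem = s.mem ∧ s'.reg 24 < s.reg 16 ∧
      (s.mem 12 (s'.reg 24) = s.mem 12 (s.reg 16 - 1) ∨ s.mem 12 (s'.reg 24) = s.reg 22) ∧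
      (∀ j < s'.reg 24, s.mem 12 j ≠ s.reg 22) ∧
      (∀ r, r < 24 → s'.reg r = s.reg r) ∧ t ≤ 6 := by
  simp only [chooseTarget, RAMProgram.block, Wp.seq_iff, Wp.load_iff, Wp.branch_iff, Wp.skip_iff,
    Wp.copy_iff, RAMTest.Holds]
  simp only [RAMState.reg_setReg, RAMState.mem_setReg]
  norm_num [h24]
  refine ⟨fun hlt => ⟨hpos, fun j hj he => ?_, by grind⟩,
    fun hle => ⟨fun heq => ⟨?_, Or.inr heq, fun j hj he => ?_, by grind⟩,
      fun hne => ⟨hpos, fun j hj he => ?_, by grind⟩⟩⟩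
  · have := hs.stack.lev_eq j (by omega)
    rw [he] at this
    omega
  · refine lt_of_le_of_ne hle fun he => hu ?_
    rw [← heq, he]
  · have := hs.stack.lev_eq j (by omega)
    rw [he] at this
    omega
  · have := hs.stack.lev_eq j (by omega)
    rw [he] at this
    rw [this] at hne
    exact hne he

theorem wp_joinLists :
    Wp W joinLists s fun s' t => (∀ i, i ≠ 9 → s'.mem i = s.mem i) ∧
      ((s.mem 8 (s.reg 23) = s.reg 1 ∧ s'.reg 25 = s.mem 8 (s.reg 22) ∧
          s'.reg 26 = s.mem 10 (s.reg 22) ∧ s'.mem 9 = s.mem 9) ∨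
        (s.mem 8 (s.reg 23) ≠ s.reg 1 ∧ s.mem 8 (s.reg 22) = s.reg 1 ∧
          s'.reg 25 = s.mem 8 (s.reg 23) ∧ s'.reg 26 = s.mem 10 (s.reg 23) ∧
          s'.mem 9 = s.mem 9) ∨
        (s.mem 8 (s.reg 23) ≠ s.reg 1 ∧ s.mem 8 (s.reg 22) ≠ s.reg 1 ∧
          s'.reg 25 = s.mem 8 (s.reg 23) ∧ s'.reg 26 = s.mem 10 (s.reg 22) ∧
          s'.mem 9 = Function.update (s.mem 9) (s.mem 10 (s.reg 23)) (s.mem 8 (s.reg 22)))) ∧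
      (∀ r, r < 25 ∨ r = 27 ∨ r = 28 → s'.reg r = s.reg r) ∧ t ≤ 9 := by
  simp only [joinLists, RAMProgram.block, Wp.seq_iff, Wp.load_iff, Wp.branch_iff, Wp.skip_iff,
    Wp.copy_iff, Wp.store_iff, RAMTest.Holds]
  simp only [RAMState.reg_setReg, RAMState.mem_setReg, RAMState.reg_setMem, RAMState.mem_setMem]
  refine ⟨fun h₁ => ⟨by simp, Or.inl ?_, ?_, by simp⟩, fun h₁ =>
    ⟨fun h₂ => ⟨by simp, Or.inr (Or.inl ?_), ?_, by simp⟩, fun h₂ =>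
      ⟨fun i hi => by simp [hi], Or.inr (Or.inr ?_), ?_, by simp⟩⟩⟩
  · simpa using h₁
  · grind
  · simp at h₁ h₂
    exact ⟨h₁, h₂, by simp⟩
  · grind
  · simp at h₁ h₂
    exact ⟨h₁, h₂, by simp⟩
  · grind

/-- Two joins realise one contraction. The intermediate root `d` depends on the ranks but leaves no
trace. -/
theorem joinRep_joinRep {rep : ℕ → ℕ} {st : MergeStep} {d : ℕ} (hd : d = st.u ∨ d = st.v) :
    IsSetForest.joinRep (IsSetForest.joinRep rep st.u st.v d) d st.w st.c =
      fun x => st.merge (rep x) := by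
  funext x
  simp only [IsSetForest.joinRep, MergeStep.merge]
  grind

theorem wp_recordContraction (h₁ : s.mem 11 (s.reg 23) + s.mem 11 (s.reg 19) +
    s.mem 11 (s.reg 22) < W) :
    Wp W recordContraction s fun s' t =>
      s'.mem 15 = Function.update (s.mem 15) (s.reg 17) (s.reg 21) ∧
      s'.mem 16 = Function.update (s.mem 16) (s.reg 17) (s.reg 20) ∧
      s'.mem 17 = Function.update (s.mem 17) (s.reg 17) (s.reg 19) ∧
      s'.mem 18 = Function.update (s.mem 18) (s.reg 17) (s.reg 23) ∧
      s'.mem 19 = Function.update (s.mem 19) (s.reg 17) (s.reg 22) ∧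
      s'.mem 20 = Function.update (s.mem 20) (s.reg 17) (s.mem 11 (s.reg 23)) ∧
      s'.mem 21 = Function.update (s.mem 21) (s.reg 17) (s.mem 11 (s.reg 19)) ∧
      (∀ i, i < 15 ∨ 21 < i → s'.mem i = s.mem i) ∧
      s'.reg 27 = s.mem 11 (s.reg 23) + s.mem 11 (s.reg 19) + s.mem 11 (s.reg 22) ∧
      s'.reg 28 = s.mem 7 (s.reg 23) ∧ (∀ r, r < 25 → s'.reg r = s.reg r) ∧ t ≤ 13 := by
  simp only [recordContraction, RAMProgram.block, Wp.seq_iff, Wp.load_iff, Wp.store_iff, Wp.add_iff]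
  simp only [RAMState.reg_setReg, RAMState.mem_setReg, RAMState.reg_setMem, RAMState.mem_setMem]
  norm_num
  refine ⟨by omega, h₁, fun i hi => ?_, fun r hr => ?_⟩
  · simp only [show i ≠ 15 by omega, show i ≠ 16 by omega, show i ≠ 17 by omega,
      show i ≠ 18 by omega, show i ≠ 19 by omega, show i ≠ 20 by omega, show i ≠ 21 by omega,
      if_false]
  · grind

theorem wp_joinClasses (a : ℕ) {p rk rep : ℕ → ℕ} {st : MergeStep} (h : IsSetForest n p rk rep)
    (hp : s.mem 4 = p) (hrk : s.mem 5 = rk) (h₃ : s.reg 3 = 1) (hW : n + 1 < W)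
    (hu : s.reg 19 = st.u) (hv : s.reg 23 = st.v) (hw : s.reg 22 = st.w)
    (hru : st.u < n ∧ rep st.u = st.u) (hrv : st.v < n ∧ rep st.v = st.v)
    (hrw : st.w < n ∧ rep st.w = st.w) (huv : st.u ≠ st.v) (hvw : st.v ≠ st.w)
    (hwu : st.w ≠ st.u) :
    Wp W joinClasses s fun s' t =>
      (s'.reg 12 = st.u ∨ s'.reg 12 = st.v ∨ s'.reg 12 = st.w) ∧
      IsSetForest n (s'.mem 4) (s'.mem 5)
        (fun x => { st with c := s'.reg 12 : MergeStep }.merge (rep x)) ∧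
      (∀ i, i ≠ 4 → i ≠ 5 → s'.mem i = s.mem i) ∧
      (∀ r, r < 10 ∨ 14 < r → s'.reg r = s.reg r) ∧
      forestPotential a n (s'.mem 4) (s'.mem 5) ≤ forestPotential a n p rk + 2 * a ∧ t ≤ 20 := by
  simp only [joinClasses, RAMProgram.block, Wp.seq_iff, Wp.copy_iff]
  refine (wp_joinRoots (W := W) (n := n) a h ?_ ?_ ?_ hW ?_ ?_ ?_ ?_ ?_).mono ?_
  · exact hp
  · exact hrk
  · simpa [RAMState.reg_setReg] using h₃
  · simpa [RAMState.reg_setReg, hu] using hru.1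
  · simpa [RAMState.reg_setReg, hv] using hrv.1
  · simpa [RAMState.reg_setReg, hu] using hru.2
  · simpa [RAMState.reg_setReg, hv] using hrv.2
  · simpa [RAMState.reg_setReg, hu, hv] using huv
  rintro s₁ t₁ ⟨p₁, rk₁, hc₁, hf₁, hm₁, hr₁, hΦ₁, ht₁⟩
  simp only [RAMState.reg_setReg, RAMState.mem_setReg] at hc₁ hf₁ hm₁ hr₁
  norm_num [hu, hv] at hc₁ hf₁
  have e22 := hr₁ 22 (by omega)
  have e3 := hr₁ 3 (by omega)
  norm_num [hw, h₃] at e22 e3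
  refine (wp_joinRoots (W := W) (n := n) (p := p₁) (rk := rk₁) a hf₁ ?_ ?_ ?_ hW ?_ ?_ ?_ ?_
    ?_).mono ?_
  · simp [RAMState.mem_setReg, hm₁]
  · simp [RAMState.mem_setReg, hm₁]
  · simpa [RAMState.reg_setReg] using e3
  · rcases hc₁ with hc | hc <;> simp [RAMState.reg_setReg, hc, hru.1, hrv.1]
  · simpa [RAMState.reg_setReg, e22] using hrw.1
  · rcases hc₁ with hc | hc <;>
      simp [RAMState.reg_setReg, hc, IsSetForest.joinRep, hru.2, hrv.2]
  · simp [RAMState.reg_setReg, e22, IsSetForest.joinRep, hrw.2, hwu, hvw.symm]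
  · rcases hc₁ with hc | hc <;> simp [RAMState.reg_setReg, hc, e22, hvw, hwu.symm]
  rintro s₂ t₂ ⟨p₂, rk₂, hc₂, hf₂, hm₂, hr₂, hΦ₂, ht₂⟩
  simp only [RAMState.reg_setReg, RAMState.mem_setReg] at hc₂ hf₂ hm₂ hr₂
  norm_num [e22] at hc₂ hf₂
  have hrep : IsSetForest.joinRep (IsSetForest.joinRep rep st.u st.v (s₁.reg 12)) (s₁.reg 12) st.w
      (s₂.reg 12) = fun x => { st with c := s₂.reg 12 : MergeStep }.merge (rep x) :=
    joinRep_joinRep (st := { st with c := s₂.reg 12 }) hc₁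
  rw [hrep] at hf₂
  refine ⟨by grind, ?_, fun i h₄ h₅ => ?_, fun r hr => ?_, ?_, by omega⟩
  · simpa [hm₂] using hf₂
  · simp [hm₂, hm₁, h₄, h₅]
  · rw [hr₂ r (by omega), if_neg (by omega), if_neg (by omega), hr₁ r (by omega),
      if_neg (by omega), if_neg (by omega)]
  · have h4 : s₂.mem 4 = p₂ := by simp [hm₂]
    have h5 : s₂.mem 5 = rk₂ := by simp [hm₂]
    rw [h4, h5]
    omega

theorem wp_storeClass (h₁ : s.reg 17 + s.reg 3 < W) :
    Wp W storeClass s fun s' t =>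
      s'.mem 22 = Function.update (s.mem 22) (s.reg 17) (s.reg 12) ∧
      s'.mem 7 = Function.update (s.mem 7) (s.reg 12) (s.reg 28) ∧
      s'.mem 8 = Function.update (s.mem 8) (s.reg 12) (s.reg 25) ∧
      s'.mem 10 = Function.update (s.mem 10) (s.reg 12) (s.reg 26) ∧
      s'.mem 11 = Function.update (s.mem 11) (s.reg 12) (s.reg 27) ∧
      s'.mem 12 = Function.update (s.mem 12) (s.reg 24) (s.reg 12) ∧
      s'.mem 14 = Function.update (s.mem 14) (s.reg 12) (s.reg 24) ∧
      s'.mem 3 = Function.update (s.mem 3) (s.reg 21) (s.reg 2) ∧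
      (∀ i, i ≠ 22 → i ≠ 7 → i ≠ 8 → i ≠ 10 → i ≠ 11 → i ≠ 12 → i ≠ 14 → i ≠ 3 →
        s'.mem i = s.mem i) ∧
      s'.reg 16 = s.reg 24 ∧ s'.reg 17 = s.reg 17 + s.reg 3 ∧
      (∀ r, r ≠ 16 → r ≠ 17 → s'.reg r = s.reg r) ∧ t ≤ 10 := by
  simp only [storeClass, RAMProgram.block, Wp.seq_iff, Wp.store_iff, Wp.add_iff, Wp.copy_iff]
  simp only [RAMState.reg_setReg, RAMState.mem_setReg, RAMState.reg_setMem, RAMState.mem_setMem]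
  norm_num
  refine ⟨h₁, fun i _ _ _ _ _ _ _ _ => ?_, fun r _ _ => ?_⟩
  · simp [*]
  · simp [*]

theorem wp_contractClasses {st : MergeStep} {B' : List ℕ}
    (hs : IsContractible n m tl hd M h B U s st B') (a : ℕ) (hW : n + 1 < W)
    (h19 : s.reg 19 = st.u) (h20 : s.reg 20 = st.f) (h21 : s.reg 21 = st.e)
    (h22 : s.reg 22 = st.w) (h23 : s.reg 23 = st.v) (h24 : s.reg 24 = s.reg 16 - 1)
    (hsv : st.sv = s.mem 11 st.v) (hsu : st.su = s.mem 11 st.u) :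
    Wp W contractClasses s fun s' t => (∃ h', SearchState n m tl hd M h' B' U s' ∧
        searchWeight n m h' U s' + 1 ≤ searchWeight n m h U s) ∧ s'.reg 18 = s.reg 18 ∧
      10 * forestPotential a n (s'.mem 4) (s'.mem 5) + t ≤
        10 * forestPotential a n (s.mem 4) (s.mem 5) + 20 * a + 60 := by
  have hsize := hs.size_lt
  have hk : h.length + 1 ≤ n := by
    have h₁ := hs.card_roots
    have h₂ : 0 < ((Finset.range n).filter fun x => mergedRep h x = x).card :=
      Finset.card_pos.2 ⟨st.u, by simp [hs.root_u]⟩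
    omega
  simp only [contractClasses, RAMProgram.block, Wp.seq_iff]
  refine (hs.toSearchState.wp_chooseTarget hs.pos ?_ h24).mono ?_
  · rw [h22, ← hs.hu]; exact hs.word.1
  rintro s₁ t₁ ⟨hm₁, htgt, ht, htw, hr₁, ht₁⟩
  rw [← hs.hv, h22] at ht
  rw [h22] at htw
  refine (wp_recordContraction ?_).mono ?_
  · rw [hm₁, hr₁ 23 (by omega), hr₁ 19 (by omega), hr₁ 22 (by omega), h19, h22, h23]
    omega
  rintro s₂ t₂ ⟨a15, a16, a17, a18, a19, a20, a21, hm₂, a27, a28, hr₂, ht₂⟩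
  simp only [hm₁, hr₁ 23 (by omega), hr₁ 19 (by omega), hr₁ 22 (by omega), hr₁ 17 (by omega),
    hr₁ 20 (by omega), hr₁ 21 (by omega), h19, h20, h21, h22, h23, hs.reg_steps]
    at a15 a16 a17 a18 a19 a20 a21 a27 a28 hm₂
  have b : ∀ r, r < 24 → s₂.reg r = s.reg r := fun r hr => by
    rw [hr₂ r (by omega), hr₁ r hr]
  refine wp_joinLists.mono ?_
  rintro s₃ t₃ ⟨hm₃, hlists, hr₃, ht₃⟩
  simp only [hm₂ 8 (by omega), hm₂ 9 (by omega), hm₂ 10 (by omega), b 22 (by omega),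
    b 23 (by omega), b 1 (by omega), h22, h23, hs.reg_edges] at hlists
  have d : ∀ r, r < 24 → s₃.reg r = s.reg r := fun r hr => by
    rw [hr₃ r (by omega), b r hr]
  have hforest := hs.forest
  rw [← hm₂ 4 (by omega), ← hm₂ 5 (by omega), ← hm₃ 4 (by omega), ← hm₃ 5 (by omega)] at hforest
  refine (wp_joinClasses a (st := st) hforest rfl rfl ?_ hW ?_ ?_ ?_ hs.root_u hs.root_v hs.root_w
    hs.huv hs.hvw hs.word.1).mono ?_
  · rw [d 3 (by omega), hs.reg_one]
  · rw [d 19 (by omega), h19]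
  · rw [d 23 (by omega), h23]
  · rw [d 22 (by omega), h22]
  rintro s₄ t₄ ⟨hc, hf₄, hm₄, hr₄, hΦ, ht₄⟩
  have f : ∀ r, (r < 10 ∨ 14 < r) → r < 24 → s₄.reg r = s.reg r := fun r h₁ h₂ => by
    rw [hr₄ r h₁, d r h₂]
  have g : ∀ r, r = 24 ∨ r = 25 ∨ r = 26 ∨ r = 27 ∨ r = 28 → s₄.reg r = s₃.reg r := fun r h₁ =>
    hr₄ r (by omega)
  have f24 : s₄.reg 24 = s₁.reg 24 := by
    rw [g 24 (by omega), hr₃ 24 (by omega), hr₂ 24 (by omega)]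
  refine (wp_storeClass ?_).mono ?_
  · rw [f 17 (by omega) (by omega), f 3 (by omega) (by omega), hs.reg_one, hs.reg_steps]
    omega
  rintro s₅ t₅ ⟨c22, c7, c8, c10, c11, c12, c14, c3, hm₅, c16, c17, hr₅, ht₅⟩
  rw [f24] at c16
  have k : ∀ i, i ≠ 4 → i ≠ 5 → i ≠ 9 → s₄.mem i = s₂.mem i := fun i h₁ h₂ h₃ => by
    rw [hm₄ i h₁ h₂, hm₃ i h₃]
  have k' : ∀ i, i ≠ 4 → i ≠ 5 → i ≠ 9 → i < 15 ∨ 21 < i → s₄.mem i = s.mem i :=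
    fun i h₁ h₂ h₃ h₄ => by rw [k i h₁ h₂ h₃, hm₂ i h₄]
  have k'' : ∀ i, 15 ≤ i → i ≤ 21 → s₅.mem i = s₂.mem i := fun i h₁ h₂ => by
    rw [hm₅ i (by omega) (by omega) (by omega) (by omega) (by omega) (by omega) (by omega)
      (by omega), k i (by omega) (by omega) (by omega)]
  rw [g 25 (by omega)] at c8
  rw [g 26 (by omega)] at c10
  rw [g 27 (by omega), hr₃ 27 (by omega), a27, k' 11 (by omega) (by omega) (by omega) (by omega)]
    at c11
  rw [g 28 (by omega), hr₃ 28 (by omega), a28, k' 7 (by omega) (by omega) (by omega) (by omega)]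
    at c7
  rw [k' 8 (by omega) (by omega) (by omega) (by omega)] at c8
  rw [k' 10 (by omega) (by omega) (by omega) (by omega)] at c10
  rw [f24, k' 12 (by omega) (by omega) (by omega) (by omega)] at c12
  rw [f24, k' 14 (by omega) (by omega) (by omega) (by omega)] at c14
  rw [f 21 (by omega) (by omega), f 2 (by omega) (by omega), hs.reg_zero, h21,
    k' 3 (by omega) (by omega) (by omega) (by omega)] at c3
  rw [f 17 (by omega) (by omega), hs.reg_steps] at c17 c22
  rw [f 3 (by omega) (by omega), hs.reg_one] at c17
  rw [k' 22 (by omega) (by omega) (by omega) (by omega)] at c22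
  have m4 : s₅.mem 4 = s₄.mem 4 := hm₅ 4 (by omega) (by omega) (by omega) (by omega) (by omega)
    (by omega) (by omega) (by omega)
  have m5 : s₅.mem 5 = s₄.mem 5 := hm₅ 5 (by omega) (by omega) (by omega) (by omega) (by omega)
    (by omega) (by omega) (by omega)
  have m9 : s₅.mem 9 = s₃.mem 9 := by
    rw [hm₅ 9 (by omega) (by omega) (by omega) (by omega) (by omega) (by omega) (by omega)
      (by omega), hm₄ 9 (by omega) (by omega)]
  rw [← m9] at hlists
  rw [hm₃ 4 (by omega), hm₃ 5 (by omega), hm₂ 4 (by omega), hm₂ 5 (by omega)] at hΦ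
  refine ⟨⟨{ st with c := s₄.reg 12 } :: h, ?_⟩, ?_, by rw [m4, m5]; omega⟩
  · have hs' : IsContractible n m tl hd M h B U s { st with c := s₄.reg 12 } B' := by
      exact { hs with }
    refine hs'.searchState hsv hsu hc htgt ht htw hlists ?_ ?_ c16 c17 ?_ c3 c7 c8 c10 c11 c12 c14
      ?_ ?_ ?_ ?_ ?_ ?_ ?_ c22
    · rw [m4, m5]; exact hf₄
    · intro r hr; rw [hr₅ r (by omega) (by omega), f r (by omega) (by omega)]
    · intro i hi
      rw [hm₅ i (by omega) (by omega) (by omega) (by omega) (by omega) (by omega) (by omega)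
        (by omega), k' i (by omega) (by omega) (by omega) (by omega)]
    · rw [k'' 15 (by omega) (by omega), a15]
    · rw [k'' 16 (by omega) (by omega), a16]
    · rw [k'' 17 (by omega) (by omega), a17]
    · rw [k'' 18 (by omega) (by omega), a18]
    · rw [k'' 19 (by omega) (by omega), a19]
    · rw [k'' 20 (by omega) (by omega), a20, hsv]
    · rw [k'' 21 (by omega) (by omega), a21, hsu]
  · rw [hr₅ 18 (by omega) (by omega), f 18 (by omega) (by omega)]

end SearchState

/-! ### A step of the search, and the whole search -/

namespace SearchState

variable {W n m a : ℕ} {tl hd : ℕ → ℕ} {M : List ℕ} {h : List MergeStep} {B : List ℕ}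
  {U : Finset ℕ} {s s' : RAMState}

/-- The search has found antiparallel edges between the classes in the registers `19` and `22`: the
edge in register `21` of the matching, and the edge in register `20`. -/
structure IsFound (n m : ℕ) (tl hd : ℕ → ℕ) (M : List ℕ) (h : List MergeStep) (B : List ℕ)
    (U : Finset ℕ) (s : RAMState) : Prop extends SearchState n m tl hd M h B U s where
  mem_B : s.reg 21 ∈ B
  live : s.reg 20 ∈ liveEdges U (s.mem 13) (s.reg 16)
  tail_e : mergedRep h (tl (s.reg 21)) = s.reg 22
  head_e : mergedRep h (hd (s.reg 21)) = s.reg 19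
  tail_f : mergedRep h (tl (s.reg 20)) = s.reg 19
  head_f : mergedRep h (hd (s.reg 20)) = s.reg 22

/-- What a step of the search achieves. -/
def HasAdvanced (n m : ℕ) (tl hd : ℕ → ℕ) (M : List ℕ) (h : List MergeStep)
    (U : Finset ℕ) (s s' : RAMState) : Prop :=
  (∃ h' B' U', SearchState n m tl hd M h' B' U' s' ∧
      searchWeight n m h' U' s' + 1 ≤ searchWeight n m h U s ∧ s'.reg 18 = s.reg 18) ∨
    ∃ h' B' U', IsFound n m tl hd M h' B' U' s' ∧ s'.reg 18 = 1

/-- The topmost class is left by the stack edge to the class below and entered by a matching edge.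
Either the latter comes from that same class and the search has succeeded, or the three classes are
distinct and can be contracted. -/
theorem wp_closeClass (hG : IsMatchedDigraph n m tl hd M) (hs : SearchState n m tl hd M h B U s)
    (ha : n < ackermannLevel a 1) (hW : n + 1 < W) (h19 : s.reg 19 = s.mem 12 (s.reg 16))
    (h8 : s.mem 8 (s.reg 19) = m) (hpos : 0 < s.reg 16) :
    Wp W closeClass s fun s' t => HasAdvanced n m tl hd M h U s s' ∧
      10 * forestPotential a n (s'.mem 4) (s'.mem 5) + t ≤
        10 * forestPotential a n (s.mem 4) (s.mem 5) + 30 * a + 100 := by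
  have hx := hs.stack.lt _ le_rfl
  have hrx := hs.stack.root _ le_rfl
  rw [← h19] at hx hrx
  have hhead := (hs.lists.first_eq_iff hx hrx).1 h8
  obtain ⟨e, he, hex, hnt⟩ := hs.exists_matching_edge hG (by rw [← h19]; exact hhead)
  rw [← h19] at hex
  have hmate := hs.mate_base he
  have hem := hG.edge_lt e (hs.contraction.subset e he)
  rw [hex] at hmate
  simp only [closeClass, RAMProgram.block, Wp.seq_iff, Wp.load_iff, Wp.copy_iff, Wp.sub_iff,
    Wp.branch_iff, Wp.const_iff, RAMTest.Holds]
  have hs₁ := hs.congr (s' := (((s.setReg 20 (s.mem 13 (s.reg 16))).setReg 25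
    (s.mem 7 (s.reg 19))).setReg 21 e).setReg 4 (tl e)) rfl
    (by intro r hr; simp only [RAMState.reg_setReg]; grind)
  simp only [RAMState.reg_setReg, RAMState.mem_setReg]
  norm_num [hmate, hs.tails]
  refine (hs₁.wp_findRoot ha ?_).mono ?_
  · simpa [RAMState.reg_setReg] using hG.tail_lt e hem
  rintro s₂ t₂ ⟨hs₂, h5, hm, hf, ht⟩
  simp only [RAMState.mem_setReg, RAMState.reg_setReg] at hm ht h5 hf
  have f3 := hf 3 (by omega)
  have f16 := hf 16 (by omega)
  have f18 := hf 18 (by omega)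
  have f19 := hf 19 (by omega)
  have f20 := hf 20 (by omega)
  have f21 := hf 21 (by omega)
  norm_num [hs.reg_one] at f3 f16 f18 f19 f20 f21 h5
  have hs₃ := hs₂.congr (s' := ((s₂.setReg 22 (mergedRep h (tl e))).setReg 24
    (s.reg 16 - 1)).setReg 23 (s.mem 12 (s.reg 16 - 1))) rfl
    (by intro r hr; simp only [RAMState.reg_setReg]; grind)
  have hstack := hs₂.stack
  rw [f16, hm 12 (by omega), hm 13 (by omega)] at hstack
  have htf := hstack.tail_eq (s.reg 16 - 1) (by omega)
  have hhf := hstack.head_eq (s.reg 16 - 1) (by omega)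
  rw [Nat.sub_add_cancel hpos, ← h19] at htf
  rw [Nat.sub_add_cancel hpos] at hhf
  simp only [h5, f3, f16, hm 12 (by omega)]
  refine ⟨fun heq => ⟨by omega, Or.inr ⟨h, B, U, ⟨?_, ?_, ?_, ?_, ?_, ?_, ?_⟩, ?_⟩, ?_⟩,
    fun hne => ?_⟩
  · exact hs₃.congr rfl (by intro r hr; simp only [RAMState.reg_setReg]; grind)
  · simpa [RAMState.reg_setReg, f21] using he
  · refine Or.inr ⟨s.reg 16 - 1, ?_, ?_⟩
    · simp [RAMState.reg_setReg, f16]; omega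
    · simp [RAMState.reg_setReg, RAMState.mem_setReg, f20, hm 13, Nat.sub_add_cancel hpos]
  · simp [RAMState.reg_setReg, f21]
  · simp [RAMState.reg_setReg, f21, f19, hex]
  · simp [RAMState.reg_setReg, f20, f19, htf]
  · simp [RAMState.reg_setReg, f20, hhf, heq]
  · simp [RAMState.reg_setReg]
  · have := hm 5 (by omega)
    omega
  · let st : MergeStep := ⟨e, s.mem 13 (s.reg 16), s.reg 19, s.mem 12 (s.reg 16 - 1),
      mergedRep h (tl e), s.reg 19, s.mem 11 (s.mem 12 (s.reg 16 - 1)), s.mem 11 (s.reg 19)⟩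
    have hc : IsContractible n m tl hd M h B U (((s₂.setReg 22 (mergedRep h (tl e))).setReg 24
        (s.reg 16 - 1)).setReg 23 (s.mem 12 (s.reg 16 - 1))) st (B.erase e) :=
      { hs₃ with
        digraph := hG
        pos := by simpa [RAMState.reg_setReg, f16] using hpos
        hu := by simp [RAMState.reg_setReg, RAMState.mem_setReg, f16, hm 12, st, h19]
        hv := by simp [RAMState.reg_setReg, RAMState.mem_setReg, f16, hm 12, st]
        hf := by simp [RAMState.reg_setReg, RAMState.mem_setReg, f16, hm 13, st]
        hB := List.perm_cons_erase he
        tail_e := rfl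
        head_e := hex
        hvw := fun he => hne he.symm
        not_head := hhead
        not_tail := by
          have := hnt hpos
          rwa [← h19] at this }
    refine (wp_contractClasses hc a hW ?_ ?_ ?_ ?_ ?_ ?_ ?_ ?_).mono ?_
    · simp [RAMState.reg_setReg, f19, st]
    · simp [RAMState.reg_setReg, f20, st]
    · simp [RAMState.reg_setReg, f21, st]
    · simp [RAMState.reg_setReg, st]
    · simp [RAMState.reg_setReg, st]
    · simp [RAMState.reg_setReg, f16]
    · simp [RAMState.mem_setReg, hm 11, st]
    · simp [RAMState.mem_setReg, hm 11, st]
    rintro s₄ t₄ ⟨⟨h', hs₄, hw⟩, h18, hΦ⟩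
    simp only [RAMState.mem_setReg] at hΦ
    have := hm 5 (by omega)
    refine ⟨Or.inl ⟨h', _, U, hs₄, hw.trans ?_, ?_⟩, by omega⟩
    · simp only [searchWeight, RAMState.mem_setReg, RAMState.reg_setReg]
      norm_num [f16, hm 8, hm 12]
    · rw [h18]; simp [RAMState.reg_setReg, f18]

theorem wp_searchStep (hG : IsMatchedDigraph n m tl hd M) (hs : SearchState n m tl hd M h B U s)
    (ha : n < ackermannLevel a 1) (hW : n + 1 < W) :
    Wp W searchStep s fun s' t => HasAdvanced n m tl hd M h U s s' ∧
      10 * forestPotential a n (s'.mem 4) (s'.mem 5) + t ≤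
        10 * forestPotential a n (s.mem 4) (s.mem 5) + 30 * a + 110 := by
  simp only [searchStep, RAMProgram.block, Wp.seq_iff, Wp.load_iff, Wp.branch_iff, RAMTest.Holds]
  have hs₁ := hs.congr (s' := (s.setReg 19 (s.mem 12 (s.reg 16))).setReg 20
    (s.mem 8 (s.mem 12 (s.reg 16)))) rfl
    (by intro r hr; simp only [RAMState.reg_setReg]; grind)
  simp only [RAMState.reg_setReg, RAMState.mem_setReg]
  norm_num [hs.reg_edges, hs.reg_zero]
  have hw : searchWeight n m h U ((s.setReg 19 (s.mem 12 (s.reg 16))).setReg 20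
      (s.mem 8 (s.mem 12 (s.reg 16)))) = searchWeight n m h U s := by
    simp [searchWeight, RAMState.mem_setReg, RAMState.reg_setReg]
  refine ⟨fun h8 => ⟨fun h16 => ?_, fun h16 => ?_⟩, fun h8 => ?_⟩
  · refine (hs₁.wp_restartSearch hG ha ?_ ?_ ?_).mono ?_
    · simp [RAMState.reg_setReg, RAMState.mem_setReg]
    · simpa [RAMState.reg_setReg, RAMState.mem_setReg] using h8
    · simpa [RAMState.reg_setReg] using h16
    rintro s' t ⟨hs', h18, hw', ht⟩
    simp only [RAMState.mem_setReg] at ht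
    refine ⟨Or.inl ⟨h, B, U, hs', by omega, by rw [h18]; simp [RAMState.reg_setReg]⟩, by omega⟩
  · refine (hs₁.wp_closeClass hG ha hW ?_ ?_ ?_).mono ?_
    · simp [RAMState.reg_setReg, RAMState.mem_setReg]
    · simpa [RAMState.reg_setReg, RAMState.mem_setReg] using h8
    · simpa [RAMState.reg_setReg] using Nat.pos_of_ne_zero h16
    rintro s' t ⟨hs', ht⟩
    simp only [RAMState.mem_setReg] at ht
    refine ⟨?_, by omega⟩
    simpa [HasAdvanced, hw, RAMState.reg_setReg] using hs'
  · refine (hs₁.wp_scanEdge hG ha (by omega) ?_ ?_ ?_).mono ?_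
    · simp [RAMState.reg_setReg, RAMState.mem_setReg]
    · simp [RAMState.reg_setReg, RAMState.mem_setReg]
    · simpa [RAMState.reg_setReg, RAMState.mem_setReg] using h8
    rintro s' t ⟨⟨U', hs', hw'⟩, h18, ht⟩
    simp only [RAMState.mem_setReg] at ht
    refine ⟨Or.inl ⟨h, B, U', hs', by omega, by rw [h18]; simp [RAMState.reg_setReg]⟩, by omega⟩

/-- The budget is ten times the forest potential plus a fixed price per unit of `searchWeight`.
Scanning releases two units, a contraction six, and either may cost one unit for an exhausted single
class, which a restart gives back. As every state with register `18` equal to zero admits a further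
step, the loop can only end with success. -/
theorem wp_searchLoop (hG : IsMatchedDigraph n m tl hd M) (hs : SearchState n m tl hd M h B U s)
    (ha : n < ackermannLevel a 1) (hW : n + 1 < W) (h18 : s.reg 18 = 0) :
    Wp W searchLoop s fun s' t => (∃ h' B' U', IsFound n m tl hd M h' B' U' s') ∧
      t ≤ 10 * forestPotential a n (s.mem 4) (s.mem 5) +
        (30 * a + 120) * (searchWeight n m h U s + 1) + 1 := by
  refine (Wp.loop (I := fun p s => (∃ h B U, SearchState n m tl hd M h B U s ∧ s.reg 18 = 0 ∧
      p = 10 * forestPotential a n (s.mem 4) (s.mem 5) +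
        (30 * a + 120) * (searchWeight n m h U s + 1)) ∨
      ∃ h B U, IsFound n m tl hd M h B U s ∧ s.reg 18 = 1) ?_ (Or.inl ⟨h, B, U, hs, h18, rfl⟩)).mono
      ?_
  · rintro p s (⟨h, B, U, hs, h18, hp⟩ | ⟨h, B, U, hs, h18⟩) hb
    · refine (hs.wp_searchStep hG ha hW).mono ?_
      rintro s' t ⟨⟨h', B', U', hs', hw, h18'⟩ | ⟨h', B', U', hs', h18'⟩, ht⟩
      · refine ⟨_, Or.inl ⟨h', B', U', hs', by rw [h18', h18], rfl⟩, ?_⟩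
        have := Nat.mul_le_mul_left (30 * a + 120) hw
        rw [mul_add, mul_one] at this ⊢
        rw [mul_add, mul_one] at hp
        omega
      · refine ⟨0, Or.inr ⟨h', B', U', hs', h18'⟩, ?_⟩
        rw [mul_add, mul_one] at hp
        omega
    · simp only [RAMTest.Holds, h18, hs.reg_zero] at hb
      omega
  · rintro s' t ⟨p', ⟨h', B', U', hs', h18', -⟩ | ⟨h', B', U', hs', h18'⟩, hb, ht⟩
    · exact absurd (by simp [RAMTest.Holds, h18', hs'.reg_zero]) hb
    · exact ⟨⟨h', B', U', hs'⟩, by omega⟩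

end SearchState

/-! ### Undoing the contractions -/

/-- Set array `23` to zero on all nodes. -/
def clearPositions : RAMProgram :=
  .block [.copy 23 0, .loop (.lt 2 23) (.block [.sub 23 23 3, .store 23 23 2])]

/-- Refine the positions in array `23` from the class of a contraction to the classes that it was
made of, and put the threshold into array `24`. -/
def splitClass : RAMProgram :=
  .block
    [.sub 23 23 3, .load 24 22 23, .load 25 23 24, .load 26 18 23, .store 23 26 25, .load 26 20 23,
      .add 25 25 26, .load 26 17 23, .store 23 26 25, .load 26 21 23, .add 25 25 26,
      .load 26 19 23, .store 23 26 25, .store 24 23 25]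

/-- Undo a contraction, adding one of its two edges to the matching. -/
def expandClass : RAMProgram :=
  .block
    [.sub 23 23 3, .load 24 22 23, .load 25 7 24, .load 26 23 25, .load 27 24 23, .load 19 17 23,
      .load 28 18 23, .load 22 19 23, .load 21 15 23, .load 20 16 23,
      .branch (.lt 26 27)
        (.block [.store 7 28 25, .load 29 0 21, .store 7 22 29, .load 29 1 21, .store 7 19 29,
          .store 3 21 3])
        (.block [.store 7 22 25, .load 29 0 20, .store 7 19 29, .load 29 1 20, .store 7 28 29,
          .store 3 20 3])]

/-- Replace the matching edge in register `21` by the edge in register `20`. -/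
def exchangeEdges : RAMProgram :=
  .block
    [.load 25 0 20, .store 7 19 25, .load 25 1 20, .store 7 22 25, .store 3 21 2, .store 3 20 3]

/-- Find the second matching after a successful search. -/
def recoverMatching : RAMProgram :=
  .block
    [exchangeEdges, clearPositions, .copy 23 17, .loop (.lt 2 23) splitClass, .copy 23 17,
      .loop (.lt 2 23) expandClass]

theorem wp_clearPositions {W n : ℕ} {s : RAMState} (h₀ : s.reg 0 = n) (h₂ : s.reg 2 = 0)
    (h₃ : s.reg 3 = 1) :
    Wp W clearPositions s fun s' t => (∀ x < n, s'.mem 23 x = 0) ∧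
      (∀ i, i ≠ 23 → s'.mem i = s.mem i) ∧ (∀ r, r ≠ 23 → s'.reg r = s.reg r) ∧
      t ≤ 3 * n + 2 := by
  simp only [clearPositions, RAMProgram.block, Wp.seq_iff, Wp.copy_iff]
  refine (Wp.loop (I := fun p s' => p = 3 * s'.reg 23 ∧
    (∀ x < n, s'.reg 23 ≤ x → s'.mem 23 x = 0) ∧ (∀ i, i ≠ 23 → s'.mem i = s.mem i) ∧
    (∀ r, r ≠ 23 → s'.reg r = s.reg r)) ?_ (p := 3 * n) ?_).mono ?_
  · rintro p s' ⟨hp, hz, hm, hr⟩ hb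
    simp only [RAMTest.Holds, hr 2 (by omega), h₂] at hb
    simp only [Wp.seq_iff, Wp.sub_iff, Wp.store_iff, RAMState.reg_setReg, RAMState.mem_setReg,
      RAMState.reg_setMem, RAMState.mem_setMem]
    norm_num [hr 2, hr 3, h₂, h₃]
    refine ⟨3 * (s'.reg 23 - 1), ⟨rfl, fun x hx hxx => ?_, fun i hi => ?_, fun r hr' => ?_⟩,
      by omega⟩
    · rw [Function.update_apply]
      split_ifs
      · rfl
      · exact hz x hx (by omega)
    · rw [if_neg hi, hm i hi]
    · rw [if_neg hr', hr r hr']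
  · simp only [RAMState.reg_setReg, RAMState.mem_setReg]
    norm_num [h₀]
    exact ⟨fun x hx hx' => by omega, fun r hr h => absurd h hr⟩
  · rintro s' t ⟨p', ⟨hp, hz, hm, hr⟩, hb, ht⟩
    simp only [RAMTest.Holds, hr 2 (by omega), h₂] at hb
    exact ⟨fun x hx => hz x hx (by omega), hm, hr, by omega⟩

theorem classSize_le (n : ℕ) (rep : ℕ → ℕ) (r : ℕ) : classSize n rep r ≤ n :=
  (Finset.card_filter_le _ _).trans (by simp)

/-- When all classes are single nodes, the lower end of a class is the position of its node. So one
array can pass from lower ends to positions in place. -/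
theorem isNested_id (n : ℕ) (lo : ℕ → ℕ) : IsNested n id lo lo := by
  intro x hx
  have : 0 < classSize n id (id x) := Finset.card_pos.2 ⟨x, by simp [hx]⟩
  exact ⟨le_rfl, by simp at *; omega⟩

namespace MergeStep.IsValid

variable {n : ℕ} {tl hd : ℕ → ℕ} {M : List ℕ} {h : List MergeStep} {B B' : List ℕ}
  {live live' : Set ℕ} {st : MergeStep}

theorem hwu (hst : st.IsValid n tl hd h B B' live live') (hc : IsContraction n tl hd M h B live)
    (hM : (edgeEnds tl hd M).Nodup) (hM' : ∀ x < n, x ∈ edgeEnds tl hd M) : st.w ≠ st.u := by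
  have hn := (hc.word hM hM').1
  have hp := ((permSign_edgeEnds (tl := tl) (hd := hd) hst.hB).map (mergedRep h)).perm
  rw [edgeEnds_cons, List.map_cons, List.map_cons, hst.htl_e, hst.hhd_e] at hp
  have := hp.nodup_iff.1 hn
  simp only [List.nodup_cons, List.mem_cons, not_or] at this
  exact this.1.1

theorem mergedRep_v (hst : st.IsValid n tl hd h B B' live live') :
    mergedRep (st :: h) st.v = st.c := by
  simp [mergedRep, MergeStep.merge, hst.hv.2]

end MergeStep.IsValid

/-- The most recent contraction is the head of `h` and is split first, so the roots recorded for it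
are exactly those needed for the next one. The bound `hlo` is inherited by the parts and keeps all
positions inside a word. -/
theorem wp_splitClasses {W n : ℕ} {tl hd : ℕ → ℕ} {M : List ℕ}
    (hM : (edgeEnds tl hd M).Nodup) (hM' : ∀ x < n, x ∈ edgeEnds tl hd M) (hW : n < W)
    {h : List MergeStep} {B : List ℕ} {live : Set ℕ} (hc : IsContraction n tl hd M h B live)
    {s : RAMState} (h₂ : s.reg 2 = 0) (h₃ : s.reg 3 = 1) (h23 : s.reg 23 = h.length)
    (hr : IsRecorded s.mem h)
    (hlo : ∀ x < n, s.mem 23 (mergedRep h x) + classSize n (mergedRep h) (mergedRep h x) ≤ n) :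
    Wp W (.loop (.lt 2 23) splitClass) s fun s' t =>
      IsNested n (mergedRep h) (s.mem 23) (s'.mem 23) ∧
      AreThresholds n (s'.mem 23) (s'.mem 24) h ∧
      (∀ i, h.length ≤ i → s'.mem 24 i = s.mem 24 i) ∧
      (∀ i, i ≠ 23 → i ≠ 24 → s'.mem i = s.mem i) ∧
      (∀ r, r < 23 → s'.reg r = s.reg r) ∧ t ≤ 15 * h.length + 1 := by
  induction hc generalizing s with
  | start live =>
    apply Wp.loop_of_not
    · simp [RAMTest.Holds, h₂, h23]
    · exact ⟨isNested_id n _, trivial, fun _ _ => rfl, fun _ _ _ => rfl, fun _ _ => rfl, by simp⟩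
  | @step h B B' live live' st hh hst ih =>
    have hwu := hst.hwu hh hM hM'
    obtain ⟨⟨r15, r16, r17, r18, r19, r20, r21, r22⟩, hr'⟩ := hr
    have hsize := classSize_merge (n := n) (rep := mergedRep h) hst.huv hst.hvw hwu hst.hc
    have hlc := hlo st.v hst.hv.1
    rw [hst.mergedRep_v] at hlc
    have hcs : classSize n (mergedRep (st :: h)) st.c = _ := (hsize 0).2
    rw [hcs, ← hst.hsv, ← hst.hsu] at hlc
    apply Wp.loop_of_holds
    · simp [RAMTest.Holds, h₂, h23]
    simp only [splitClass, RAMProgram.block, Wp.seq_iff, Wp.load_iff, Wp.sub_iff, Wp.store_iff,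
      Wp.add_iff]
    simp only [RAMState.reg_setReg, RAMState.mem_setReg, RAMState.reg_setMem, RAMState.mem_setMem]
    norm_num [h23, h₃, r17, r18, r19, r20, r21, r22]
    refine ⟨by omega, by omega, ?_⟩
    have hm23 : Function.update (Function.update (Function.update (s.mem 23) st.v
        (s.mem 23 st.c)) st.u (s.mem 23 st.c + st.sv)) st.w (s.mem 23 st.c + st.sv + st.su) =
      st.splitPositions (s.mem 23) := rfl
    refine (ih ?_ ?_ ?_ ?_ ?_).mono ?_
    · simpa [RAMState.reg_setReg, RAMState.reg_setMem] using h₂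
    · simpa [RAMState.reg_setReg, RAMState.reg_setMem] using h₃
    · simp [RAMState.reg_setReg, RAMState.reg_setMem]
    · refine hr'.congr fun b hb hb' i _ => ?_
      simp only [RAMState.mem_setReg, RAMState.mem_setMem]
      rw [if_neg (by omega), if_neg (by omega), if_neg (by omega), if_neg (by omega)]
    · intro x hx
      simp only [RAMState.mem_setReg, RAMState.mem_setMem]
      norm_num [hm23]
      have h₁ := hlo x hx
      simp only [mergedRep] at h₁
      by_cases hxc : mergedRep h x = st.u ∨ mergedRep h x = st.v ∨ mergedRep h x = st.w
      · have := hst.hsv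
        have := hst.hsu
        have := hst.huv
        have := hst.hvw
        simp only [MergeStep.splitPositions, Function.update_apply]
        rcases hxc with he | he | he <;> rw [he] <;> split_ifs <;> grind
      · have hm : st.merge (mergedRep h x) = mergedRep h x := by simp [MergeStep.merge, hxc]
        push Not at hxc
        have hxc' : mergedRep h x ≠ st.c := by have := hst.hc; grind
        rw [hm, (hsize _).1 hxc' hxc.1 hxc.2.1 hxc.2.2] at h₁
        simpa [MergeStep.splitPositions, Function.update_apply, hxc] using h₁
    rintro s' t ⟨hn, hthr, h24, hm, hr, ht⟩
    simp only [RAMState.mem_setReg, RAMState.mem_setMem, RAMState.reg_setReg,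
      RAMState.reg_setMem] at hn h24 hm hr
    norm_num [hm23] at hn h24
    obtain ⟨hn', ht'⟩ := hn.of_split hst.huv hst.hvw hwu hst.hc hst.hsv hst.hsu
    refine ⟨hn', ⟨?_, hthr⟩, fun i hi => ?_, fun i hi hi' => ?_, fun r hr' => ?_, ?_⟩
    · rw [h24 _ le_rfl, Function.update_self]
      exact ht'
    · rw [h24 i (by omega), Function.update_of_ne (by omega)]
    · rw [hm i hi hi']; simp [hi, hi']
    · rw [hr r hr']; grind
    · omega

/-- Array `7` plays the role of `ex` throughout. Besides it only the records, the positions and the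
thresholds are consulted, so the forest is not needed here. -/
theorem wp_expandClasses {W n : ℕ} {tl hd : ℕ → ℕ} {M : List ℕ} (htl : ∀ g, tl g < n)
    (hhd : ∀ g, hd g < n) (hM : (edgeEnds tl hd M).Nodup) (hM' : ∀ x < n, x ∈ edgeEnds tl hd M)
    {h : List MergeStep} {B A : List ℕ} {live : Set ℕ} (hc : IsContraction n tl hd M h B live)
    {s : RAMState} (h₂ : s.reg 2 = 0) (h₃ : s.reg 3 = 1) (h23 : s.reg 23 = h.length)
    (hr : IsRecorded s.mem h) (h0 : s.mem 0 = tl) (h1 : s.mem 1 = hd)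
    (hA : IsOppositeMatching tl hd (mergedRep h) B live A (s.mem 7))
    (hthr : AreThresholds n (s.mem 23) (s.mem 24) h)
    (hout : ∀ g, s.mem 3 g = if g ∈ A then 1 else 0) :
    Wp W (.loop (.lt 2 23) expandClass) s fun s' t => ∃ A',
      PermSign true (edgeEnds tl hd M) (edgeEnds tl hd A') ∧
      (∀ g, s'.mem 3 g = if g ∈ A' then 1 else 0) ∧ t ≤ 18 * h.length + 1 := by
  induction hc generalizing s A with
  | start live =>
    apply Wp.loop_of_not
    · simp [RAMTest.Holds, h₂, h23]
    · refine ⟨A, ?_, hout, by simp⟩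
      have := hA.sign
      simpa [mergedRep] using this
  | @step h B B' live live' st hh hst ih =>
    have hwu := hst.hwu hh hM hM'
    obtain ⟨⟨r15, r16, r17, r18, r19, r20, r21, r22⟩, hr'⟩ := hr
    obtain ⟨hz, hzvw, hv, hw⟩ := hA.undo hM hM' hh hst
    obtain ⟨ht, hthr'⟩ := hthr
    have hzn : s.mem 7 st.c < n := by
      obtain ⟨g, -, hg | hg⟩ := mem_edgeEnds.1 hz
      exacts [hg ▸ htl g, hg ▸ hhd g]
    -- The covered node is in `v` or in `w`, so one comparison with the threshold decides between
    -- them.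
    have hside : s.mem 23 (s.mem 7 st.c) < s.mem 24 h.length ↔
        mergedRep h (s.mem 7 st.c) = st.v := by
      have := ht _ hzn
      refine ⟨fun hlt => hzvw.resolve_right fun he => ?_, this.1⟩
      have := this.2 he
      omega
    apply Wp.loop_of_holds
    · simp [RAMTest.Holds, h₂, h23]
    simp only [expandClass, RAMProgram.block, Wp.seq_iff, Wp.load_iff, Wp.sub_iff, Wp.store_iff,
      Wp.branch_iff, RAMTest.Holds]
    simp only [RAMState.reg_setReg, RAMState.mem_setReg, RAMState.reg_setMem, RAMState.mem_setMem]
    norm_num [h23, h₃, r15, r16, r17, r18, r19, r22, h0, h1]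
    refine ⟨fun hlt => ?_, fun hge => ?_⟩
    · have hA' := hv (hside.1 hlt)
      refine (ih (A := st.e :: A) ?_ ?_ ?_ ?_ ?_ ?_ ?_ ?_ ?_).mono ?_
      · simpa [RAMState.reg_setReg, RAMState.reg_setMem] using h₂
      · simpa [RAMState.reg_setReg, RAMState.reg_setMem] using h₃
      · simp [RAMState.reg_setReg, RAMState.reg_setMem]
      · refine hr'.congr fun b hb hb' i _ => ?_
        simp only [RAMState.mem_setReg, RAMState.mem_setMem]
        rw [if_neg (by omega), if_neg (by omega), if_neg (by omega), if_neg (by omega)]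
      · simp [RAMState.mem_setReg, RAMState.mem_setMem, h0]
      · simp [RAMState.mem_setReg, RAMState.mem_setMem, h1]
      · simpa [RAMState.mem_setReg, RAMState.mem_setMem] using hA'
      · simpa [RAMState.mem_setReg, RAMState.mem_setMem] using hthr'
      · intro g
        simp only [RAMState.mem_setReg, RAMState.mem_setMem]
        norm_num [Function.update_apply, hout]
        grind
      · rintro s' t ⟨A', h₁, h₂, h₃⟩
        exact ⟨A', h₁, h₂, by omega⟩
    · have hA' := hw (hzvw.resolve_left fun he => absurd (hside.2 he) (by omega))
      refine (ih (A := st.f :: A) ?_ ?_ ?_ ?_ ?_ ?_ ?_ ?_ ?_).mono ?_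
      · simpa [RAMState.reg_setReg, RAMState.reg_setMem] using h₂
      · simpa [RAMState.reg_setReg, RAMState.reg_setMem] using h₃
      · simp [RAMState.reg_setReg, RAMState.reg_setMem]
      · refine hr'.congr fun b hb hb' i _ => ?_
        simp only [RAMState.mem_setReg, RAMState.mem_setMem]
        rw [if_neg (by omega), if_neg (by omega), if_neg (by omega), if_neg (by omega)]
      · simp [RAMState.mem_setReg, RAMState.mem_setMem, h0]
      · simp [RAMState.mem_setReg, RAMState.mem_setMem, h1]
      · simpa [RAMState.mem_setReg, RAMState.mem_setMem] using hA'
      · simpa [RAMState.mem_setReg, RAMState.mem_setMem] using hthr'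
      · intro g
        simp only [RAMState.mem_setReg, RAMState.mem_setMem]
        norm_num [Function.update_apply, hout]
        grind
      · rintro s' t ⟨A', h₁, h₂, h₃⟩
        exact ⟨A', h₁, h₂, by omega⟩

/-! ### Recovering the second matching -/

namespace SearchState

/-- Exchanging the antiparallel edges gives a matching of opposite sign. -/
theorem IsFound.isOppositeMatching {n m : ℕ} {tl hd : ℕ → ℕ} {M : List ℕ} {h : List MergeStep}
    {B : List ℕ} {U : Finset ℕ} {s : RAMState} (hG : IsMatchedDigraph n m tl hd M)
    (hs : IsFound n m tl hd M h B U s) :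
    ∃ B', B.Perm (s.reg 21 :: B') ∧ s.reg 21 ≠ s.reg 20 ∧ s.reg 21 ∉ B' ∧
      IsOppositeMatching tl hd (mergedRep h) B (liveEdges U (s.mem 13) (s.reg 16))
        (s.reg 20 :: B') (Function.update (Function.update (s.mem 7) (s.reg 19)
          (tl (s.reg 20))) (s.reg 22) (hd (s.reg 20))) := by
  have hB := List.perm_cons_erase hs.mem_B
  have hw₁ := (hs.contraction.word hG.nodup hG.covers).1
  have hp := (permSign_edgeEnds (tl := tl) (hd := hd) hB).map (mergedRep h)
  rw [edgeEnds_cons, List.map_cons, List.map_cons, hs.tail_e, hs.head_e] at hp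
  have hn := hp.perm.nodup_iff.1 hw₁
  simp only [List.nodup_cons, List.mem_cons, not_or] at hn
  obtain ⟨⟨hwu, hw⟩, hu, hn⟩ := hn
  refine ⟨_, hB, fun he => ?_, fun he => ?_, ?_, ?_, ?_⟩
  · apply hwu
    rw [← hs.tail_e, ← hs.tail_f, he]
  · apply hu
    rw [← hs.head_e]
    exact List.mem_map_of_mem (mem_edgeEnds.2 ⟨_, he, Or.inr rfl⟩)
  · intro g hg
    rcases List.mem_cons.1 hg with rfl | hg
    exacts [Or.inr hs.live, Or.inl (List.mem_of_mem_erase hg)]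
  · rw [edgeEnds_cons, List.map_cons, List.map_cons, hs.tail_f, hs.head_f]
    -- The word starts with `w`, `u` for one edge and with `u`, `w` for the other: a single
    -- exchange.
    exact hp.swap [] _ _ _
  · intro z hz
    rw [edgeEnds_cons] at hz
    rcases List.mem_cons.1 hz with rfl | hz
    · rw [hs.tail_f, Function.update_of_ne (Ne.symm hwu), Function.update_self]
    rcases List.mem_cons.1 hz with rfl | hz
    · rw [hs.head_f, Function.update_self]
    · have hzw : mergedRep h z ≠ s.reg 22 := fun he => hw (he ▸ List.mem_map_of_mem hz)
      have hzu : mergedRep h z ≠ s.reg 19 := fun he => hu (he ▸ List.mem_map_of_mem hz)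
      rw [Function.update_of_ne hzw, Function.update_of_ne hzu]
      obtain ⟨g, hg, hgz⟩ := mem_edgeEnds.1 hz
      exact hs.base z (mem_edgeEnds.2 ⟨g, List.mem_of_mem_erase hg, hgz⟩)

theorem IsFound.wp_recoverMatching {W n m : ℕ} {tl hd : ℕ → ℕ} {M : List ℕ} {h : List MergeStep}
    {B : List ℕ} {U : Finset ℕ} {s : RAMState} (hG : IsMatchedDigraph n m tl hd M)
    (htl : ∀ g, tl g < n) (hhd : ∀ g, hd g < n) (hW : n < W)
    (hs : IsFound n m tl hd M h B U s) :
    Wp W recoverMatching s fun s' t => ∃ A,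
      PermSign true (edgeEnds tl hd M) (edgeEnds tl hd A) ∧
      (∀ g, s'.mem 3 g = if g ∈ A then 1 else 0) ∧ t ≤ 36 * n + 20 := by
  obtain ⟨B', hB, hef, heB, hA⟩ := hs.isOppositeMatching hG
  -- Every contraction costs two roots, so there are at most `n / 2` of them.
  have hk : 2 * h.length ≤ n := by have := hs.card_roots; omega
  simp only [recoverMatching, RAMProgram.block, Wp.seq_iff]
  simp only [exchangeEdges, RAMProgram.block, Wp.seq_iff, Wp.load_iff, Wp.store_iff, Wp.copy_iff]
  simp only [RAMState.reg_setReg, RAMState.mem_setReg, RAMState.reg_setMem, RAMState.mem_setMem]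
  norm_num [hs.tails, hs.heads, hs.reg_zero, hs.reg_one]
  refine (wp_clearPositions (n := n) ?_ ?_ ?_).mono ?_
  · simpa [RAMState.reg_setReg, RAMState.reg_setMem] using hs.reg_nodes
  · simpa [RAMState.reg_setReg, RAMState.reg_setMem] using hs.reg_zero
  · simpa [RAMState.reg_setReg, RAMState.reg_setMem] using hs.reg_one
  rintro s₁ t₁ ⟨hlo, hm₁, hr₁, ht₁⟩
  simp only [RAMState.reg_setReg, RAMState.mem_setReg, RAMState.reg_setMem,
    RAMState.mem_setMem] at hm₁ hr₁
  have e2 := hr₁ 2 (by omega)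
  have e3 := hr₁ 3 (by omega)
  have e17 := hr₁ 17 (by omega)
  norm_num [hs.reg_zero, hs.reg_one, hs.reg_steps] at e2 e3 e17
  have p0 := hm₁ 0 (by omega)
  have p1 := hm₁ 1 (by omega)
  have p3 := hm₁ 3 (by omega)
  have p7 := hm₁ 7 (by omega)
  norm_num [hs.tails, hs.heads] at p0 p1 p3 p7
  refine (wp_splitClasses hG.nodup hG.covers hW hs.contraction ?_ ?_ ?_ ?_ ?_).mono ?_
  · simpa [RAMState.reg_setReg] using e2
  · simpa [RAMState.reg_setReg] using e3
  · simpa [RAMState.reg_setReg] using e17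
  · refine hs.recorded.congr fun b hb hb' i _ => ?_
    rw [RAMState.mem_setReg, hm₁ b (by omega)]
    rw [if_neg (by omega), if_neg (by omega), if_neg (by omega), if_neg (by omega)]
  -- All final classes start at position zero and may overlap. This is harmless, as thresholds only
  -- compare nodes inside one class.
  · intro x hx
    rw [RAMState.mem_setReg, hlo _ (hs.forest.rep_lt x hx), zero_add]
    exact classSize_le _ _ _
  rintro s₂ t₂ ⟨-, hthr, -, hm₂, hr₂, ht₂⟩
  simp only [RAMState.reg_setReg, RAMState.mem_setReg] at hm₂ hr₂
  have f2 := hr₂ 2 (by omega)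
  have f3 := hr₂ 3 (by omega)
  have f17 := hr₂ 17 (by omega)
  norm_num [e2, e3, e17] at f2 f3 f17
  refine (wp_expandClasses (A := s.reg 20 :: B') htl hhd hG.nodup hG.covers hs.contraction ?_ ?_ ?_
    ?_ ?_ ?_ ?_ ?_ ?_).mono ?_
  · simpa [RAMState.reg_setReg] using f2
  · simpa [RAMState.reg_setReg] using f3
  · simpa [RAMState.reg_setReg] using f17
  · refine hs.recorded.congr fun b hb hb' i _ => ?_
    rw [RAMState.mem_setReg, hm₂ b (by omega) (by omega), hm₁ b (by omega)]
    rw [if_neg (by omega), if_neg (by omega), if_neg (by omega), if_neg (by omega)]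
  · rw [RAMState.mem_setReg, hm₂ 0 (by omega) (by omega), p0]
  · rw [RAMState.mem_setReg, hm₂ 1 (by omega) (by omega), p1]
  · rw [RAMState.mem_setReg, hm₂ 7 (by omega) (by omega), p7]
    exact hA
  · exact hthr
  · intro g
    rw [RAMState.mem_setReg, hm₂ 3 (by omega) (by omega), p3]
    simp only [Function.update_apply, hs.out, hB.mem_iff, List.mem_cons]
    grind
  rintro s₃ t₃ ⟨A, h₁, h₂, h₃⟩
  exact ⟨A, h₁, h₂, by omega⟩

end SearchState

/-! ### Initial lists, forest and degrees -/

namespace IsInLists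

variable {n m : ℕ} {hd rep first nxt last : ℕ → ℕ} {U : Finset ℕ}

theorem empty (h : ∀ r < n, first r = m) : IsInLists n m hd rep first nxt last ∅ :=
  ⟨fun _ => [], fun r hr _ => ⟨h r hr, List.nodup_nil, by simp, by simp⟩⟩

/-- Adding an edge at the front of a list. -/
theorem prepend (h : IsInLists n m hd rep first nxt last U) {g : ℕ} (hg : g ∉ U) (hgm : g ≠ m)
    {last' : ℕ → ℕ}
    (hlast : last' = if first (rep (hd g)) = m then Function.update last (rep (hd g)) g else last) :
    IsInLists n m hd rep (Function.update first (rep (hd g)) g)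
      (Function.update nxt g (first (rep (hd g)))) last' (insert g U) := by
  obtain ⟨L, hL⟩ := h
  refine ⟨Function.update L (rep (hd g)) (g :: L (rep (hd g))), fun r hr hrr => ?_⟩
  obtain ⟨k₁, k₂, k₃, k₄⟩ := hL r hr hrr
  have hgL : g ∉ L r := fun hgl => hg ((k₃ g).1 hgl).1
  by_cases he : r = rep (hd g)
  · subst he
    rw [Function.update_self, Function.update_self]
    refine ⟨⟨rfl, hgm, ?_⟩, List.nodup_cons.2 ⟨hgL, k₂⟩, fun g' => ?_, fun A x hA => ?_⟩
    · rw [Function.update_self]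
      exact k₁.update hgL
    · rw [List.mem_cons, k₃, Finset.mem_insert]
      grind
    · rw [hlast]
      cases A with
      | nil =>
        simp only [List.nil_append, List.cons.injEq] at hA
        rw [if_pos (k₁.eq_nil_iff.2 hA.2), Function.update_self, hA.1]
      | cons y A =>
        simp only [List.cons_append, List.cons.injEq] at hA
        rw [if_neg, k₄ A x hA.2]
        rw [k₁.eq_nil_iff, hA.2]
        simp
  · rw [Function.update_of_ne he, Function.update_of_ne he]
    refine ⟨k₁.update hgL, k₂, fun g' => ?_, fun A x hA => ?_⟩
    · rw [k₃, Finset.mem_insert]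
      grind
    · rw [← k₄ A x hA, hlast]
      split_ifs
      · rw [Function.update_of_ne he]
      · rfl

end IsInLists

/-- Ranks start at 1 because every level of the Ackermann hierarchy takes the value 1 at 0; only
from rank 1 on is level `a` guaranteed to exceed `n`. -/
theorem IsSetForest.discrete {n : ℕ} {p rk : ℕ → ℕ} (hp : ∀ v < n, p v = v)
    (hrk : ∀ v < n, rk v = 1) : IsSetForest n p rk id where
  parent_lt v hv := by rwa [hp v hv]
  rep_lt v hv := hv
  rep_parent v hv := by rw [hp v hv]
  rep_eq v _ _ := rfl
  parent_rep v hv := hp v hv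
  rank_lt v hv h := absurd (hp v hv) h
  rank_pos v hv := (hrk v hv).ge
  rank_le v hv := by
    rw [hrk v hv]
    simp
    omega

theorem forestPotential_discrete {n : ℕ} (a : ℕ) {p rk : ℕ → ℕ} (hp : ∀ v < n, p v = v)
    (hrk : ∀ v < n, rk v = 1) : forestPotential a n p rk = n * a := by
  unfold forestPotential
  rw [Finset.sum_congr rfl fun v hv => ?_, Finset.sum_const, Finset.card_range, smul_eq_mul]
  have := Finset.mem_range.1 hv
  rw [if_pos (hp v this), hrk v this, mul_one]

theorem eq_of_mem_ends {tl hd : ℕ → ℕ} {M : List ℕ} (hM : (edgeEnds tl hd M).Nodup) {e g x : ℕ}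
    (he : e ∈ M) (hg : g ∈ M) (hex : tl e = x ∨ hd e = x) (hgx : tl g = x ∨ hd g = x) : e = g := by
  by_contra hne
  have hp := (permSign_edgeEnds (tl := tl) (hd := hd) (List.perm_cons_erase he)).perm
  have hn := hp.nodup_iff.1 hM
  rw [edgeEnds_cons, List.nodup_cons, List.mem_cons, List.nodup_cons, not_or] at hn
  have : x ∈ edgeEnds tl hd (M.erase e) :=
    mem_edgeEnds.2 ⟨g, (List.mem_erase_of_ne (Ne.symm hne)).2 hg, hgx⟩
  rcases hex with rfl | rfl
  exacts [hn.1.2 this, hn.2.1 this]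

/-- An Eulerian digraph with a matching is balanced. -/
theorem isBalanced_of_card_eq {m : ℕ} {tl hd : ℕ → ℕ} {M : List ℕ} (hM : M.Nodup)
    (hMm : ∀ e ∈ M, e < m)
    (hE : ∀ r, ((Finset.range m).filter fun g => hd g = r).card =
      ((Finset.range m).filter fun g => tl g = r).card) (b : ℕ) :
    IsBalanced tl hd id ((Finset.range m).filter fun g => g ∉ M) M b b := by
  have key : ∀ (φ : ℕ → ℕ) (r : ℕ), classDegree φ ((Finset.range m).filter fun g => g ∉ M) M r =
      ((Finset.range m).filter fun g => φ g = r).card := by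
    intro φ r
    have h₁ : (M.countP fun g => φ g = r) = (M.toFinset.filter fun g => φ g = r).card := by
      rw [List.countP_eq_length_filter, ← List.toFinset_card_of_nodup (hM.filter _),
        List.toFinset_filter]
      simp
    rw [classDegree, h₁, ← Finset.card_union_of_disjoint]
    · congr 1
      ext g
      have := hMm g
      simp only [Finset.mem_union, Finset.mem_filter, Finset.mem_range, List.mem_toFinset]
      tauto
    · rw [Finset.disjoint_left]
      intro g
      simp only [Finset.mem_filter, List.mem_toFinset]
      tauto
  intro r
  rw [key, key]
  simp only [id_eq, hE]

/-! ### Preparing the search -/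

/-- Make every node a class. -/
def initNodes : RAMProgram :=
  .block
    [.copy 4 2, .loop (.lt 4 0)
      (.block [.store 4 4 4, .store 5 4 3, .store 7 4 4, .store 11 4 3, .store 8 4 1, .add 4 4 3])]

/-- Enter the edge in register `4` into the arrays. -/
def initEdge : RAMProgram :=
  .block
    [.load 5 2 4, .store 3 4 5, .load 6 0 4, .load 7 1 4,
      .branch (.eq 5 3) (.block [.store 6 6 4, .store 6 7 4])
        (.block [.load 8 8 7, .store 9 4 8, .store 8 7 4,
          .branch (.eq 8 1) (.store 10 7 4) .skip]),
      .add 4 4 3]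

/-- Prepare the search. -/
def prepareSearch : RAMProgram :=
  .block [.const 3 1, initNodes, .copy 4 2, .loop (.lt 4 1) initEdge]

theorem wp_initNodes {W n : ℕ} {s : RAMState} (hW : n + 1 < W) (h₀ : s.reg 0 = n)
    (h₂ : s.reg 2 = 0) (h₃ : s.reg 3 = 1) :
    Wp W initNodes s fun s' t => (∀ v < n, s'.mem 4 v = v ∧ s'.mem 5 v = 1 ∧ s'.mem 7 v = v ∧
        s'.mem 11 v = 1 ∧ s'.mem 8 v = s.reg 1) ∧
      (∀ i, i ≠ 4 → i ≠ 5 → i ≠ 7 → i ≠ 11 → i ≠ 8 → s'.mem i = s.mem i) ∧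
      (∀ r, r ≠ 4 → s'.reg r = s.reg r) ∧ t ≤ 7 * n + 2 := by
  simp only [initNodes, RAMProgram.block, Wp.seq_iff, Wp.copy_iff]
  refine (Wp.loop (I := fun p s' => s'.reg 4 ≤ n ∧ p = 7 * (n - s'.reg 4) ∧
    (∀ v < s'.reg 4, s'.mem 4 v = v ∧ s'.mem 5 v = 1 ∧ s'.mem 7 v = v ∧
        s'.mem 11 v = 1 ∧ s'.mem 8 v = s.reg 1) ∧
    (∀ i, i ≠ 4 → i ≠ 5 → i ≠ 7 → i ≠ 11 → i ≠ 8 → s'.mem i = s.mem i) ∧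
    (∀ r, r ≠ 4 → s'.reg r = s.reg r)) ?_ (p := 7 * n) ?_).mono ?_
  · rintro p s' ⟨hle, hp, hv, hm, hr⟩ hb
    simp only [RAMTest.Holds, hr 0 (by omega), h₀] at hb
    simp only [Wp.seq_iff, Wp.add_iff, Wp.store_iff, RAMState.reg_setReg, RAMState.mem_setReg,
      RAMState.reg_setMem, RAMState.mem_setMem]
    norm_num [hr 1, hr 3, h₃]
    refine ⟨by omega, _, ⟨by omega, rfl, fun v hv' => ?_, fun i h₁ h₂ h₃ h₄ h₅ => ?_,
      fun r hr' => ?_⟩, by omega⟩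
    · have := hv v
      simp only [Function.update_apply]
      split_ifs with hvv
      · exact ⟨hvv.symm, rfl, hvv.symm, rfl, rfl⟩
      · exact this (by omega)
    · simp [h₁, h₂, h₃, h₄, h₅, hm i h₁ h₂ h₃ h₄ h₅]
    · rw [if_neg hr', hr r hr']
  · simp only [RAMState.reg_setReg, RAMState.mem_setReg]
    norm_num [h₂]
    exact fun r hr h => absurd h hr
  · rintro s' t ⟨p', ⟨hle, hp, hv, hm, hr⟩, hb, ht⟩
    simp only [RAMTest.Holds, hr 0 (by omega), h₀] at hb
    exact ⟨fun v hv' => hv v (by omega), hm, hr, by omega⟩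

theorem wp_initEdges {W n m : ℕ} {tl hd : ℕ → ℕ} {M : List ℕ}
    (hG : IsMatchedDigraph n m tl hd M) {s : RAMState} (hW : m + 1 < W)
    (h₁ : s.reg 1 = m) (h₃ : s.reg 3 = 1) (h₄ : s.reg 4 = 0) (h0 : s.mem 0 = tl)
    (h1 : s.mem 1 = hd) (h2 : ∀ e < m, s.mem 2 e = if e ∈ M then 1 else 0)
    (h3 : ∀ g, s.mem 3 g = 0) (h8 : ∀ v < n, s.mem 8 v = m) :
    Wp W (.loop (.lt 4 1) initEdge) s fun s' t =>
      (∀ g, s'.mem 3 g = if g ∈ M then 1 else 0) ∧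
      (∀ e ∈ M, s'.mem 6 (tl e) = e ∧ s'.mem 6 (hd e) = e) ∧
      IsInLists n m hd id (s'.mem 8) (s'.mem 9) (s'.mem 10)
        ((Finset.range m).filter fun g => g ∉ M) ∧
      (∀ i, i ≠ 3 → i ≠ 6 → i ≠ 8 → i ≠ 9 → i ≠ 10 → s'.mem i = s.mem i) ∧
      (∀ r, r < 4 ∨ 8 < r → s'.reg r = s.reg r) ∧ t ≤ 12 * m + 1 := by
  refine (Wp.loop (I := fun p s' => s'.reg 4 ≤ m ∧ p = 12 * (m - s'.reg 4) ∧
    (∀ g, s'.mem 3 g = if g ∈ M ∧ g < s'.reg 4 then 1 else 0) ∧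
    (∀ e ∈ M, e < s'.reg 4 → s'.mem 6 (tl e) = e ∧ s'.mem 6 (hd e) = e) ∧
    IsInLists n m hd id (s'.mem 8) (s'.mem 9) (s'.mem 10)
      ((Finset.range (s'.reg 4)).filter fun g => g ∉ M) ∧
    (∀ i, i ≠ 3 → i ≠ 6 → i ≠ 8 → i ≠ 9 → i ≠ 10 → s'.mem i = s.mem i) ∧
    (∀ r, r < 4 ∨ 8 < r → s'.reg r = s.reg r)) ?_ (p := 12 * m) ?_).mono ?_
  · rintro p s' ⟨hle, hp, hout, hmate, hlists, hm, hr⟩ hb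
    simp only [RAMTest.Holds, hr 1 (by omega), h₁] at hb
    have q1 := hr 1 (by omega)
    have q3 := hr 3 (by omega)
    have p0 := hm 0 (by omega) (by omega) (by omega) (by omega) (by omega)
    have p1 := hm 1 (by omega) (by omega) (by omega) (by omega) (by omega)
    have p2 := hm 2 (by omega) (by omega) (by omega) (by omega) (by omega)
    rw [h₁] at q1
    rw [h₃] at q3
    rw [h0] at p0
    rw [h1] at p1
    have p2' := h2 _ hb
    rw [← p2] at p2'
    set e := s'.reg 4 with he
    simp only [initEdge, RAMProgram.block, Wp.seq_iff, Wp.add_iff, Wp.store_iff, Wp.load_iff,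
      Wp.branch_iff, Wp.skip_iff, RAMTest.Holds, RAMState.reg_setReg, RAMState.mem_setReg,
      RAMState.reg_setMem, RAMState.mem_setMem]
    norm_num [q1, q3, p0, p1, p2', ← he]
    refine ⟨fun heM => ⟨by omega, _, ⟨by omega, rfl, fun g => ?_, fun g hg hge => ?_, ?_,
      fun i k₁ k₂ k₃ k₄ k₅ => ?_, fun r hr' => ?_⟩, by omega⟩, fun heM => ?_⟩
    · rw [Function.update_apply, hout]
      grind
    -- Distinct matching edges share no node, so the new entries of array `6` do not overwrite
    -- earlier ones.
    · have h₁ := eq_of_mem_ends hG.nodup (x := tl g) heM hg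
      have h₂ := eq_of_mem_ends hG.nodup (x := hd g) heM hg
      have h₃ := hmate g hg
      simp only [Function.update_apply]
      grind
    · have : (Finset.range (e + 1)).filter (fun g => g ∉ M) =
          (Finset.range e).filter fun g => g ∉ M := by
        rw [Finset.range_add_one, Finset.filter_insert, if_neg (by simpa using heM)]
      rw [this]
      exact hlists
    · simp [k₁, k₂, hm i k₁ k₂ k₃ k₄ k₅]
    · rw [← hr r hr']; grind
    · have hset : (Finset.range (e + 1)).filter (fun g => g ∉ M) =
          insert e ((Finset.range e).filter fun g => g ∉ M) := by
        rw [Finset.range_add_one, Finset.filter_insert, if_pos heM]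
      have hpre := fun last' => hlists.prepend (g := e) (last' := last') (by simp) (by omega)
      rw [← hset] at hpre
      have hout' : ∀ g, Function.update (s'.mem 3) e (if e ∈ M then 1 else 0) g =
          if g ∈ M ∧ g ≤ e then 1 else 0 := by
        intro g
        rw [Function.update_apply, hout]
        grind
      have hmate' : ∀ g ∈ M, g ≤ e → s'.mem 6 (tl g) = g ∧ s'.mem 6 (hd g) = g := by
        intro g hg hge
        exact hmate g hg (lt_of_le_of_ne hge fun h => heM (h ▸ hg))
      refine ⟨fun hfirst => ⟨by omega, _, ⟨by omega, rfl, fun g => ?_, fun g hg hge => ?_, ?_,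
        fun i k₁ k₂ k₃ k₄ k₅ => ?_, fun r hr' => ?_⟩, by omega⟩, fun hfirst => ⟨by omega, _,
          ⟨by omega, rfl, fun g => ?_, fun g hg hge => ?_, ?_,
        fun i k₁ k₂ k₃ k₄ k₅ => ?_, fun r hr' => ?_⟩, by omega⟩⟩
      · exact hout' g
      · exact hmate' g hg (by omega)
      · apply hpre
        rw [id_eq, if_pos hfirst]
      · simp [k₁, k₃, k₄, k₅, hm i k₁ k₂ k₃ k₄ k₅]
      · rw [← hr r hr']; grind
      · exact hout' g
      · exact hmate' g hg (by omega)
      · apply hpre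
        rw [id_eq, if_neg hfirst]
      · simp [k₁, k₃, k₄, hm i k₁ k₂ k₃ k₄ k₅]
      · rw [← hr r hr']; grind
  · refine ⟨by omega, by rw [h₄]; rfl, fun g => ?_, fun e _ he => ?_, ?_, fun _ _ _ _ _ _ => rfl,
      fun _ _ => rfl⟩
    · rw [h3, h₄]; simp
    · rw [h₄] at he; omega
    · rw [h₄]; exact IsInLists.empty h8
  · rintro s' t ⟨p', ⟨hle, hp, hout, hmate, hlists, hm, hr⟩, hb, ht⟩
    simp only [RAMTest.Holds, hr 1 (by omega), h₁] at hb
    have he : s'.reg 4 = m := by omega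
    rw [he] at hlists hmate hout
    refine ⟨fun g => ?_, fun e he => hmate e he (hG.edge_lt e he), hlists, hm, hr, by omega⟩
    rw [hout]
    have := hG.edge_lt g
    grind

/-- The given digraph and matching, as the input of a program. -/
structure IsInput (n m : ℕ) (tl hd : ℕ → ℕ) (M : List ℕ) (s : RAMState) : Prop where
  nodes : s.reg 0 = n
  edges : s.reg 1 = m
  reg_zero : ∀ r, 2 ≤ r → s.reg r = 0
  tails : s.mem 0 = tl
  heads : s.mem 1 = hd
  flags : ∀ e < m, s.mem 2 e = if e ∈ M then 1 else 0
  mem_zero : ∀ i, 3 ≤ i → ∀ x, s.mem i x = 0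

theorem IsInput.wp_prepareSearch {W n m : ℕ} {tl hd : ℕ → ℕ} {M : List ℕ} {s : RAMState}
    (hs : IsInput n m tl hd M s) (hG : IsMatchedDigraph n m tl hd M) (hn : 0 < n)
    (hE : ∀ r, ((Finset.range m).filter fun g => hd g = r).card =
      ((Finset.range m).filter fun g => tl g = r).card) (hWn : n + 1 < W) (hWm : m + 1 < W)
    (a : ℕ) :
    Wp W prepareSearch s fun s' t =>
      SearchState n m tl hd M [] M ((Finset.range m).filter fun g => g ∉ M) s' ∧
      s'.reg 18 = 0 ∧ forestPotential a n (s'.mem 4) (s'.mem 5) = n * a ∧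
      t ≤ 7 * n + 12 * m + 10 := by
  simp only [prepareSearch, RAMProgram.block, Wp.seq_iff, Wp.const_iff, Wp.copy_iff]
  refine ⟨by omega, ?_⟩
  refine (wp_initNodes hWn (by simpa [RAMState.reg_setReg] using hs.nodes)
    (by simpa [RAMState.reg_setReg] using hs.reg_zero 2 (by omega))
    (by simp [RAMState.reg_setReg])).mono ?_
  rintro s₁ t₁ ⟨hv, hm₁, hr₁, ht₁⟩
  simp only [RAMState.reg_setReg, RAMState.mem_setReg] at hm₁ hr₁ hv
  norm_num [hs.edges] at hv
  have e1 := hr₁ 1 (by omega)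
  have e2 := hr₁ 2 (by omega)
  have e3 := hr₁ 3 (by omega)
  norm_num [hs.edges, hs.reg_zero] at e1 e2 e3
  have z : ∀ i, i = 0 ∨ i = 1 ∨ i = 2 ∨ i = 3 ∨ i = 6 ∨ i = 9 ∨ i = 10 ∨ 12 ≤ i →
      s₁.mem i = s.mem i := fun i hi =>
    hm₁ i (by omega) (by omega) (by omega) (by omega) (by omega)
  refine (wp_initEdges hG hWm ?_ ?_ ?_ ?_ ?_ ?_ ?_ ?_).mono ?_
  · simpa [RAMState.reg_setReg] using e1
  · simpa [RAMState.reg_setReg] using e3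
  · simpa [RAMState.reg_setReg] using e2
  · rw [RAMState.mem_setReg, z 0 (by omega), hs.tails]
  · rw [RAMState.mem_setReg, z 1 (by omega), hs.heads]
  · rw [RAMState.mem_setReg, z 2 (by omega)]; exact hs.flags
  · rw [RAMState.mem_setReg, z 3 (by omega)]; exact hs.mem_zero 3 le_rfl
  · rw [RAMState.mem_setReg]; exact fun v hv' => (hv v hv').2.2.2.2
  rintro s₂ t₂ ⟨hout, hmate, hlists, hm₂, hr₂, ht₂⟩
  simp only [RAMState.reg_setReg, RAMState.mem_setReg] at hm₂ hr₂
  have y : ∀ i, i = 4 ∨ i = 5 ∨ i = 7 ∨ i = 11 → s₂.mem i = s₁.mem i := fun i hi =>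
    hm₂ i (by omega) (by omega) (by omega) (by omega) (by omega)
  have y' : ∀ i, i = 0 ∨ i = 1 ∨ 12 ≤ i → s₂.mem i = s.mem i := fun i hi => by
    rw [hm₂ i (by omega) (by omega) (by omega) (by omega) (by omega), z i (by omega)]
  have x : ∀ r, r ≠ 3 → r < 4 ∨ 8 < r → s₂.reg r = s.reg r := fun r h₁ h₂ => by
    rw [hr₂ r h₂, if_neg (by omega), hr₁ r (by omega), if_neg h₁]
  have x16 : s₂.reg 16 = 0 := by rw [x 16 (by omega) (by omega), hs.reg_zero 16 (by omega)]
  have hnodup := nodup_of_nodup_edgeEnds hG.nodup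
  have h4 : ∀ v < n, s₂.mem 4 v = v := fun v hv' => by rw [y 4 (by omega)]; exact (hv v hv').1
  have h5 : ∀ v < n, s₂.mem 5 v = 1 := fun v hv' => by rw [y 5 (by omega)]; exact (hv v hv').2.1
  refine ⟨⟨?_, ?_, ?_, ?_, ?_, ?_, ?_, hout, ?_, hmate, ?_, hlists, ?_, ?_, trivial, ?_, .start _,
    ?_, ?_⟩, ?_, forestPotential_discrete a h4 h5, by omega⟩
  · rw [x 0 (by omega) (by omega), hs.nodes]
  · rw [x 1 (by omega) (by omega), hs.edges]
  · rw [x 2 (by omega) (by omega), hs.reg_zero 2 le_rfl]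
  · rw [hr₂ 3 (by omega), if_neg (by omega), e3]
  · rw [x 17 (by omega) (by omega), hs.reg_zero 17 (by omega)]; rfl
  · rw [y' 0 (by omega), hs.tails]
  · rw [y' 1 (by omega), hs.heads]
  · exact IsSetForest.discrete h4 h5
  · intro z hz
    rw [y 7 (by omega)]
    refine (hv _ ?_).2.2.1
    obtain ⟨e, he, h | h⟩ := mem_edgeEnds.1 hz
    · exact h ▸ hG.tail_lt e (hG.edge_lt e he)
    · exact h ▸ hG.head_lt e (hG.edge_lt e he)
  · intro r hr _
    rw [y 11 (by omega), (hv r hr).2.2.2.1, classSize]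
    have : (Finset.range n).filter (fun x => mergedRep [] x = r) = {r} := by
      ext x
      rw [Finset.mem_filter, Finset.mem_range, Finset.mem_singleton]
      exact ⟨fun hx => hx.2, fun hx => ⟨hx ▸ hr, hx⟩⟩
    rw [this, Finset.card_singleton]
  · rw [x16]
    have h12 := hs.mem_zero 12 (by omega)
    have h14 := hs.mem_zero 14 (by omega)
    rw [← y' 12 (by omega)] at h12
    rw [← y' 14 (by omega)] at h14
    refine ⟨fun j _ => ?_, fun j _ => rfl, fun j hj => ?_, fun j hj => by omega,
      fun j hj => by omega⟩
    · rw [h12]; exact hn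
    · rw [h14]; omega
  · exact fun g hg => Finset.mem_range.1 (Finset.mem_filter.1 hg).1
  · rw [x16]
    exact isBalanced_of_card_eq hnodup hG.edge_lt hE _
  · simp [mergedRep]
  · rw [x 18 (by omega) (by omega), hs.reg_zero 18 (by omega)]

/-! ### Translation between the digraph and its numbered edges -/

namespace MultiDigraph

variable {n m : ℕ} (G : MultiDigraph n m)

/-- The tail of an edge that is given by its number. -/
def tailNum (e : ℕ) : ℕ := if h : e < m then (G.tail ⟨e, h⟩ : ℕ) else 0

/-- The head of an edge that is given by its number. -/
def headNum (e : ℕ) : ℕ := if h : e < m then (G.head ⟨e, h⟩ : ℕ) else 0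

theorem tailNum_val (e : Fin m) : G.tailNum e = G.tail e := by simp [tailNum]

theorem headNum_val (e : Fin m) : G.headNum e = G.head e := by simp [headNum]

theorem tailNum_lt (hn : 0 < n) (e : ℕ) : G.tailNum e < n := by
  unfold tailNum
  split_ifs <;> omega

theorem headNum_lt (hn : 0 < n) (e : ℕ) : G.headNum e < n := by
  unfold headNum
  split_ifs <;> omega

theorem edgeEnds_map_val (l : List (Fin m)) :
    edgeEnds G.tailNum G.headNum (l.map Fin.val) = (G.endpoints l).map Fin.val := by
  induction l with
  | nil => rfl
  | cons e l ih =>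
    rw [List.map_cons, edgeEnds_cons, ih, tailNum_val, headNum_val]
    rfl

/-- The edges of a matching in increasing order. -/
def edgeList (M : Finset (Fin m)) : List (Fin m) := (List.finRange m).filter fun e => e ∈ M

theorem mem_edgeList {M : Finset (Fin m)} {e : Fin m} : e ∈ edgeList M ↔ e ∈ M := by
  simp [edgeList]

variable {G}

theorem IsPerfectMatching.isMatchedDigraph {M : Finset (Fin m)} (hM : G.IsPerfectMatching M)
    (hn : 0 < n) :
    IsMatchedDigraph n m G.tailNum G.headNum ((edgeList M).map Fin.val) where
  tail_lt g _ := G.tailNum_lt hn g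
  head_lt g _ := G.headNum_lt hn g
  edge_lt e he := by
    obtain ⟨e, -, rfl⟩ := List.mem_map.1 he
    exact e.2
  nodup := by
    rw [edgeEnds_map_val]
    exact (G.nodup_endpoints hM ((List.nodup_finRange m).filter _)
      fun e he => mem_edgeList.1 he).map Fin.val_injective
  covers x hx := by
    rw [edgeEnds_map_val]
    obtain ⟨e, ⟨he, hex⟩, -⟩ := hM ⟨x, hx⟩
    exact List.mem_map.2 ⟨⟨x, hx⟩, G.mem_endpoints.2 ⟨e, mem_edgeList.2 he, hex⟩, rfl⟩

theorem card_filter_range (φ : Fin m → Fin n) (ψ : ℕ → ℕ) (h : ∀ e : Fin m, ψ e = φ e) (r : ℕ) :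
    ((Finset.range m).filter fun g => ψ g = r).card =
      (Finset.univ.filter fun e => (φ e : ℕ) = r).card := by
  rw [← Finset.card_map Fin.valEmbedding]
  congr 1
  ext g
  simp only [Finset.mem_filter, Finset.mem_range, Finset.mem_map, Finset.mem_univ, true_and,
    Fin.valEmbedding_apply]
  constructor
  · rintro ⟨hg, hr⟩
    exact ⟨⟨g, hg⟩, by rw [← h]; exact hr, rfl⟩
  · rintro ⟨e, he, rfl⟩
    exact ⟨e.2, by rw [h, he]⟩

theorem IsEuler.card_eq (hG : G.IsEuler) (r : ℕ) :
    ((Finset.range m).filter fun g => G.headNum g = r).card =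
      ((Finset.range m).filter fun g => G.tailNum g = r).card := by
  rw [card_filter_range G.head _ G.headNum_val, card_filter_range G.tail _ G.tailNum_val]
  by_cases hr : r < n
  · have := hG ⟨r, hr⟩
    simpa only [Fin.ext_iff] using this
  · rw [Finset.filter_false_of_mem fun e _ => by omega,
      Finset.filter_false_of_mem fun e _ => by omega]

/-- Every node is met by a matching edge. If it is the tail, then Euler's condition supplies another
edge that enters the node. So every node is a head, and terms linear in the number of nodes are
absorbed by the number of edges. -/
theorem IsEuler.card_nodes_le (hG : G.IsEuler) {M : Finset (Fin m)}
    (hM : G.IsPerfectMatching M) : n ≤ m := by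
  have : Function.Surjective G.head := by
    intro v
    obtain ⟨e, ⟨-, he | he⟩, -⟩ := hM v
    · have h : 0 < (Finset.univ.filter fun e => G.tail e = v).card :=
        Finset.card_pos.2 ⟨e, by simp [he]⟩
      rw [← hG v] at h
      obtain ⟨f, hf⟩ := Finset.card_pos.1 h
      exact ⟨f, by simpa using hf⟩
    · exact ⟨e, he⟩
  simpa using Fintype.card_le_of_surjective _ this

theorem isInput_initialState (G : MultiDigraph n m) (M : Finset (Fin m)) :
    IsInput n m G.tailNum G.headNum ((edgeList M).map Fin.val) (initialState G M) where
  nodes := rfl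
  edges := rfl
  reg_zero r hr := by
    match r, hr with
    | r + 2, _ => rfl
  tails := rfl
  heads := rfl
  flags e he := by
    have : e ∈ (edgeList M).map Fin.val ↔ (⟨e, he⟩ : Fin m) ∈ M := by
      simp only [List.mem_map, mem_edgeList]
      exact ⟨fun ⟨f, hf, hfe⟩ => by subst hfe; exact hf, fun h => ⟨_, h, rfl⟩⟩
    simp [initialState, edgeFlags, he, this]
  mem_zero i hi x := by
    match i, hi with
    | i + 3, _ => rfl

/-- A list of edges whose ends are an odd rearrangement of those of a perfect matching is a perfect
matching of opposite sign. -/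
theorem IsPerfectMatching.of_permSign {M : Finset (Fin m)} (hM : G.IsPerfectMatching M)
    (hn : 0 < n) {A : List ℕ}
    (hA : PermSign true (edgeEnds G.tailNum G.headNum ((edgeList M).map Fin.val))
      (edgeEnds G.tailNum G.headNum A)) :
    ∃ M' : Finset (Fin m), G.IsPerfectMatching M' ∧ G.sign M' = -G.sign M ∧
      ∀ i < m, (if i ∈ A then 1 else 0) = edgeFlags M' i := by
  have hG := hM.isMatchedDigraph hn
  have hnd := hA.perm.nodup_iff.1 hG.nodup
  have hlt : ∀ g ∈ A, g < m := by
    intro g hg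
    by_contra hgm
    have hp := (permSign_edgeEnds (tl := G.tailNum) (hd := G.headNum)
      (List.perm_cons_erase hg)).perm
    have := hp.nodup_iff.1 hnd
    rw [edgeEnds_cons, List.nodup_cons, List.mem_cons, not_or] at this
    -- An index that is not an edge would get tail and head `0`, hence a repeated entry in the word.
    exact this.1.1 (by simp [tailNum, headNum, hgm])
  obtain ⟨l, rfl⟩ : ∃ l : List (Fin m), l.map Fin.val = A :=
    ⟨A.pmap Fin.mk hlt, by simp [List.map_pmap]⟩
  have hlnd : l.Nodup := (nodup_of_nodup_edgeEnds hnd).of_map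
  -- Reduction modulo `n` is a left inverse of the inclusion of `Fin n`, and `PermSign.map` carries
  -- the parity along it.
  have hmod : ∀ l : List (Fin n),
      (l.map Fin.val).map (fun i => (⟨i % n, Nat.mod_lt i hn⟩ : Fin n)) = l := by
    intro l
    rw [List.map_map]
    conv_rhs => rw [← List.map_id l]
    refine List.map_congr_left fun v _ => ?_
    simp [Nat.mod_eq_of_lt v.2]
  have hsign := hA.map fun i => (⟨i % n, Nat.mod_lt i hn⟩ : Fin n)
  rw [edgeEnds_map_val, edgeEnds_map_val, hmod, hmod] at hsign
  have hM' : G.IsPerfectMatching l.toFinset := by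
    intro v
    have hv : v ∈ G.endpoints l := by
      obtain ⟨e, ⟨he, hev⟩, -⟩ := hM v
      exact hsign.perm.mem_iff.1 (G.mem_endpoints.2 ⟨e, mem_edgeList.2 he, hev⟩)
    obtain ⟨e, he, hev⟩ := G.mem_endpoints.1 hv
    refine ⟨e, ⟨by simpa using he, hev⟩, ?_⟩
    rintro f ⟨hf, hfv⟩
    apply Fin.val_injective
    refine eq_of_mem_ends hnd (x := v) (List.mem_map_of_mem (by simpa using hf))
      (List.mem_map_of_mem he) ?_ ?_
    · rw [tailNum_val, headNum_val]
      exact hfv.imp (congrArg _) (congrArg _)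
    · rw [tailNum_val, headNum_val]
      exact hev.imp (congrArg _) (congrArg _)
  refine ⟨l.toFinset, hM', ?_, fun i hi => ?_⟩
  · rw [← G.sign_eq_of_toFinset_eq hM' hlnd rfl, hsign.neg_one_pow_inversions
      (G.nodup_endpoints hM ((List.nodup_finRange m).filter _) fun e he => mem_edgeList.1 he)]
    simp [sign, edgeList]
  · have : i ∈ l.map Fin.val ↔ (⟨i, hi⟩ : Fin m) ∈ l := by
      simp only [List.mem_map]
      exact ⟨fun ⟨f, hf, hfe⟩ => by subst hfe; exact hf, fun h => ⟨_, h, rfl⟩⟩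
    simp [edgeFlags, hi, this]

end MultiDigraph

/-- Find a perfect matching of opposite sign. -/
def findOppositeMatching : RAMProgram :=
  .block [prepareSearch, searchLoop, recoverMatching]

theorem searchWeight_le {n m : ℕ} {h : List MergeStep} {U : Finset ℕ} {s : RAMState}
    (hU : U ⊆ Finset.range m) : searchWeight n m h U s ≤ 2 * m + 3 * n + 1 := by
  have h₁ := Finset.card_le_card hU
  have h₂ := Finset.card_filter_le (Finset.range n) fun x => mergedRep h x = x
  rw [Finset.card_range] at h₁ h₂
  unfold searchWeight
  split_ifs <;> omega

theorem IsInput.wp_findOppositeMatching {W n m a : ℕ} {tl hd : ℕ → ℕ} {M : List ℕ} {s : RAMState}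
    (hs : IsInput n m tl hd M s) (hG : IsMatchedDigraph n m tl hd M) (hn : 0 < n)
    (htl : ∀ g, tl g < n) (hhd : ∀ g, hd g < n)
    (hE : ∀ r, ((Finset.range m).filter fun g => hd g = r).card =
      ((Finset.range m).filter fun g => tl g = r).card) (hWn : n + 1 < W) (hWm : m + 1 < W)
    (ha : n < ackermannLevel a 1) :
    Wp W findOppositeMatching s fun s' t => ∃ A,
      PermSign true (edgeEnds tl hd M) (edgeEnds tl hd A) ∧
      (∀ g, s'.mem 3 g = if g ∈ A then 1 else 0) ∧
      t ≤ 43 * n + 12 * m + 31 + 10 * (n * a) + (30 * a + 120) * (2 * m + 3 * n + 1 + 1) := by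
  simp only [findOppositeMatching, RAMProgram.block, Wp.seq_iff]
  refine (hs.wp_prepareSearch hG hn hE hWn hWm a).mono ?_
  rintro s₁ t₁ ⟨hs₁, h18, hΦ, ht₁⟩
  refine (hs₁.wp_searchLoop hG ha hWn h18).mono ?_
  rintro s₂ t₂ ⟨⟨h, B, U, hs₂⟩, ht₂⟩
  refine (hs₂.wp_recoverMatching hG htl hhd (by omega)).mono ?_
  rintro s₃ t₃ ⟨A, hA, hout, ht₃⟩
  refine ⟨A, hA, hout, ?_⟩
  rw [hΦ] at ht₂
  have := Nat.mul_le_mul_left (30 * a + 120) (Nat.add_le_add_right (searchWeight_le (n := n)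
    (h := []) (s := s₁) (Finset.filter_subset (fun g => g ∉ M) (Finset.range m))) 1)
  omega

/-- There is a program that, given an Euler digraph `G` with at least one node and a perfect
matching `M` of `G`, finds a perfect matching `M'` of opposite sign in time
`O(|E| · α(|V|))` on words of `O(log (|V| + |E|))` bits. -/
theorem theorem5 :
    ∃ (P : RAMProgram) (C k : ℕ), ∀ (n m : ℕ) (G : MultiDigraph n m) (M : Finset (Fin m)),
      0 < n → G.IsEuler → G.IsPerfectMatching M →
        ∃ (s : RAMState) (t : ℕ) (M' : Finset (Fin m)),
          RAMRun ((n + m + 2) ^ k) P (initialState G M) s t ∧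
          t ≤ C * (m * max 1 (inverseAckermann n)) ∧
          IsOutput s M' ∧
          G.IsPerfectMatching M' ∧
          G.sign M' = -G.sign M := by
  -- With `n ≤ m` and `1 ≤ m` the step bound is at most 86 + 20 + 1260 times `m * max 1 α(n)`, so
  -- 2000 is a generous constant. The machine only needs words that exceed `n + 1` and `m + 1`.
  refine ⟨findOppositeMatching, 2000, 2, fun n m G M hn hE hM => ?_⟩
  have hnm := hE.card_nodes_le hM
  obtain ⟨s, t, hrun, A, hA, hout, ht⟩ :=
    (MultiDigraph.isInput_initialState G M).wp_findOppositeMatching (W := (n + m + 2) ^ 2)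
      (hM.isMatchedDigraph hn) hn (G.tailNum_lt hn) (G.headNum_lt hn) hE.card_eq
      (by nlinarith) (by nlinarith) (ackermannLevel_succ_inverseAckermann n)
  obtain ⟨M', hM', hsign, hflags⟩ := hM.of_permSign hn hA
  refine ⟨s, t, M', hrun, ht.trans ?_, fun i hi => ?_, hM', hsign⟩
  · set b := max 1 (inverseAckermann n) with hb
    have h₁ : 1 ≤ b := le_max_left _ _
    have h₂ : inverseAckermann n ≤ b := le_max_right _ _
    have h₃ : m * 1 ≤ m * b := Nat.mul_le_mul_left m h₁
    have h₄ : n * (inverseAckermann n + 1) ≤ m * (2 * b) := Nat.mul_le_mul hnm (by omega)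
    have h₅ : (30 * (inverseAckermann n + 1) + 120) * (2 * m + 3 * n + 1 + 1) ≤ (180 * b) * (7 * m) :=
      Nat.mul_le_mul (by omega) (by omega)
    have h₆ : (180 * b) * (7 * m) = 1260 * (m * b) := by ring
    have h₇ : m * (2 * b) = 2 * (m * b) := by ring
    omega
  · rw [hout, hflags i hi]
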